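/- **Theorem (choice-free duality for cylindric ortholattices).** Let $I$ be a set. *Algebras.* An ortholattice is a bounded lattice $A$ with a map $^\perp\colon A\to A$ such that $a\wedge a^\perp=0$, $a\vee a^\perp=1$, $a\le b\Rightarrow b^\perp\le a^\perp$ and $a^{\perp\perp}=a$. A quantifier on $A$ is a map $\exists\colon A\to A$ with $\exists(a\vee b)=\exists a\vee\exists b$, $\exists 0=0$, $\exists\exists a=\exists a$, $a\le\exists a$ and $\exists(\exists a)^\perp=(\exists a)^\perp$. An $I$-dimensional cylindric ortholattice is an ortholattice with quantifiers $(\exists_i)_{i\in I}$ and constants $(\delta_{i,k})_{i,k\in I}$ such that $\exists_i\exists_k a=\exists_k\exists_i a$, $\delta_{i,k}=\delta_{k,i}$, $\delta_{i,i}=1$, and $\exists_k(\delta_{i,k}\wedge\delta_{k,l})=\delta_{i,l}$ whenever $i\neq k$ and $l\neq k$. With the bounded lattice homomorphisms that preserve $^\perp$, all $\exists_i$ and all $\delta_{i,k}$, they form the category $\mathcal{COL}$. *Spaces.* Let $X$ be a set with an irreflexive symmetric relation $\perp$. For $U\subseteq X$ let $U^\perp=\{x: x\perp y\text{ for all }y\in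 U\}$; $U$ is biorthogonally closed if $U=U^{\perp\perp}$. For a relation $R$ on $X$ let $R[U]=\{y: xRy\text{ for some }x\in U\}$ and $\exists_RU=R[U]^{\perp\perp}$. An $I$-dimensional cylindric UVO-space is a $T_0$ topological space $X$ with such a $\perp$, relations $(R_i)_{i\in I}$ and subsets $(\Delta_{i,k})_{i,k\in I}$ such that, writing $\mathcal{CO}(X)$ for the set of compact open sets and $\mathcal{COB}(X)$ for the set of compact open biorthogonally closed sets, for all $i,k,l\in I$: 1. $R_i$ is reflexive and transitive, $R_i[R_i[\{x\}]^\perp]\subseteq R_i[\{x\}]^\perp$ for all $x$, and $R_i\circ R_k=R_k\circ R_i$; 2. $\Delta_{i,k}=\Delta_{k,i}=\Delta_{i,k}^{\perp\perp}$, $\Delta_{i,i}=X$, $\Delta_{i,k}\in\mathcal{CO}(X)$, and $R_k[\Delta_{i,k}\cap\Delta_{k,l}]=\Delta_{i,l}$ whenever $i\neq k$ and $l\neq k$; 3. $\mathcal{COB}(X)$ is a basis of $X$ and is closed under $\cap$ and $^\perp$; 4. every proper filter of $(\mathcal{COB}(X),\subseteq)$ is of the form $\{U\in\mathcal{COB}(X):x\in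 U\}$ for some $x\in X$; 5. if $x\perp y$, there is $U\in\mathcal{COB}(X)$ with $x\in U$ and $y\in U^\perp$; 6. $R_i[U]\in\mathcal{COB}(X)$ for all $U\in\mathcal{COB}(X)$, and if not $xR_iy$, there is $V\in\mathcal{COB}(X)$ with $x\in V$, $\exists_{R_i}V\in\mathcal{COB}(X)$ and $y\notin\exists_{R_i}V$. A cylindric UVO-map is a map $f\colon X\to X'$ such that $f^{-1}[U]\in\mathcal{CO}(X)$ for $U\in\mathcal{CO}(X')$; $x\not\perp y$ implies $f(x)\not\perp f(y)$; if $z\not\perp f(y)$, there is $x$ with $x\not\perp y$ and $z\leqslant f(x)$ in the specialization order ($z\leqslant w$ iff every open set containing $z$ contains $w$); $R_i[f^{-1}[U]]=f^{-1}[R'_i[U]]$ for $U\in\mathcal{COB}(X')$; and $f^{-1}[\Delta'_{i,k}]=\Delta_{i,k}$. These spaces and maps form the category $\mathcal{CUVO}$. *Functors.* For a cylindric ortholattice $A$, $\mathcal S_0(A)$ is the set of proper (non-empty) filters of $A$ with the topology generated by the sets $\phi(a)=\{x:a\in x\}$, $a\in A$, with $x\perp y$ iff $a^\perp\in y$ for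 some $a\in x$, with $xR_iy$ iff $\{\exists_ia:a\in x\}\subseteq y$, and with $\Delta_{i,k}=\phi(\delta_{i,k})$; for a homomorphism $h$, $\mathcal S_1(h)=h^{-1}$. For a cylindric UVO-space $X$, $\mathcal A_0(X)=\langle\mathcal{COB}(X);\cap,\sqcup,{}^\perp,\emptyset,X,(\exists_{R_i})_{i\in I},(\Delta_{i,k})_{i,k\in I}\rangle$ with $U\sqcup V=(U\cup V)^{\perp\perp}$; for a cylindric UVO-map $f$, $\mathcal A_1(f)=f^{-1}$. *Claim.* $\mathcal S_F=\langle\mathcal S_0,\mathcal S_1\rangle\colon\mathcal{COL}\to\mathcal{CUVO}$ and $\mathcal A_F=\langle\mathcal A_0,\mathcal A_1\rangle\colon\mathcal{CUVO}\to\mathcal{COL}$ are contravariant functors that constitute a dual equivalence between $\mathcal{COL}$ and $\mathcal{CUVO}$: the maps $\phi\colon A\to\mathcal A_0(\mathcal S_0(A))$, $a\mapsto\phi(a)$, and $\psi\colon X\to\mathcal S_0(\mathcal A_0(X))$, $x\mapsto\{U\in\mathcal{COB}(X):x\in U\}$, are natural isomorphisms $\mathrm{id}_{\mathcal{COL}}\cong\mathcal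 A_F\circ\mathcal S_F$ and $\mathrm{id}_{\mathcal{CUVO}}\cong\mathcal S_F\circ\mathcal A_F$. Moreover the duality holds in ZF, without the axiom of choice: in every model of ZF, and for every set $I$ of the model, the categories and functors formed inside the model constitute a dual equivalence with the natural isomorphisms $\phi$ and $\psi$. -/

import Mathlib

open CategoryTheory

universe u v w

/-! ## Cylindric ortholattices -/

/-- An ortholattice: a bounded lattice with an orthocomplementation, written `aᶜ`. -/
class Ortholattice (A : Type v) extends Lattice A, BoundedOrder A, Compl A where
  inf_compl : ∀ a : A, a ⊓ aᶜ = ⊥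
  sup_compl : ∀ a : A, a ⊔ aᶜ = ⊤
  compl_anti : ∀ a b : A, a ≤ b → bᶜ ≤ aᶜ
  compl_compl : ∀ a : A, aᶜᶜ = a

/-- Quantifiers on an ortholattice. -/
structure IsQuantifier {A : Type v} [Ortholattice A] (q : A → A) : Prop where
  map_sup : ∀ a b, q (a ⊔ b) = q a ⊔ q b
  map_bot : q ⊥ = ⊥
  idem : ∀ a, q (q a) = q a
  le : ∀ a, a ≤ q a
  compl : ∀ a, q (q a)ᶜ = (q a)ᶜ

/-- The structure of an `I`-dimensional cylindric ortholattice on an ortholattice `A`. -/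
class CylindricOrtholattice (I : Type u) (A : Type v) [Ortholattice A] where
  ex : I → A → A
  diag : I → I → A
  quantifier : ∀ i, IsQuantifier (ex i)
  ex_comm : ∀ i k a, ex i (ex k a) = ex k (ex i a)
  diag_symm : ∀ i k, diag i k = diag k i
  diag_self : ∀ i, diag i i = ⊤
  ex_diag : ∀ i k l, i ≠ k → l ≠ k → ex k (diag i k ⊓ diag k l) = diag i l

open CylindricOrtholattice (ex diag)

/-- Homomorphisms of `I`-dimensional cylindric ortholattices. -/
structure CylHom (I : Type u) (A : Type v) (B : Type w) [Ortholattice A] [Ortholattice B]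
    [CylindricOrtholattice I A] [CylindricOrtholattice I B] extends BoundedLatticeHom A B where
  map_compl' : ∀ a, toFun aᶜ = (toFun a)ᶜ
  map_ex' : ∀ (i : I) a, toFun (ex i a) = ex i (toFun a)
  map_diag' : ∀ i k : I, toFun (diag i k) = diag i k

namespace CylHom

instance instFunLike (I : Type u) (A : Type v) (B : Type w) [Ortholattice A] [Ortholattice B]
    [CylindricOrtholattice I A] [CylindricOrtholattice I B] : FunLike (CylHom I A B) A B where
  coe h := h.toFun
  coe_injective := by
    rintro ⟨⟨⟨⟨f, _⟩, _⟩, _, _⟩, _, _, _⟩ ⟨⟨⟨⟨g, _⟩, _⟩, _, _⟩, _, _, _⟩ h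
    cases h
    rfl

/-- The identity homomorphism. -/
protected def id (I : Type u) (A : Type v) [Ortholattice A] [CylindricOrtholattice I A] :
    CylHom I A A where
  toBoundedLatticeHom := BoundedLatticeHom.id A
  map_compl' _ := rfl
  map_ex' _ _ := rfl
  map_diag' _ _ := rfl

/-- `h.comp g` is `g` after `h`. -/
protected def comp {I : Type u} {A B C : Type*} [Ortholattice A] [Ortholattice B] [Ortholattice C]
    [CylindricOrtholattice I A] [CylindricOrtholattice I B] [CylindricOrtholattice I C]
    (h : CylHom I A B) (g : CylHom I B C) : CylHom I A C where
  toBoundedLatticeHom := g.toBoundedLatticeHom.comp h.toBoundedLatticeHom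
  map_compl' a := (congrArg g.toFun (h.map_compl' a)).trans (g.map_compl' _)
  map_ex' i a := (congrArg g.toFun (h.map_ex' i a)).trans (g.map_ex' i _)
  map_diag' i k := (congrArg g.toFun (h.map_diag' i k)).trans (g.map_diag' i k)

end CylHom

/-- The category `COL` of `I`-dimensional cylindric ortholattices. -/
structure COL (I : Type u) where
  carrier : Type v
  [ortholattice : Ortholattice carrier]
  [cylindric : CylindricOrtholattice I carrier]

attribute [instance] COL.ortholattice COL.cylindric

instance COL.instCategory (I : Type u) : Category (COL.{u, v} I) where
  Hom A B := CylHom I A.carrier B.carrier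
  id A := CylHom.id I A.carrier
  comp h g := h.comp g

/-- Proper filters of a bounded lattice. -/
structure IsProperFilter {A : Type v} [Lattice A] (x : Set A) : Prop where
  nonempty : x.Nonempty
  upward : ∀ a b, a ∈ x → a ≤ b → b ∈ x
  inf_mem : ∀ a b, a ∈ x → b ∈ x → a ⊓ b ∈ x
  proper : x ≠ Set.univ

/-! ## Cylindric orthoframes -/

/-- `U^⊥`, the set of points orthogonal to every point of `U`. -/
def orth {X : Type v} (perp : X → X → Prop) (U : Set X) : Set X := {x | ∀ y ∈ U, perp x y}

/-- `R[U]`, the relational image of `U`. -/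
def relImage {X : Type v} (R : X → X → Prop) (U : Set X) : Set X := {y | ∃ x ∈ U, R x y}

/-- `U` is biorthogonally closed. -/
def IsBiorth {X : Type v} (perp : X → X → Prop) (U : Set X) : Prop := orth perp (orth perp U) = U

structure IsOrthoframe {X : Type v} (perp : X → X → Prop) : Prop where
  irrefl : ∀ x, ¬ perp x x
  symm : ∀ x y, perp x y → perp y x

structure IsMonadicOrthoframe {X : Type v} (perp R : X → X → Prop) : Prop
    extends IsOrthoframe perp where
  refl : ∀ x, R x x
  trans : ∀ x y z, R x y → R y z → R x z
  image_orth : ∀ x, relImage R (orth perp (relImage R {x})) ⊆ orth perp (relImage R {x})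

structure IsCylindricOrthoframe {I : Type u} {X : Type v} (perp : X → X → Prop)
    (R : I → X → X → Prop) (Δ : I → I → Set X) : Prop extends IsOrthoframe perp where
  monadic : ∀ i, IsMonadicOrthoframe perp (R i)
  comm : ∀ i k x z, (∃ y, R i x y ∧ R k y z) ↔ ∃ y, R k x y ∧ R i y z
  diag_symm : ∀ i k, Δ i k = Δ k i
  diag_biorth : ∀ i k, IsBiorth perp (Δ i k)
  diag_self : ∀ i, Δ i i = Set.univ
  image_diag : ∀ i k l, i ≠ k → l ≠ k → relImage (R k) (Δ i k ∩ Δ k l) = Δ i l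

/-! ## Cylindric UVO-spaces -/

/-- `𝓕` is a proper filter in the family `C` of sets, ordered by inclusion and closed
under intersection. -/
structure IsProperFilterIn {X : Type v} (C 𝓕 : Set (Set X)) : Prop where
  subset : 𝓕 ⊆ C
  nonempty : 𝓕.Nonempty
  upward : ∀ U W, U ∈ 𝓕 → W ∈ C → U ⊆ W → W ∈ 𝓕
  inter_mem : ∀ U W, U ∈ 𝓕 → W ∈ 𝓕 → U ∩ W ∈ 𝓕
  proper : 𝓕 ≠ C

section Spaces

variable {I : Type u} {X : Type v} [TopologicalSpace X]

/-- `CO(X)`, the compact open sets. -/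
def CO (X : Type v) [TopologicalSpace X] : Set (Set X) := {U | IsCompact U ∧ IsOpen U}

/-- `COB(X)`, the compact open biorthogonally closed sets. -/
def COB (perp : X → X → Prop) : Set (Set X) := {U | U ∈ CO X ∧ IsBiorth perp U}

/-- Upper Vietoris orthospaces. -/
structure IsUVOSpace (perp : X → X → Prop) : Prop extends IsOrthoframe perp where
  t0 : T0Space X
  basis : TopologicalSpace.IsTopologicalBasis (COB perp)
  inter_mem : ∀ U W, U ∈ COB perp → W ∈ COB perp → U ∩ W ∈ COB perp
  orth_mem : ∀ U, U ∈ COB perp → orth perp U ∈ COB perp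
  filter : ∀ 𝓕, IsProperFilterIn (COB perp) 𝓕 → ∃ x, 𝓕 = {U | U ∈ COB perp ∧ x ∈ U}
  perp_sep : ∀ x y, perp x y → ∃ U ∈ COB perp, x ∈ U ∧ y ∈ orth perp U

/-- Monadic UVO-spaces. -/
structure IsMonadicUVOSpace (perp R : X → X → Prop) : Prop
    extends IsUVOSpace perp, IsMonadicOrthoframe perp R where
  image_mem : ∀ U, U ∈ COB perp → relImage R U ∈ COB perp
  rel_sep : ∀ x y, ¬ R x y → ∃ U ∈ COB perp,
    (∃ W ∈ COB perp, x ∈ W ∧ U = orth perp (orth perp (relImage R W))) ∧ y ∉ U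

/-- `I`-dimensional cylindric UVO-spaces; the conditions that do not mention the relations `R i`
are required also when `I` is empty. -/
structure IsCylindricUVOSpace (perp : X → X → Prop) (R : I → X → X → Prop)
    (Δ : I → I → Set X) : Prop extends IsUVOSpace perp, IsCylindricOrthoframe perp R Δ where
  monadicUVO : ∀ i, IsMonadicUVOSpace perp (R i)
  diag_mem : ∀ i k, Δ i k ∈ CO X

end Spaces

/-- The objects of the category `CUVO` of `I`-dimensional cylindric UVO-spaces. -/
structure CUVO (I : Type u) where
  carrier : Type v
  [top : TopologicalSpace carrier]
  perp : carrier → carrier → Prop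
  R : I → carrier → carrier → Prop
  Δ : I → I → Set carrier
  isCylindric : IsCylindricUVOSpace perp R Δ

attribute [instance] CUVO.top

/-- `I`-dimensional cylindric UVO-maps; the inequality `z ⩽ f x` in `lift` is the
specialization order. -/
structure IsCUVOMap {I : Type u} (X Y : CUVO.{u, v} I) (f : X.carrier → Y.carrier) : Prop where
  spectral : ∀ U, U ∈ CO Y.carrier → f ⁻¹' U ∈ CO X.carrier
  nonperp : ∀ x y, ¬ X.perp x y → ¬ Y.perp (f x) (f y)
  lift : ∀ z y, ¬ Y.perp z (f y) →
    ∃ x, ¬ X.perp x y ∧ ∀ U : Set Y.carrier, IsOpen U → z ∈ U → f x ∈ U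
  image : ∀ i U, U ∈ COB Y.perp → relImage (X.R i) (f ⁻¹' U) = f ⁻¹' relImage (Y.R i) U
  diag : ∀ i k, f ⁻¹' Y.Δ i k = X.Δ i k

section Orth

variable {X : Type v} {Y : Type w} {perp : X → X → Prop} {perp' : Y → Y → Prop}

theorem orth_anti {U W : Set X} (h : U ⊆ W) : orth perp W ⊆ orth perp U :=
  fun _ hx y hy => hx y (h hy)

theorem subset_orth_orth (hp : IsOrthoframe perp) (U : Set X) : U ⊆ orth perp (orth perp U) :=
  fun x hx y hy => hp.symm y x (hy x hx)

theorem isBiorth_orth (hp : IsOrthoframe perp) (U : Set X) : IsBiorth perp (orth perp U) :=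
  Set.Subset.antisymm (orth_anti (subset_orth_orth hp U)) (subset_orth_orth hp _)

theorem inter_orth (hp : IsOrthoframe perp) (U : Set X) : U ∩ orth perp U = ∅ := by
  ext x
  simp only [Set.mem_inter_iff, Set.mem_empty_iff_false, iff_false, not_and]
  exact fun hx h => hp.irrefl x (h x hx)

/-- Preimages under a frame morphism commute with `^⊥` on the sets that are closed upwards
for the relation used in the lifting condition. -/
theorem preimage_orth {f : X → Y} {le : Y → Y → Prop} {U : Set Y}
    (hp : IsOrthoframe perp) (hp' : IsOrthoframe perp')
    (h2 : ∀ x y, ¬ perp x y → ¬ perp' (f x) (f y))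
    (h3 : ∀ z y, ¬ perp' z (f y) → ∃ x, ¬ perp x y ∧ le z (f x))
    (hU : ∀ z w, le z w → z ∈ U → w ∈ U) :
    f ⁻¹' orth perp' U = orth perp (f ⁻¹' U) := by
  ext x
  constructor
  · intro hx y hy
    by_contra h
    exact h2 x y h (hx _ hy)
  · intro hx z hz
    by_contra h
    obtain ⟨w, hw, hle⟩ := h3 z x fun h' => h (hp'.symm _ _ h')
    exact hw (hp.symm _ _ (hx w (hU _ _ hle hz)))

end Orth

theorem IsCUVOMap.preimage_mem {I : Type u} {X Y : CUVO.{u, v} I} {f : X.carrier → Y.carrier}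
    (hf : IsCUVOMap X Y f) {U : Set Y.carrier} (hU : U ∈ COB Y.perp) :
    f ⁻¹' U ∈ COB X.perp := by
  have key : ∀ W, W ∈ COB Y.perp → f ⁻¹' orth Y.perp W = orth X.perp (f ⁻¹' W) := fun W hW =>
    preimage_orth (le := fun z w => ∀ V : Set Y.carrier, IsOpen V → z ∈ V → w ∈ V)
      X.isCylindric.toIsOrthoframe Y.isCylindric.toIsOrthoframe hf.nonperp hf.lift
      (fun z w h => h W hW.1.2)
  refine ⟨hf.spectral U hU.1, ?_⟩
  rw [IsBiorth, ← key U hU, ← key _ (Y.isCylindric.orth_mem U hU), hU.2]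

theorem IsCUVOMap.id {I : Type u} (X : CUVO.{u, v} I) : IsCUVOMap X X id :=
  ⟨fun _ h => h, fun _ _ h => h, fun z _ h => ⟨z, h, fun _ _ h => h⟩, fun _ _ _ => rfl,
    fun _ _ => rfl⟩

theorem IsCUVOMap.continuous {I : Type u} {X Y : CUVO.{u, v} I} {f : X.carrier → Y.carrier}
    (hf : IsCUVOMap X Y f) : Continuous f :=
  Y.isCylindric.basis.continuous_iff.2 fun _ hU => (hf.spectral _ hU.1).2

theorem IsCUVOMap.comp {I : Type u} {X Y Z : CUVO.{u, v} I} {f : X.carrier → Y.carrier}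
    {g : Y.carrier → Z.carrier} (hf : IsCUVOMap X Y f) (hg : IsCUVOMap Y Z g) :
    IsCUVOMap X Z (g ∘ f) where
  spectral U hU := hf.spectral _ (hg.spectral U hU)
  nonperp x y h := hg.nonperp _ _ (hf.nonperp x y h)
  lift z y h := by
    obtain ⟨x', hx', hz⟩ := hg.lift z (f y) h
    obtain ⟨x, hx, hx''⟩ := hf.lift x' y hx'
    exact ⟨x, hx, fun U hU hzU => hx'' _ (hU.preimage hg.continuous) (hz U hU hzU)⟩
  image i U hU := by
    rw [Set.preimage_comp, hf.image i _ (hg.preimage_mem hU), hg.image i U hU]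
    rfl
  diag i k := by rw [Set.preimage_comp, hg.diag, hf.diag]

instance CUVO.instCategory (I : Type u) : Category (CUVO.{u, v} I) where
  Hom X Y := {f : X.carrier → Y.carrier // IsCUVOMap X Y f}
  id X := ⟨id, IsCUVOMap.id X⟩
  comp f g := ⟨g.1 ∘ f.1, f.2.comp g.2⟩

/-! ## The spectrum of a cylindric ortholattice -/

section Spectrum

variable (I : Type u) (A : Type v) [Ortholattice A] [CylindricOrtholattice I A]

/-- The set of proper filters of `A`. -/
def ProperFilter (A : Type v) [Ortholattice A] : Type v := {x : Set A // IsProperFilter x}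

/-- `φ a`, the set of proper filters that contain `a`. -/
def phi {A : Type v} [Ortholattice A] (a : A) : Set (ProperFilter A) := {x | a ∈ x.1}

/-- The topology generated by the sets `φ a`. -/
instance ProperFilter.instTop (A : Type v) [Ortholattice A] : TopologicalSpace (ProperFilter A) :=
  TopologicalSpace.generateFrom (Set.range phi)

/-- `x ⊥ y` iff some `a ∈ x` has `aᶜ ∈ y`. -/
def specPerp (x y : ProperFilter A) : Prop := ∃ a ∈ x.1, aᶜ ∈ y.1

/-- `x R_i y` iff `∃_i[x] ⊆ y`. -/
def specR (i : I) (x y : ProperFilter A) : Prop := (fun a => ex i a) '' x.1 ⊆ y.1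

/-- `Δ_{i,k} = φ(δ_{i,k})`. -/
def specDiag (i k : I) : Set (ProperFilter A) := phi (diag i k)

variable {I A}

theorem Ortholattice.compl_bot : (⊥ : A)ᶜ = ⊤ := by
  have := Ortholattice.sup_compl (⊥ : A)
  rwa [bot_sup_eq] at this

theorem Ortholattice.compl_sup (a b : A) : (a ⊔ b)ᶜ = aᶜ ⊓ bᶜ := by
  refine le_antisymm (le_inf (compl_anti _ _ le_sup_left) (compl_anti _ _ le_sup_right)) ?_
  have h : a ⊔ b ≤ (aᶜ ⊓ bᶜ)ᶜ := sup_le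
    (by simpa [Ortholattice.compl_compl] using compl_anti (aᶜ ⊓ bᶜ) aᶜ inf_le_left)
    (by simpa [Ortholattice.compl_compl] using compl_anti (aᶜ ⊓ bᶜ) bᶜ inf_le_right)
  simpa [Ortholattice.compl_compl] using compl_anti _ _ h

theorem IsQuantifier.mono {q : A → A} (hq : IsQuantifier q) {a b : A} (h : a ≤ b) : q a ≤ q b := by
  have := hq.map_sup a b
  rw [sup_eq_right.2 h] at this
  rw [this]
  exact le_sup_left

theorem IsProperFilter.bot_notMem {x : Set A} (hx : IsProperFilter x) : ⊥ ∉ x :=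
  fun h => hx.proper (Set.eq_univ_of_forall fun a => hx.upward ⊥ a h bot_le)

theorem IsProperFilter.top_mem {x : Set A} (hx : IsProperFilter x) : ⊤ ∈ x :=
  let ⟨a, ha⟩ := hx.nonempty
  hx.upward a ⊤ ha le_top

theorem isProperFilter_Ici {a : A} (ha : a ≠ ⊥) : IsProperFilter (Set.Ici a) where
  nonempty := ⟨a, le_rfl⟩
  upward _ _ h h' := le_trans h h'
  inf_mem _ _ h h' := le_inf h h'
  proper h := ha (le_bot_iff.1 (show ⊥ ∈ Set.Ici a from h ▸ Set.mem_univ _))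

theorem phi_bot : phi (⊥ : A) = ∅ :=
  Set.eq_empty_of_forall_notMem fun x hx => x.2.bot_notMem hx

theorem phi_top : phi (⊤ : A) = Set.univ := Set.eq_univ_of_forall fun x => x.2.top_mem

theorem phi_inf (a b : A) : phi (a ⊓ b) = phi a ∩ phi b :=
  Set.ext fun x => ⟨fun h => ⟨x.2.upward _ _ h inf_le_left, x.2.upward _ _ h inf_le_right⟩,
    fun h => x.2.inf_mem _ _ h.1 h.2⟩

theorem phi_subset {a b : A} : phi a ⊆ phi b ↔ a ≤ b := by
  refine ⟨fun h => ?_, fun h x hx => x.2.upward _ _ hx h⟩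
  by_cases ha : a = ⊥
  · rw [ha]; exact bot_le
  · exact h (show (⟨Set.Ici a, isProperFilter_Ici ha⟩ : ProperFilter A) ∈ phi a from le_refl a)

theorem isOrthoframe_spec : IsOrthoframe (specPerp A) where
  irrefl := by
    rintro x ⟨a, ha, ha'⟩
    exact x.2.bot_notMem (Ortholattice.inf_compl a ▸ x.2.inf_mem _ _ ha ha')
  symm := by
    rintro x y ⟨a, ha, ha'⟩
    exact ⟨aᶜ, ha', by rwa [Ortholattice.compl_compl]⟩

theorem orth_phi (a : A) : orth (specPerp A) (phi a) = phi aᶜ := by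
  ext x
  constructor
  · intro h
    by_cases ha : a = ⊥
    · rw [ha, Ortholattice.compl_bot, phi_top]; trivial
    · obtain ⟨b, hb, hb'⟩ := h ⟨Set.Ici a, isProperFilter_Ici ha⟩ (le_refl a)
      refine x.2.upward b _ hb ?_
      simpa [Ortholattice.compl_compl] using Ortholattice.compl_anti _ _ (Set.mem_Ici.1 hb')
  · intro h y hy
    exact ⟨aᶜ, h, by rwa [Ortholattice.compl_compl]⟩

theorem orth_union {X : Type v} (perp : X → X → Prop) (U W : Set X) :
    orth perp (U ∪ W) = orth perp U ∩ orth perp W :=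
  Set.ext fun _ => ⟨fun h => ⟨fun y hy => h y (.inl hy), fun y hy => h y (.inr hy)⟩,
    fun h y hy => hy.elim (h.1 y) (h.2 y)⟩

theorem isBiorth_phi (a : A) : IsBiorth (specPerp A) (phi a) := by
  rw [IsBiorth, orth_phi, orth_phi, Ortholattice.compl_compl]

theorem isTopologicalBasis_phi :
    TopologicalSpace.IsTopologicalBasis (Set.range (phi : A → Set (ProperFilter A))) where
  exists_subset_inter := by
    rintro _ ⟨a, rfl⟩ _ ⟨b, rfl⟩ x hx
    exact ⟨_, ⟨a ⊓ b, rfl⟩, (phi_inf a b) ▸ hx, (phi_inf a b).le⟩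
  sUnion_eq := Set.eq_univ_of_forall fun x => ⟨phi ⊤, ⟨⊤, rfl⟩, x.2.top_mem⟩
  eq_generateFrom := rfl

theorem phi_mem_CO (a : A) : phi a ∈ CO (ProperFilter A) := by
  refine ⟨?_, isTopologicalBasis_phi.isOpen ⟨a, rfl⟩⟩
  by_cases ha : a = ⊥
  · rw [ha, phi_bot]; exact isCompact_empty
  · refine isCompact_of_finite_subcover fun {ι} U hU hc => ?_
    obtain ⟨j, hj⟩ := Set.mem_iUnion.1
      (hc (show (⟨Set.Ici a, isProperFilter_Ici ha⟩ : ProperFilter A) ∈ phi a from le_refl a))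
    obtain ⟨_, ⟨b, rfl⟩, hb, hbU⟩ := isTopologicalBasis_phi.exists_subset_of_mem_open hj (hU j)
    refine ⟨{j}, ?_⟩
    simpa using (phi_subset.2 (show a ≤ b from hb)).trans hbU

theorem phi_mem_COB (a : A) : phi a ∈ COB (specPerp A) := ⟨phi_mem_CO a, isBiorth_phi a⟩

/-- A finite union of sets `φ a` has the same orthogonal set as a single one. -/
theorem exists_orth_sUnion (s : Set (Set (ProperFilter A))) (hs : s.Finite)
    (h : s ⊆ Set.range phi) : ∃ a : A, orth (specPerp A) (⋃₀ s) = phi aᶜ := by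
  induction s, hs using Set.Finite.induction_on with
  | empty =>
    refine ⟨⊥, ?_⟩
    rw [Ortholattice.compl_bot, phi_top]
    exact Set.eq_univ_of_forall fun x y hy => by simp at hy
  | insert _ _ ih =>
    obtain ⟨a, ha⟩ := ih ((Set.subset_insert _ _).trans h)
    obtain ⟨b, hb⟩ := h (Set.mem_insert _ _)
    refine ⟨b ⊔ a, ?_⟩
    rw [Set.sUnion_insert, orth_union, ha, ← hb, orth_phi, Ortholattice.compl_sup, phi_inf]

theorem COB_spec : COB (specPerp A) = Set.range phi := by
  refine Set.Subset.antisymm ?_ (Set.range_subset_iff.2 phi_mem_COB)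
  rintro U ⟨⟨hc, ho⟩, hb⟩
  obtain ⟨t, ht, rfl⟩ := (isCompact_open_iff_eq_finite_iUnion_of_isTopologicalBasis
    (phi : A → Set (ProperFilter A)) isTopologicalBasis_phi (fun a => (phi_mem_CO a).1) U).1 ⟨hc, ho⟩
  rw [← Set.sUnion_image] at hb ⊢
  obtain ⟨a, ha⟩ := exists_orth_sUnion (phi '' t) (ht.image _) (Set.image_subset_range _ _)
  refine ⟨a, ?_⟩
  rw [IsBiorth, ha, orth_phi, Ortholattice.compl_compl] at hb
  exact hb

theorem relImage_phi (i : I) (a : A) : relImage (specR I A i) (phi a) = phi (ex i a) := by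
  ext y
  constructor
  · rintro ⟨x, hx, hxy⟩
    exact hxy ⟨a, hx, rfl⟩
  · intro hy
    have ha : a ≠ ⊥ := by
      rintro rfl
      rw [(CylindricOrtholattice.quantifier i).map_bot] at hy
      exact y.2.bot_notMem hy
    refine ⟨⟨Set.Ici a, isProperFilter_Ici ha⟩, le_refl a, ?_⟩
    rintro _ ⟨b, hb, rfl⟩
    exact y.2.upward _ _ hy ((CylindricOrtholattice.quantifier i).mono hb)

/-- The filter generated by `∃_i[x]`. -/
def exFilter (i : I) (x : ProperFilter A) : ProperFilter A :=
  ⟨{b | ∃ a ∈ x.1, ex i a ≤ b},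
    { nonempty := ⟨⊤, ⊤, x.2.top_mem, le_top⟩
      upward := by
        rintro b c ⟨a, ha, hab⟩ hbc
        exact ⟨a, ha, hab.trans hbc⟩
      inf_mem := by
        rintro b c ⟨a, ha, hab⟩ ⟨a', ha', hac⟩
        have hq : IsQuantifier (ex (A := A) i) := CylindricOrtholattice.quantifier i
        exact ⟨a ⊓ a', x.2.inf_mem _ _ ha ha', le_inf ((hq.mono inf_le_left).trans hab)
          ((hq.mono inf_le_right).trans hac)⟩
      proper := by
        intro h
        obtain ⟨a, ha, hab⟩ := h.ge (Set.mem_univ ⊥)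
        exact x.2.bot_notMem (x.2.upward _ _ ha
          (((CylindricOrtholattice.quantifier i).le a).trans hab)) }⟩

theorem spec_comm_aux (i k : I) (x z : ProperFilter A)
    (h : ∃ y, specR I A i x y ∧ specR I A k y z) : ∃ y, specR I A k x y ∧ specR I A i y z := by
  obtain ⟨y, hxy, hyz⟩ := h
  refine ⟨exFilter k x, ?_, ?_⟩
  · rintro _ ⟨a, ha, rfl⟩
    exact ⟨a, ha, le_rfl⟩
  · rintro _ ⟨b, ⟨a, ha, hab⟩, rfl⟩
    have h1 : ex k (ex i a) ∈ z.1 := hyz ⟨_, hxy ⟨a, ha, rfl⟩, rfl⟩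
    rw [← CylindricOrtholattice.ex_comm] at h1
    exact z.2.upward _ _ h1 ((CylindricOrtholattice.quantifier i).mono hab)

theorem isMonadicOrthoframe_spec (i : I) : IsMonadicOrthoframe (specPerp A) (specR I A i) where
  toIsOrthoframe := isOrthoframe_spec
  refl x := by
    rintro _ ⟨a, ha, rfl⟩
    exact x.2.upward _ _ ha ((CylindricOrtholattice.quantifier i).le a)
  trans x y z hxy hyz := by
    rintro _ ⟨a, ha, rfl⟩
    have := hyz ⟨_, hxy ⟨a, ha, rfl⟩, rfl⟩
    simpa only [(CylindricOrtholattice.quantifier i).idem] using this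
  image_orth x := by
    have hq : IsQuantifier (ex (A := A) i) := CylindricOrtholattice.quantifier i
    rintro y ⟨w, hw, hwy⟩ z hz
    have hxz : specR I A i x z := by
      obtain ⟨x', rfl, h⟩ := hz
      exact h
    obtain ⟨b, hb, a, ha, hab⟩ := hw (exFilter i x) ⟨x, rfl, by
      rintro _ ⟨a, ha, rfl⟩
      exact ⟨a, ha, le_rfl⟩⟩
    have h1 : b ≤ (ex i a)ᶜ := by
      simpa [Ortholattice.compl_compl] using Ortholattice.compl_anti _ _ hab
    have h2 : ex i (ex i a)ᶜ ∈ y.1 := hwy ⟨_, w.2.upward _ _ hb h1, rfl⟩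
    rw [hq.compl] at h2
    exact ⟨_, h2, by rw [Ortholattice.compl_compl]; exact hxz ⟨a, ha, rfl⟩⟩

theorem isUVOSpace_spec : IsUVOSpace (specPerp A) where
  toIsOrthoframe := isOrthoframe_spec
  t0 := by
    refine ⟨fun x y h => Subtype.ext (Set.ext fun a => ?_)⟩
    have h1 : x ∈ phi a ↔ y ∈ phi a := h.mem_open_iff (phi_mem_CO a).2
    exact h1
  basis := by
    rw [COB_spec]
    exact isTopologicalBasis_phi
  inter_mem := by
    rw [COB_spec]
    rintro _ _ ⟨a, rfl⟩ ⟨b, rfl⟩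
    exact ⟨a ⊓ b, phi_inf a b⟩
  orth_mem := by
    rw [COB_spec]
    rintro _ ⟨a, rfl⟩
    exact ⟨aᶜ, (orth_phi a).symm⟩
  filter := by
    rw [COB_spec]
    intro 𝓕 h𝓕
    refine ⟨⟨{a | phi a ∈ 𝓕}, ?_, ?_, ?_, ?_⟩, ?_⟩
    · obtain ⟨U, hU⟩ := h𝓕.nonempty
      obtain ⟨a, rfl⟩ := h𝓕.subset hU
      exact ⟨a, hU⟩
    · exact fun a b ha hab => h𝓕.upward _ _ ha ⟨b, rfl⟩ (phi_subset.2 hab)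
    · intro a b ha hb
      have := h𝓕.inter_mem _ _ ha hb
      rwa [← phi_inf] at this
    · intro h
      refine h𝓕.proper (Set.Subset.antisymm h𝓕.subset ?_)
      rintro _ ⟨a, rfl⟩
      exact h.ge (Set.mem_univ a)
    · ext U
      constructor
      · intro hU
        obtain ⟨a, rfl⟩ := h𝓕.subset hU
        exact ⟨⟨a, rfl⟩, hU⟩
      · rintro ⟨⟨a, rfl⟩, hU⟩
        exact hU
  perp_sep := by
    rintro x y ⟨a, ha, ha'⟩
    exact ⟨phi a, phi_mem_COB a, ha, by rw [orth_phi]; exact ha'⟩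

theorem isCylindricUVOSpace_spec :
    IsCylindricUVOSpace (specPerp A) (specR I A) (specDiag I A) where
  toIsUVOSpace := isUVOSpace_spec
  monadic := isMonadicOrthoframe_spec
  comm i k x z := ⟨spec_comm_aux i k x z, spec_comm_aux k i x z⟩
  diag_symm i k := congrArg phi (CylindricOrtholattice.diag_symm i k)
  diag_biorth i k := isBiorth_phi _
  diag_self i := by rw [specDiag, CylindricOrtholattice.diag_self, phi_top]
  image_diag i k l h h' := by
    rw [specDiag, specDiag, ← phi_inf, relImage_phi, CylindricOrtholattice.ex_diag i k l h h']
    rfl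
  monadicUVO i :=
    { toIsUVOSpace := isUVOSpace_spec
      refl := (isMonadicOrthoframe_spec i).refl
      trans := (isMonadicOrthoframe_spec i).trans
      image_orth := (isMonadicOrthoframe_spec i).image_orth
      image_mem := by
        rw [COB_spec]
        rintro _ ⟨a, rfl⟩
        exact ⟨ex i a, (relImage_phi i a).symm⟩
      rel_sep := by
        intro x y h
        obtain ⟨_, ⟨a, ha, rfl⟩, hy⟩ := Set.not_subset.1 h
        refine ⟨phi (ex i a), phi_mem_COB _, ⟨phi a, phi_mem_COB _, ha, ?_⟩, hy⟩
        rw [relImage_phi, isBiorth_phi] }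
  diag_mem i k := phi_mem_CO _

end Spectrum

/-- The spectrum `S₀(A)` of a cylindric ortholattice. -/
def S₀ {I : Type u} (A : COL.{u, v} I) : CUVO.{u, v} I where
  carrier := ProperFilter A.carrier
  perp := specPerp A.carrier
  R := specR I A.carrier
  Δ := specDiag I A.carrier
  isCylindric := isCylindricUVOSpace_spec

/-- `S₁(h) = h⁻¹` on points. -/
def S₁fun {I : Type u} {A B : COL.{u, v} I} (h : A ⟶ B) (x : (S₀ B).carrier) : (S₀ A).carrier :=
  ⟨(fun a => (show CylHom I A.carrier B.carrier from h) a) ⁻¹' x.1,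
    { nonempty := ⟨⊤, by
        show h.toFun ⊤ ∈ x.1
        rw [h.map_top']; exact x.2.top_mem⟩
      upward := fun a b ha hab => x.2.upward _ _ ha (OrderHomClass.mono h.toBoundedLatticeHom hab)
      inf_mem := fun a b ha hb => by
        show h.toFun (a ⊓ b) ∈ x.1
        rw [h.map_inf']; exact x.2.inf_mem _ _ ha hb
      proper := fun hu => by
        have h1 : h.toFun ⊥ ∈ x.1 := hu.ge (Set.mem_univ (⊥ : A.carrier))
        rw [h.map_bot'] at h1; exact x.2.bot_notMem h1 }⟩

theorem S₁fun_preimage_phi {I : Type u} {A B : COL.{u, v} I} (h : A ⟶ B) (a : A.carrier) :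
    S₁fun h ⁻¹' phi a = phi (h.toFun a) := rfl

theorem isCUVOMap_S₁ {I : Type u} {A B : COL.{u, v} I} (h : A ⟶ B) :
    IsCUVOMap (S₀ B) (S₀ A) (S₁fun h) where
  spectral := by
    intro U hU
    obtain ⟨s, hs, rfl⟩ := (isCompact_open_iff_eq_finite_iUnion_of_isTopologicalBasis
      (phi : A.carrier → Set (ProperFilter A.carrier)) isTopologicalBasis_phi
      (fun a => (phi_mem_CO a).1) U).1 hU
    have h1 : S₁fun h ⁻¹' (⋃ a ∈ s, phi a) = ⋃ a ∈ s, phi (h.toFun a) := Set.preimage_iUnion₂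
    have h2 : (⋃ a ∈ s, phi (h.toFun a)) ∈ CO (ProperFilter B.carrier) :=
      ⟨hs.isCompact_biUnion fun a _ => (phi_mem_CO (h.toFun a)).1,
        isOpen_biUnion fun a _ => (phi_mem_CO (h.toFun a)).2⟩
    exact (congrArg (fun W => W ∈ CO (ProperFilter B.carrier)) h1).mpr h2
  nonperp := by
    rintro x y hxy ⟨a, ha, ha'⟩
    refine hxy ⟨h.toFun a, ha, ?_⟩
    rw [← h.map_compl']; exact ha'
  lift := by
    intro z y hzy
    refine ⟨⟨{b | ∃ a ∈ z.1, h.toFun a ≤ b}, ?_, ?_, ?_, ?_⟩, ?_, ?_⟩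
    · exact ⟨⊤, ⊤, z.2.top_mem, le_top⟩
    · rintro b c ⟨a, ha, hab⟩ hbc
      exact ⟨a, ha, hab.trans hbc⟩
    · rintro b c ⟨a, ha, hab⟩ ⟨a', ha', hac⟩
      refine ⟨a ⊓ a', z.2.inf_mem _ _ ha ha', ?_⟩
      rw [h.map_inf']
      exact inf_le_inf hab hac
    · intro hu
      obtain ⟨a, ha, hab⟩ := hu.ge (Set.mem_univ (⊥ : B.carrier))
      refine hzy ⟨a, ha, ?_⟩
      show h.toFun aᶜ ∈ y.1
      rw [h.map_compl', le_bot_iff.1 hab, Ortholattice.compl_bot]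
      exact y.2.top_mem
    · rintro ⟨b, ⟨a, ha, hab⟩, hb⟩
      refine hzy ⟨a, ha, ?_⟩
      show h.toFun aᶜ ∈ y.1
      rw [h.map_compl']
      exact y.2.upward _ _ hb (Ortholattice.compl_anti _ _ hab)
    · intro U hU hz
      obtain ⟨_, ⟨a, rfl⟩, ha, haU⟩ := isTopologicalBasis_phi.exists_subset_of_mem_open hz hU
      exact haU ⟨a, ha, le_rfl⟩
  image := by
    intro i U hU
    obtain ⟨a, rfl⟩ := COB_spec.le hU
    rw [S₁fun_preimage_phi]
    refine (relImage_phi i _).trans ?_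
    rw [← h.map_ex', ← S₁fun_preimage_phi]
    exact congrArg _ (relImage_phi i a).symm
  diag i k := by
    refine (S₁fun_preimage_phi h _).trans ?_
    rw [h.map_diag']; rfl

/-- The contravariant functor `S_F`. -/
def S_F (I : Type u) : (COL.{u, v} I)ᵒᵖ ⥤ CUVO.{u, v} I where
  obj A := S₀ A.unop
  map h := ⟨S₁fun h.unop, isCUVOMap_S₁ h.unop⟩

/-! ## The algebra of compact open biorthogonally closed sets -/

section Algebra

variable {I : Type u} (X : CUVO.{u, v} I)

theorem CUVO.empty_mem : ∅ ∈ COB X.perp := by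
  have hp := X.isCylindric.toIsOrthoframe
  rcases isEmpty_or_nonempty X.carrier with h | ⟨⟨x⟩⟩
  · exact ⟨⟨isCompact_empty, isOpen_empty⟩, Subsingleton.elim _ _⟩
  · obtain ⟨U, hU, -⟩ := X.isCylindric.basis.exists_subset_of_mem_open (Set.mem_univ x) isOpen_univ
    rw [← inter_orth hp U]
    exact X.isCylindric.inter_mem _ _ hU (X.isCylindric.orth_mem _ hU)

theorem orth_empty {X : Type v} (perp : X → X → Prop) : orth perp ∅ = Set.univ :=
  Set.eq_univ_of_forall fun _ _ hy => hy.elim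

theorem CUVO.univ_mem : Set.univ ∈ COB X.perp := by
  rw [← orth_empty X.perp]
  exact X.isCylindric.orth_mem _ X.empty_mem

theorem CUVO.sup_mem {U W : Set X.carrier} (hU : U ∈ COB X.perp) (hW : W ∈ COB X.perp) :
    orth X.perp (orth X.perp (U ∪ W)) ∈ COB X.perp := by
  rw [orth_union]
  exact X.isCylindric.orth_mem _ (X.isCylindric.inter_mem _ _ (X.isCylindric.orth_mem _ hU)
    (X.isCylindric.orth_mem _ hW))

theorem CUVO.image_mem (i : I) {U : Set X.carrier} (hU : U ∈ COB X.perp) :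
    orth X.perp (orth X.perp (relImage (X.R i) U)) ∈ COB X.perp :=
  X.isCylindric.orth_mem _ (X.isCylindric.orth_mem _
    ((X.isCylindric.monadicUVO i).image_mem U hU))

/-- The ortholattice `⟨COB(X); ∩, ⊔, ^⊥, ∅, X⟩` with `U ⊔ W = (U ∪ W)^⊥⊥`. -/
instance CUVO.instOrtholattice : Ortholattice {U // U ∈ COB X.perp} where
  le U W := U.1 ⊆ W.1
  le_refl U := subset_rfl
  le_trans _ _ _ h h' := h.trans h'
  le_antisymm _ _ h h' := Subtype.ext (h.antisymm h')
  inf U W := ⟨U.1 ∩ W.1, X.isCylindric.inter_mem _ _ U.2 W.2⟩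
  inf_le_left _ _ := Set.inter_subset_left
  inf_le_right _ _ := Set.inter_subset_right
  le_inf _ _ _ h h' := Set.subset_inter h h'
  sup U W := ⟨orth X.perp (orth X.perp (U.1 ∪ W.1)), X.sup_mem U.2 W.2⟩
  le_sup_left _ _ := Set.subset_union_left.trans (subset_orth_orth X.isCylindric.toIsOrthoframe _)
  le_sup_right _ _ := Set.subset_union_right.trans (subset_orth_orth X.isCylindric.toIsOrthoframe _)
  sup_le U W T h h' := (orth_anti (orth_anti (Set.union_subset h h'))).trans T.2.2.le
  top := ⟨Set.univ, X.univ_mem⟩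
  le_top _ := Set.subset_univ _
  bot := ⟨∅, X.empty_mem⟩
  bot_le _ := Set.empty_subset _
  compl U := ⟨orth X.perp U.1, X.isCylindric.orth_mem _ U.2⟩
  inf_compl U := Subtype.ext (inter_orth X.isCylindric.toIsOrthoframe U.1)
  sup_compl U := Subtype.ext (by
    show orth X.perp (orth X.perp (U.1 ∪ orth X.perp U.1)) = Set.univ
    rw [orth_union, inter_orth X.isCylindric.toIsOrthoframe, orth_empty])
  compl_anti _ _ h := orth_anti h
  compl_compl U := Subtype.ext U.2.2

end Algebra

section Frame

variable {X : Type v} {perp R : X → X → Prop}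

theorem relImage_mono {U W : Set X} (h : U ⊆ W) : relImage R U ⊆ relImage R W :=
  fun _ ⟨x, hx, hxy⟩ => ⟨x, h hx, hxy⟩

theorem IsMonadicOrthoframe.subset_image (h : IsMonadicOrthoframe perp R) (U : Set X) :
    U ⊆ relImage R U := fun x hx => ⟨x, hx, h.refl x⟩

theorem IsMonadicOrthoframe.image_image (h : IsMonadicOrthoframe perp R) (U : Set X) :
    relImage R (relImage R U) = relImage R U :=
  Set.Subset.antisymm (fun _ ⟨_, ⟨w, hw, hwy⟩, hyz⟩ => ⟨w, hw, h.trans _ _ _ hwy hyz⟩)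
    (h.subset_image _)

theorem IsMonadicOrthoframe.image_orth_image (h : IsMonadicOrthoframe perp R) (U : Set X) :
    relImage R (orth perp (relImage R U)) = orth perp (relImage R U) := by
  refine Set.Subset.antisymm ?_ (h.subset_image _)
  rintro z ⟨y, hy, hyz⟩ w ⟨x, hx, hxw⟩
  refine h.image_orth x ⟨y, ?_, hyz⟩ w ⟨x, rfl, hxw⟩
  rintro w' ⟨x', rfl, hw'⟩
  exact hy w' ⟨_, hx, hw'⟩

/-- The sets closed under `R` are stable under `^⊥`. -/
theorem IsMonadicOrthoframe.image_orth_of (h : IsMonadicOrthoframe perp R) {U : Set X}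
    (hU : relImage R U = U) : relImage R (orth perp U) = orth perp U := by
  have := h.image_orth_image U
  rwa [hU] at this

end Frame

section Algebra

variable {I : Type u} (X : CUVO.{u, v} I)

theorem CUVO.biorth_image (i : I) {U : Set X.carrier} (hU : U ∈ COB X.perp) :
    orth X.perp (orth X.perp (relImage (X.R i) U)) = relImage (X.R i) U :=
  ((X.isCylindric.monadicUVO i).image_mem U hU).2

/-- The cylindric structure on `COB(X)` with `∃_i U = R_i[U]^⊥⊥`. -/
instance CUVO.instCylindric : CylindricOrtholattice I {U // U ∈ COB X.perp} where
  ex i U := ⟨orth X.perp (orth X.perp (relImage (X.R i) U.1)), X.image_mem i U.2⟩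
  diag i k := ⟨X.Δ i k, X.isCylindric.diag_mem i k, X.isCylindric.diag_biorth i k⟩
  quantifier i := by
    have hf := X.isCylindric.monadic i
    refine ⟨fun U W => le_antisymm ?_ ?_, ?_, ?_, ?_, ?_⟩
    · show orth X.perp (orth X.perp (relImage (X.R i) (orth X.perp (orth X.perp (U.1 ∪ W.1))))) ⊆
        orth X.perp (orth X.perp (orth X.perp (orth X.perp (relImage (X.R i) U.1)) ∪
          orth X.perp (orth X.perp (relImage (X.R i) W.1))))
      rw [X.biorth_image i (X.sup_mem U.2 W.2), X.biorth_image i U.2, X.biorth_image i W.2]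
      have h1 : relImage (X.R i) (relImage (X.R i) U.1 ∪ relImage (X.R i) W.1) =
          relImage (X.R i) U.1 ∪ relImage (X.R i) W.1 := by
        refine Set.Subset.antisymm ?_ (hf.subset_image _)
        rintro y ⟨x, hx | hx, hxy⟩
        · exact .inl ((hf.image_image U.1).le ⟨x, hx, hxy⟩)
        · exact .inr ((hf.image_image W.1).le ⟨x, hx, hxy⟩)
      rw [← hf.image_orth_of (hf.image_orth_of h1)]
      exact relImage_mono (orth_anti (orth_anti
        (Set.union_subset_union (hf.subset_image _) (hf.subset_image _))))
    · have mono : ∀ S T : {U // U ∈ COB X.perp}, S ≤ T →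
          orth X.perp (orth X.perp (relImage (X.R i) S.1)) ⊆
            orth X.perp (orth X.perp (relImage (X.R i) T.1)) :=
        fun S T h => orth_anti (orth_anti (relImage_mono h))
      exact sup_le (mono U (U ⊔ W) le_sup_left) (mono W (U ⊔ W) le_sup_right)
    · refine Subtype.ext ((X.biorth_image i X.empty_mem).trans ?_)
      exact Set.eq_empty_of_forall_notMem fun y ⟨x, hx, _⟩ => hx
    · intro U
      refine Subtype.ext ?_
      show orth X.perp (orth X.perp (relImage (X.R i) (orth X.perp (orth X.perp
        (relImage (X.R i) U.1))))) = orth X.perp (orth X.perp (relImage (X.R i) U.1))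
      rw [X.biorth_image i U.2, hf.image_image, X.biorth_image i U.2]
    · intro U
      exact (hf.subset_image U.1).trans (X.biorth_image i U.2).ge
    · intro U
      refine Subtype.ext ?_
      show orth X.perp (orth X.perp (relImage (X.R i) (orth X.perp (orth X.perp (orth X.perp
        (relImage (X.R i) U.1)))))) = orth X.perp (orth X.perp (orth X.perp (relImage (X.R i) U.1)))
      rw [X.biorth_image i U.2, hf.image_orth_image, X.biorth_image i U.2]
  ex_comm i k U := by
    refine Subtype.ext ?_
    show orth X.perp (orth X.perp (relImage (X.R i) (orth X.perp (orth X.perp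
        (relImage (X.R k) U.1))))) = orth X.perp (orth X.perp (relImage (X.R k)
        (orth X.perp (orth X.perp (relImage (X.R i) U.1)))))
    rw [X.biorth_image i U.2, X.biorth_image k U.2]
    congr 2
    ext z
    constructor
    · rintro ⟨y, ⟨x, hx, hxy⟩, hyz⟩
      obtain ⟨y', h1, h2⟩ := (X.isCylindric.comm i k x z).2 ⟨y, hxy, hyz⟩
      exact ⟨y', ⟨x, hx, h1⟩, h2⟩
    · rintro ⟨y, ⟨x, hx, hxy⟩, hyz⟩
      obtain ⟨y', h1, h2⟩ := (X.isCylindric.comm i k x z).1 ⟨y, hxy, hyz⟩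
      exact ⟨y', ⟨x, hx, h1⟩, h2⟩
  diag_symm i k := Subtype.ext (X.isCylindric.diag_symm i k)
  diag_self i := Subtype.ext (X.isCylindric.diag_self i)
  ex_diag i k l h h' := by
    refine Subtype.ext ?_
    show orth X.perp (orth X.perp (relImage (X.R k) (X.Δ i k ∩ X.Δ k l))) = X.Δ i l
    rw [X.isCylindric.image_diag i k l h h', X.isCylindric.diag_biorth]

end Algebra

/-- The algebra `A₀(X)` of a cylindric UVO-space. -/
def A₀ {I : Type u} (X : CUVO.{u, v} I) : COL.{u, v} I where
  carrier := {U // U ∈ COB X.perp}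

theorem IsCUVOMap.preimage_orth {I : Type u} {X Y : CUVO.{u, v} I} {f : X.carrier → Y.carrier}
    (hf : IsCUVOMap X Y f) {U : Set Y.carrier} (hU : IsOpen U) :
    f ⁻¹' orth Y.perp U = orth X.perp (f ⁻¹' U) :=
  _root_.preimage_orth (le := fun z w => ∀ V : Set Y.carrier, IsOpen V → z ∈ V → w ∈ V)
      X.isCylindric.toIsOrthoframe Y.isCylindric.toIsOrthoframe hf.nonperp hf.lift
      (fun _ _ h => h U hU)

/-- `A₁(f) = f⁻¹`. -/
def A₁ {I : Type u} {X Y : CUVO.{u, v} I} (f : X ⟶ Y) : A₀ Y ⟶ A₀ X where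
  toFun U := ⟨f.1 ⁻¹' U.1, f.2.preimage_mem U.2⟩
  map_inf' _ _ := rfl
  map_top' := rfl
  map_bot' := rfl
  map_sup' U W := by
    refine Subtype.ext ?_
    show f.1 ⁻¹' orth Y.perp (orth Y.perp (U.1 ∪ W.1)) =
      orth X.perp (orth X.perp (f.1 ⁻¹' U.1 ∪ f.1 ⁻¹' W.1))
    have h1 : IsOpen (orth Y.perp (U.1 ∪ W.1)) := by
      rw [orth_union]
      exact (Y.isCylindric.orth_mem _ U.2).1.2.inter (Y.isCylindric.orth_mem _ W.2).1.2
    rw [f.2.preimage_orth h1, f.2.preimage_orth (U.2.1.2.union W.2.1.2)]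
    rfl
  map_compl' U := Subtype.ext (f.2.preimage_orth U.2.1.2)
  map_ex' i U := by
    refine Subtype.ext ?_
    show f.1 ⁻¹' orth Y.perp (orth Y.perp (relImage (Y.R i) U.1)) =
      orth X.perp (orth X.perp (relImage (X.R i) (f.1 ⁻¹' U.1)))
    rw [Y.biorth_image i U.2, X.biorth_image i (f.2.preimage_mem U.2), f.2.image i U.1 U.2]
  map_diag' i k := Subtype.ext (f.2.diag i k)

/-- The contravariant functor `A_F`. -/
def A_F (I : Type u) : (CUVO.{u, v} I)ᵒᵖ ⥤ COL.{u, v} I where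
  obj X := A₀ X.unop
  map f := A₁ f.unop

/-! ## Models of ZF

Provability in ZF is truth in all models of ZF. A model is a first-order structure `V` in the
language with one binary relation symbol; the axiom schemes range over the classes that are
first-order definable over `V` with parameters. There is no axiom of choice. -/

/-- The relation symbols of the language of set theory. -/
inductive SetLangRel : ℕ → Type
  | mem : SetLangRel 2

/-- The first-order language of set theory. -/
def setLang : FirstOrder.Language.{0, 0} := ⟨fun _ => Empty, SetLangRel⟩

/-- The membership relation of a structure for the language of set theory. -/
def VMem {V : Type w} [setLang.Structure V] (x y : V) : Prop :=
  FirstOrder.Language.Structure.RelMap (L := setLang) SetLangRel.mem ![x, y]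

infix:50 "∊" => VMem

/-- `V` is a model of the axioms of Zermelo-Fraenkel set theory (without choice). -/
class IsZFModel (V : Type w) [setLang.Structure V] : Prop where
  extensionality : ∀ x y : V, (∀ z : V, z ∊ x ↔ z ∊ y) → x = y
  foundation : ∀ x : V, (∃ y : V, y ∊ x) → ∃ y : V, y ∊ x ∧ ∀ z : V, ¬ (z ∊ y ∧ z ∊ x)
  pairing : ∀ x y : V, ∃ z : V, ∀ t : V, t ∊ z ↔ t = x ∨ t = y
  union : ∀ x : V, ∃ z : V, ∀ t : V, t ∊ z ↔ ∃ y : V, t ∊ y ∧ y ∊ x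
  powerset : ∀ x : V, ∃ z : V, ∀ t : V, t ∊ z ↔ ∀ s : V, s ∊ t → s ∊ x
  infinity : ∃ z : V, (∃ e : V, e ∊ z ∧ ∀ t : V, ¬ t ∊ e) ∧
    ∀ x : V, x ∊ z → ∃ y : V, y ∊ z ∧ ∀ t : V, t ∊ y ↔ t ∊ x ∨ t = x
  separation : ∀ D : Set V, Set.univ.Definable₁ setLang D →
    ∀ x : V, ∃ z : V, ∀ t : V, t ∊ z ↔ t ∊ x ∧ t ∈ D
  replacement : ∀ F : Set (V × V), Set.univ.Definable₂ setLang F →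
    ∀ x : V, (∀ s : V, s ∊ x → ∃! t : V, (s, t) ∈ F) →
      ∃ z : V, ∀ t : V, t ∊ z ↔ ∃ s : V, s ∊ x ∧ (s, t) ∈ F

section Model

variable {V : Type w} [setLang.Structure V]

/-- The elements of the set `a` of the model. -/
def El (a : V) : Type w := {x : V // x ∊ a}

/-- `p` is the Kuratowski pair `{{x}, {x, y}}` in the model. -/
def IsPair (p x y : V) : Prop :=
  ∀ z : V, z ∊ p ↔ (∀ t : V, t ∊ z ↔ t = x) ∨ (∀ t : V, t ∊ z ↔ t = x ∨ t = y)

/-- The relation `P` between the elements of `a` and `b` is a set of the model. -/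
def IsSetRel₂ {a b : V} (P : El a → El b → Prop) : Prop :=
  ∃ r : V, ∀ x y, P x y ↔ ∃ p : V, IsPair p x.1 y.1 ∧ p ∊ r

/-- The ternary relation `P` between the elements of `a`, `b` and `c` is a set of the model. -/
def IsSetRel₃ {a b c : V} (P : El a → El b → El c → Prop) : Prop :=
  ∃ r : V, ∀ x y z, P x y z ↔ ∃ q p : V, IsPair q x.1 y.1 ∧ IsPair p q z.1 ∧ p ∊ r

/-- The function `f` from `a` to `b` is a set of the model. -/
def IsSetFun {a b : V} (f : El a → El b) : Prop := IsSetRel₂ fun x y => f x = y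

/-- The binary function `f` from `a` and `b` to `c` is a set of the model. -/
def IsSetFun₂ {a b c : V} (f : El a → El b → El c) : Prop := IsSetRel₃ fun x y z => f x y = z

/-- The set of those elements of `c` that belong to `u`. -/
def trace (c u : V) : Set (El c) := {x | x.1 ∊ u}

/-- The family of the subsets of `c` cut out by the elements of `F`. -/
def traceFamily (c F : V) : Set (Set (El c)) := {U | ∃ u : V, u ∊ F ∧ trace c u = U}

/-- `s` is finite in the sense of the model: it belongs to every set of the model that contains
the empty set and is closed under adjoining one element of `s`. (In ZF this is equivalent to
`s` having a bijection with a natural number.) -/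
def VFinite (s : V) : Prop :=
  ∀ K : V, (∃ e : V, e ∊ K ∧ ∀ t : V, ¬ t ∊ e) →
    (∀ u x : V, u ∊ K → x ∊ s → ∃ u' : V, u' ∊ K ∧ ∀ t : V, t ∊ u' ↔ t ∊ u ∨ t = x) → s ∊ K

/-! ### Definable classes and closure of the sets of a model under composition -/

/-- `P` is first-order definable with parameters. -/
def Dfn {n : ℕ} (P : (Fin n → V) → Prop) : Prop := (Set.univ : Set V).Definable setLang {v | P v}

namespace Dfn

variable {n : ℕ} {P Q : (Fin n → V) → Prop}

theorem mem (i j : Fin n) : Dfn fun v : Fin n → V => v i ∊ v j := by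
  refine (Set.Definable.mono (A := ∅) ?_ (Set.empty_subset _))
  rw [Set.empty_definable_iff]
  refine ⟨FirstOrder.Language.Relations.formula₂ (L := setLang) SetLangRel.mem
    (FirstOrder.Language.Term.var i) (FirstOrder.Language.Term.var j), ?_⟩
  ext v
  refine Iff.symm ?_
  exact FirstOrder.Language.Formula.realize_rel₂ (L := setLang) (M := V)

theorem eq (i j : Fin n) : Dfn fun v : Fin n → V => v i = v j := by
  refine (Set.Definable.mono (A := ∅) ?_ (Set.empty_subset _))
  rw [Set.empty_definable_iff]
  refine ⟨(FirstOrder.Language.Term.var i).equal (FirstOrder.Language.Term.var j), ?_⟩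
  ext v
  simp

theorem eq_const (i : Fin n) (c : V) : Dfn fun v : Fin n → V => v i = c :=
  (Set.Definable.singleton_of_mem (L := setLang) (Set.mem_univ c)).preimage_comp
    (fun _ : Fin 1 => i)

theorem not (h : Dfn P) : Dfn fun v => ¬ P v := Set.Definable.compl h

theorem and (h : Dfn P) (h' : Dfn Q) : Dfn fun v => P v ∧ Q v := Set.Definable.inter h h'

theorem or (h : Dfn P) (h' : Dfn Q) : Dfn fun v => P v ∨ Q v := Set.Definable.union h h'

theorem imp (h : Dfn P) (h' : Dfn Q) : Dfn fun v => P v → Q v := by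
  simpa only [imp_iff_not_or] using h.not.or h'

theorem iff (h : Dfn P) (h' : Dfn Q) : Dfn fun v => P v ↔ Q v := by
  simpa only [iff_iff_implies_and_implies] using (h.imp h').and (h'.imp h)

theorem ex {P : (Fin n → V) → V → Prop}
    (h : Dfn fun v : Fin (n + 1) → V => P (fun i => v i.castSucc) (v (Fin.last n))) :
    Dfn fun v => ∃ x, P v x := by
  have h1 := Set.Definable.image_comp h (Fin.castSucc : Fin n → Fin (n + 1))
  refine (congrArg (Set.Definable Set.univ setLang) (Set.ext fun v => ?_)).mp h1
  constructor
  · rintro ⟨w, hw, rfl⟩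
    exact ⟨_, hw⟩
  · rintro ⟨x, hx⟩
    refine ⟨Fin.snoc v x, ?_, ?_⟩
    · simpa using hx
    · ext i
      simp

theorem all {P : (Fin n → V) → V → Prop}
    (h : Dfn fun v : Fin (n + 1) → V => P (fun i => v i.castSucc) (v (Fin.last n))) :
    Dfn fun v => ∀ x, P v x := by
  have := (ex (P := fun v x => ¬ P v x) h.not).not
  simpa only [not_exists, not_not] using this

theorem mem_const (i : Fin n) (c : V) : Dfn fun v : Fin n → V => v i ∊ c := by
  have : Dfn fun v : Fin n → V => ∃ x, x = c ∧ v i ∊ x := ex ((eq_const _ c).and (mem _ _))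
  simpa using this

theorem isPair (i j k : Fin n) : Dfn fun v : Fin n → V => IsPair (v i) (v j) (v k) :=
  all ((mem _ _).iff ((all ((mem _ _).iff (eq _ _))).or
    (all ((mem _ _).iff ((eq _ _).or (eq _ _))))))

end Dfn

variable [IsZFModel V]

theorem exists_isPair (x y : V) : ∃ p : V, IsPair p x y := by
  obtain ⟨a, ha⟩ := IsZFModel.pairing x x
  obtain ⟨b, hb⟩ := IsZFModel.pairing x y
  obtain ⟨p, hp⟩ := IsZFModel.pairing a b
  refine ⟨p, fun z => (hp z).trans (or_congr ⟨?_, fun h => ?_⟩ ⟨?_, fun h => ?_⟩)⟩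
  · rintro rfl t
    simpa using ha t
  · exact IsZFModel.extensionality _ _ fun t => by rw [h, ha]; simp
  · rintro rfl t
    exact hb t
  · exact IsZFModel.extensionality _ _ fun t => by rw [h, hb]

theorem IsPair.inj {p x y x' y' : V} (h : IsPair p x y) (h' : IsPair p x' y') :
    x = x' ∧ y = y' := by
  obtain ⟨a, ha⟩ := IsZFModel.pairing x x
  obtain ⟨b, hb⟩ := IsZFModel.pairing x y
  obtain ⟨b', hb'⟩ := IsZFModel.pairing x' y'
  have h1 := (h' a).1 ((h a).2 (.inl fun t => by simpa using ha t))
  have h2 := (h' b).1 ((h b).2 (.inr hb))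
  have h4 := (h b').1 ((h' b').2 (.inr hb'))
  simp only [ha, hb, hb', or_self] at h1 h2 h4
  obtain rfl : x = x' := by
    rcases h1 with h1 | h1
    · exact ((h1 x').2 rfl).symm
    · exact ((h1 x').2 (.inl rfl)).symm
  refine ⟨rfl, ?_⟩
  rcases h2 with h2 | h2 <;> rcases h4 with h4 | h4 <;>
    have e2 := h2 y <;> have e4 := h4 y' <;> grind

/-- A definable relation between the elements of two sets is a set of the model. -/
theorem isSetRel₂_of_dfn {P : V → V → Prop} (hP : Dfn fun v : Fin 2 → V => P (v 0) (v 1))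
    (a b : V) : IsSetRel₂ fun (x : El a) (y : El b) => P x.1 y.1 := by
  obtain ⟨ab, hab⟩ := IsZFModel.pairing a b
  obtain ⟨c, hc⟩ := IsZFModel.union ab
  obtain ⟨d, hd⟩ := IsZFModel.powerset c
  obtain ⟨m, hm⟩ := IsZFModel.powerset d
  have hD : Dfn fun v : Fin 1 → V => ∃ x y, IsPair (v 0) x y ∧ P x y :=
    Dfn.ex (Dfn.ex ((Dfn.isPair _ _ _).and
      (Set.Definable.preimage_comp (![1, 2] : Fin 2 → Fin 3) hP)))
  obtain ⟨r, hr⟩ := IsZFModel.separation {p : V | ∃ x y, IsPair p x y ∧ P x y} hD m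
  refine ⟨r, fun x y => ⟨fun h => ?_, ?_⟩⟩
  · obtain ⟨p, hp⟩ := exists_isPair x.1 y.1
    refine ⟨p, hp, (hr p).2 ⟨(hm p).2 fun s hs => (hd s).2 fun t ht => (hc t).2 ?_, _, _, hp, h⟩⟩
    rcases (hp s).1 hs with h1 | h1
    · exact ⟨a, (h1 t).1 ht ▸ x.2, (hab a).2 (.inl rfl)⟩
    · rcases (h1 t).1 ht with rfl | rfl
      · exact ⟨a, x.2, (hab a).2 (.inl rfl)⟩
      · exact ⟨b, y.2, (hab b).2 (.inr rfl)⟩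
  · rintro ⟨p, hp, hpr⟩
    obtain ⟨-, x', y', hp', h⟩ := (hr p).1 hpr
    obtain ⟨h1, h2⟩ := hp.inj hp'
    rw [h1, h2]
    exact h

theorem isSetFun_id (a : V) : IsSetFun (id : El a → El a) := by
  obtain ⟨r, hr⟩ := isSetRel₂_of_dfn (P := fun x y : V => x = y) (Dfn.eq _ _) a a
  exact ⟨r, fun x y => (Subtype.ext_iff.trans Iff.rfl).trans (hr x y)⟩

theorem IsSetFun.comp {a b c : V} {f : El a → El b} {g : El b → El c} (hf : IsSetFun f)
    (hg : IsSetFun g) : IsSetFun (g ∘ f) := by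
  obtain ⟨r, hr⟩ := hf
  obtain ⟨s, hs⟩ := hg
  obtain ⟨t, ht⟩ := isSetRel₂_of_dfn (P := fun x z : V => ∃ y, y ∊ b ∧
    (∃ p, IsPair p x y ∧ p ∊ r) ∧ ∃ p, IsPair p y z ∧ p ∊ s)
    (Dfn.ex ((Dfn.mem_const _ _).and ((Dfn.ex ((Dfn.isPair _ _ _).and (Dfn.mem_const _ _))).and
      (Dfn.ex ((Dfn.isPair _ _ _).and (Dfn.mem_const _ _)))))) a c
  refine ⟨t, fun x z => Iff.trans ?_ (ht x z)⟩
  constructor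
  · rintro rfl
    exact ⟨(f x).1, (f x).2, (hr x _).1 rfl, (hs _ _).1 rfl⟩
  · rintro ⟨y, hy, h1, h2⟩
    have e1 := (hr x ⟨y, hy⟩).2 h1
    have e2 := (hs ⟨y, hy⟩ z).2 h2
    rw [Function.comp_apply, e1, e2]

end Model

/-! ## The categories `COL` and `CUVO` inside a model of ZF -/

section ModelCategories

variable {V : Type w} [setLang.Structure V]

/-- A cylindric ortholattice in the sense of the model `V`, of dimension `I ∈ V`: a set of the
model with operations that are sets of the model. -/
structure VCOL (I : V) where
  carrier : V
  [ortholattice : Ortholattice (El carrier)]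
  [cylindric : CylindricOrtholattice (El I) (El carrier)]
  isSet_inf : IsSetFun₂ fun a b : El carrier => a ⊓ b
  isSet_sup : IsSetFun₂ fun a b : El carrier => a ⊔ b
  isSet_compl : IsSetFun fun a : El carrier => aᶜ
  isSet_ex : IsSetFun₂ fun (i : El I) (a : El carrier) => ex i a
  isSet_diag : IsSetFun₂ fun i k : El I => (diag i k : El carrier)

attribute [instance] VCOL.ortholattice VCOL.cylindric

/-- The homomorphisms that are sets of the model. -/
instance VCOL.instCategory [IsZFModel V] (I : V) : Category (VCOL I) where
  Hom A B := {h : CylHom (El I) (El A.carrier) (El B.carrier) // IsSetFun (fun a => h a)}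
  id A := ⟨CylHom.id _ _, isSetFun_id A.carrier⟩
  comp h g := ⟨h.1.comp g.1, IsSetFun.comp (f := fun a => h.1 a) (g := fun b => g.1 b) h.2 g.2⟩

section VSpace

variable (c top : V)

/-- Open sets with respect to `top ∈ V`, a set of subsets of `c`. -/
def VIsOpen (U : Set (El c)) : Prop := U ∈ traceFamily c top

/-- `top` is a topology on `c` in the sense of the model. -/
structure VIsTopology : Prop where
  subset : ∀ u : V, u ∊ top → ∀ x : V, x ∊ u → x ∊ c
  univ : VIsOpen c top Set.univ
  inter : ∀ U W, VIsOpen c top U → VIsOpen c top W → VIsOpen c top (U ∩ W)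
  sUnion : ∀ t : V, (∀ u : V, u ∊ t → u ∊ top) → VIsOpen c top (⋃₀ traceFamily c t)

/-- Compactness in the sense of the model. -/
def VIsCompact (U : Set (El c)) : Prop :=
  ∀ t : V, (∀ u : V, u ∊ t → u ∊ top) → U ⊆ ⋃₀ traceFamily c t →
    ∃ s : V, (∀ u : V, u ∊ s → u ∊ t) ∧ VFinite s ∧ U ⊆ ⋃₀ traceFamily c s

/-- `CO(X)` in the sense of the model. -/
def VCO : Set (Set (El c)) := {U | VIsCompact c top U ∧ VIsOpen c top U}

/-- `COB(X)` in the sense of the model. -/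
def VCOB (perp : El c → El c → Prop) : Set (Set (El c)) := {U | U ∈ VCO c top ∧ IsBiorth perp U}

/-- Upper Vietoris orthospaces in the sense of the model. -/
structure VIsUVOSpace (perp : El c → El c → Prop) : Prop extends IsOrthoframe perp where
  isTopology : VIsTopology c top
  t0 : ∀ x y : El c, x ≠ y → ∃ U, VIsOpen c top U ∧ ¬ (x ∈ U ↔ y ∈ U)
  basis : ∀ U, VIsOpen c top U → ∀ x ∈ U, ∃ W ∈ VCOB c top perp, x ∈ W ∧ W ⊆ U
  inter_mem : ∀ U W, U ∈ VCOB c top perp → W ∈ VCOB c top perp → U ∩ W ∈ VCOB c top perp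
  orth_mem : ∀ U, U ∈ VCOB c top perp → orth perp U ∈ VCOB c top perp
  filter : ∀ F : V, IsProperFilterIn (VCOB c top perp) (traceFamily c F) →
    ∃ x : El c, traceFamily c F = {U | U ∈ VCOB c top perp ∧ x ∈ U}
  perp_sep : ∀ x y, perp x y → ∃ U ∈ VCOB c top perp, x ∈ U ∧ y ∈ orth perp U

/-- Monadic UVO-spaces in the sense of the model. -/
structure VIsMonadicUVOSpace (perp R : El c → El c → Prop) : Prop
    extends VIsUVOSpace c top perp, IsMonadicOrthoframe perp R where
  image_mem : ∀ U, U ∈ VCOB c top perp → relImage R U ∈ VCOB c top perp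
  rel_sep : ∀ x y, ¬ R x y → ∃ U ∈ VCOB c top perp,
    (∃ W ∈ VCOB c top perp, x ∈ W ∧ U = orth perp (orth perp (relImage R W))) ∧ y ∉ U

/-- Cylindric UVO-spaces in the sense of the model. -/
structure VIsCylindricUVOSpace {I : V} (perp : El c → El c → Prop)
    (R : El I → El c → El c → Prop) (Δ : El I → El I → Set (El c)) : Prop
    extends VIsUVOSpace c top perp, IsCylindricOrthoframe perp R Δ where
  monadicUVO : ∀ i, VIsMonadicUVOSpace c top perp (R i)
  diag_mem : ∀ i k, Δ i k ∈ VCO c top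

end VSpace

/-- A cylindric UVO-space in the sense of the model `V`, of dimension `I ∈ V`. -/
structure VCUVO (I : V) where
  carrier : V
  top : V
  perp : El carrier → El carrier → Prop
  R : El I → El carrier → El carrier → Prop
  Δ : El I → El I → Set (El carrier)
  isSet_perp : IsSetRel₂ perp
  isSet_R : IsSetRel₃ R
  isSet_Δ : IsSetRel₃ fun i k x => x ∈ Δ i k
  isCylindric : VIsCylindricUVOSpace carrier top perp R Δ

/-- Cylindric UVO-maps in the sense of the model. -/
structure VIsCUVOMap {I : V} (X Y : VCUVO I) (f : El X.carrier → El Y.carrier) : Prop where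
  isSet : IsSetFun f
  spectral : ∀ U, U ∈ VCO Y.carrier Y.top → f ⁻¹' U ∈ VCO X.carrier X.top
  nonperp : ∀ x y, ¬ X.perp x y → ¬ Y.perp (f x) (f y)
  lift : ∀ z y, ¬ Y.perp z (f y) →
    ∃ x, ¬ X.perp x y ∧ ∀ U, VIsOpen Y.carrier Y.top U → z ∈ U → f x ∈ U
  image : ∀ i U, U ∈ VCOB Y.carrier Y.top Y.perp →
    relImage (X.R i) (f ⁻¹' U) = f ⁻¹' relImage (Y.R i) U
  diag : ∀ i k, f ⁻¹' Y.Δ i k = X.Δ i k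

theorem VIsCUVOMap.preimage_mem {I : V} {X Y : VCUVO I} {f : El X.carrier → El Y.carrier}
    (hf : VIsCUVOMap X Y f) {U : Set (El Y.carrier)} (hU : U ∈ VCOB Y.carrier Y.top Y.perp) :
    f ⁻¹' U ∈ VCOB X.carrier X.top X.perp := by
  have key : ∀ W, W ∈ VCOB Y.carrier Y.top Y.perp →
      f ⁻¹' orth Y.perp W = orth X.perp (f ⁻¹' W) := fun W hW =>
    preimage_orth (le := fun z w => ∀ U, VIsOpen Y.carrier Y.top U → z ∈ U → w ∈ U)
      X.isCylindric.toIsOrthoframe Y.isCylindric.toIsOrthoframe hf.nonperp hf.lift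
      (fun z w h => h W hW.1.2)
  refine ⟨hf.spectral U hU.1, ?_⟩
  rw [IsBiorth, ← key U hU, ← key _ (Y.isCylindric.orth_mem U hU), hU.2]

variable [IsZFModel V]

theorem VIsCUVOMap.id {I : V} (X : VCUVO I) : VIsCUVOMap X X id :=
  ⟨isSetFun_id _, fun _ h => h, fun _ _ h => h, fun z _ h => ⟨z, h, fun _ _ h => h⟩,
    fun _ _ _ => rfl, fun _ _ => rfl⟩

theorem VIsCUVOMap.comp {I : V} {X Y Z : VCUVO I} {f : El X.carrier → El Y.carrier}
    {g : El Y.carrier → El Z.carrier} (hf : VIsCUVOMap X Y f) (hg : VIsCUVOMap Y Z g) :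
    VIsCUVOMap X Z (g ∘ f) where
  isSet := hf.isSet.comp hg.isSet
  spectral U hU := hf.spectral _ (hg.spectral U hU)
  nonperp x y h := hg.nonperp _ _ (hf.nonperp x y h)
  lift z y h := by
    obtain ⟨x', hx', hz⟩ := hg.lift z (f y) h
    obtain ⟨x, hx, hx''⟩ := hf.lift x' y hx'
    refine ⟨x, hx, fun U hU hzU => ?_⟩
    obtain ⟨W, hW, hzW, hWU⟩ := Z.isCylindric.basis U hU z hzU
    exact hWU (hx'' _ (hg.spectral W hW.1).2 (hz W hW.1.2 hzW))
  image i U hU := by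
    rw [Set.preimage_comp, hf.image i _ (hg.preimage_mem hU), hg.image i U hU]
    rfl
  diag i k := by rw [Set.preimage_comp, hg.diag, hf.diag]

instance VCUVO.instCategory (I : V) : Category (VCUVO I) where
  Hom X Y := {f : El X.carrier → El Y.carrier // VIsCUVOMap X Y f}
  id X := ⟨id, VIsCUVOMap.id X⟩
  comp f g := ⟨g.1 ∘ f.1, f.2.comp g.2⟩

/-- `X` is the spectrum `S₀(A)`, formed in the model: its points are the proper filters of `A`
that are sets of the model, and its topology is generated by the sets `{x | a ∈ x}`. -/
structure VIsSpectrum {I : V} (A : VCOL I) (X : VCUVO I) : Prop where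
  carrier : ∀ x : V, x ∊ X.carrier ↔
    (∀ a : V, a ∊ x → a ∊ A.carrier) ∧ IsProperFilter (trace A.carrier x)
  perp : ∀ x y, X.perp x y ↔ ∃ a ∈ trace A.carrier x.1, aᶜ ∈ trace A.carrier y.1
  R : ∀ i x y, X.R i x y ↔ ∀ a ∈ trace A.carrier x.1, ex i a ∈ trace A.carrier y.1
  Δ : ∀ i k, X.Δ i k = {x | diag i k ∈ trace A.carrier x.1}
  top : ∀ u : V, u ∊ X.top ↔ (∀ x : V, x ∊ u → x ∊ X.carrier) ∧
    ∀ x ∈ trace X.carrier u, ∃ a ∈ trace A.carrier x.1,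
      {y | a ∈ trace A.carrier y.1} ⊆ trace X.carrier u

/-- `A` is the algebra `A₀(X)`, formed in the model: its elements are the compact open
biorthogonally closed sets of `X`. -/
structure VIsCOBAlgebra {I : V} (X : VCUVO I) (A : VCOL I) : Prop where
  carrier : ∀ u : V, u ∊ A.carrier ↔
    (∀ x : V, x ∊ u → x ∊ X.carrier) ∧ trace X.carrier u ∈ VCOB X.carrier X.top X.perp
  inf : ∀ a b : El A.carrier,
    trace X.carrier (a ⊓ b).1 = trace X.carrier a.1 ∩ trace X.carrier b.1
  sup : ∀ a b : El A.carrier, trace X.carrier (a ⊔ b).1 =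
    orth X.perp (orth X.perp (trace X.carrier a.1 ∪ trace X.carrier b.1))
  compl : ∀ a : El A.carrier, trace X.carrier aᶜ.1 = orth X.perp (trace X.carrier a.1)
  bot : trace X.carrier (⊥ : El A.carrier).1 = ∅
  top : trace X.carrier (⊤ : El A.carrier).1 = Set.univ
  ex : ∀ (i : El I) (a : El A.carrier), trace X.carrier (ex i a).1 =
    orth X.perp (orth X.perp (relImage (X.R i) (trace X.carrier a.1)))
  diag : ∀ i k : El I, trace X.carrier (diag i k : El A.carrier).1 = X.Δ i k

end ModelCategories

/-- Contravariant functors `S` and `A` that are mutually quasi-inverse. -/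
def IsDualEquivalence {C : Type*} {D : Type*} [Category C] [Category D]
    (S : Cᵒᵖ ⥤ D) (A : Dᵒᵖ ⥤ C) : Prop :=
  ∃ e : Cᵒᵖ ≌ D, e.functor = S ∧ e.inverse = A.rightOp

/-! ## Dual equivalences from natural isomorphisms -/

/-! The points of the spectrum are all proper filters, not only prime ones, and this is what makes
choice superfluous. For `a ≠ ⊥` the principal filter `Set.Ici a` is the least point of `phi a`.
Testing at this single point shows that `phi` reflects the order (`phi_subset`), that `phi a` is
compact (the member of a cover that contains the least point contains all of `phi a`), that `phi a`
has orthogonal set `phi aᶜ`, and that its image under `R_i` is `phi (ex i a)`. No prime filter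
theorem enters. A compact open set of the spectrum is a finite union of sets `phi a`. By De Morgan
its orthogonal set is a single `phi aᶜ`, so a biorthogonally closed one is itself some `phi a`
(`COB_spec`). Hence `phi` is an isomorphism onto the algebra of the spectrum. For a space, `psi` is
injective by T0 and surjective by the filter axiom; the two separation axioms say that it reflects
orthogonality and the relations. A bijection that respects this structure and pulls `COB` back to
compact open sets is a cylindric UVO-map, and so `psi` is an isomorphism. Inside a model `V` of ZF
the argument is the same, but a filter, cover, relation or function counts only if it is an element
of `V`. Every object that is built must therefore be first-order definable with parameters, after
which separation yields it as a set (`exists_sep`, `exists_trace_eq`, `isSetRel₂_of_defPred`). The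
classes `DefPred` and `DefFun` leave the construction of the formulas to instance search. Finiteness
becomes `VFinite`, whose induction principle `VFinite.induction` holds for definable predicates. The
filters needed (principal ones, those generated by `∃_i[x]` or by the image of a homomorphism, and
preimages) are all definable. The spectrum, its topology and the algebra are determined by
extensionality, so `choose` only names unique objects of `V` and selects nothing. -/

theorem isDualEquivalence_of_natIso {C : Type*} {D : Type*} [Category C] [Category D]
    {S : Cᵒᵖ ⥤ D} {A : Dᵒᵖ ⥤ C} (η : 𝟭 C ≅ S.rightOp ⋙ A) (θ : 𝟭 D ≅ A.rightOp ⋙ S) :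
    IsDualEquivalence S A := by
  let unit : 𝟭 Cᵒᵖ ≅ S ⋙ A.rightOp :=
    NatIso.ofComponents (fun X => (η.app X.unop).op.symm) fun {X Y} f => by
      have h := η.inv.naturality f.unop
      exact Quiver.Hom.unop_inj h.symm
  -- `Equivalence.mk` corrects the unit so that the triangle identity holds; it leaves both functors
  -- as they are, hence the two `rfl`.
  exact ⟨CategoryTheory.Equivalence.mk S A.rightOp unit θ.symm, rfl, rfl⟩

/-- The inverse of a bijective homomorphism. -/
def CylHom.symm {I : Type u} {A B : Type*} [Ortholattice A] [Ortholattice B]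
    [CylindricOrtholattice I A] [CylindricOrtholattice I B] (h : CylHom I A B) (e : A ≃ B)
    (he : ∀ a, e a = h.toFun a) : CylHom I B A where
  toFun := e.symm
  map_sup' a b := by rw [Equiv.symm_apply_eq, he, h.map_sup', ← he, ← he]; simp
  map_inf' a b := by rw [Equiv.symm_apply_eq, he, h.map_inf', ← he, ← he]; simp
  map_top' := by rw [Equiv.symm_apply_eq, he, h.map_top']
  map_bot' := by rw [Equiv.symm_apply_eq, he, h.map_bot']
  map_compl' a := by rw [Equiv.symm_apply_eq, he, h.map_compl', ← he]; simp
  map_ex' i a := by rw [Equiv.symm_apply_eq, he, h.map_ex', ← he]; simp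
  map_diag' i k := by rw [Equiv.symm_apply_eq, he, h.map_diag']

theorem CylHom.ext_toFun {I : Type u} {A B : Type*} [Ortholattice A] [Ortholattice B]
    [CylindricOrtholattice I A] [CylindricOrtholattice I B] {h g : CylHom I A B}
    (H : ∀ a, h.toFun a = g.toFun a) : h = g :=
  DFunLike.coe_injective (funext H)

/-! ## The unit `φ` and the counit `ψ` -/

section Unit

variable {I : Type u}

theorem orth_orth_union_phi {A : Type v} [Ortholattice A] (a b : A) :
    orth (specPerp A) (orth (specPerp A) (phi a ∪ phi b)) = phi (a ⊔ b) := by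
  rw [orth_union, orth_phi, orth_phi, ← phi_inf, ← Ortholattice.compl_sup, orth_phi,
    Ortholattice.compl_compl]

/-- The homomorphism `φ : A → A₀(S₀(A))`. -/
def phiHom (A : COL.{u, v} I) : CylHom I A.carrier (A₀ (S₀ A)).carrier where
  toFun a := ⟨phi a, phi_mem_COB a⟩
  map_sup' a b := Subtype.ext (orth_orth_union_phi a b).symm
  map_inf' a b := Subtype.ext (phi_inf a b)
  map_top' := Subtype.ext phi_top
  map_bot' := Subtype.ext phi_bot
  map_compl' a := Subtype.ext (orth_phi a).symm
  map_ex' i a := Subtype.ext (by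
    show phi (ex i a) = orth (specPerp A.carrier) (orth (specPerp A.carrier)
      (relImage (specR I A.carrier i) (phi a)))
    rw [relImage_phi, isBiorth_phi])
  map_diag' i k := rfl

/-- Injectivity is the order reflection given by principal filters; surjectivity is the description
of `COB` of the spectrum in `COB_spec`. -/
theorem phiHom_bijective (A : COL.{u, v} I) : Function.Bijective (phiHom A).toFun := by
  constructor
  · intro a b h
    have h' : phi a = phi b := congrArg Subtype.val h
    exact le_antisymm (phi_subset.1 h'.le) (phi_subset.1 h'.ge)
  · rintro ⟨U, hU⟩
    obtain ⟨a, rfl⟩ := COB_spec.le hU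
    exact ⟨a, rfl⟩

/-- `φ` as an isomorphism of cylindric ortholattices. -/
noncomputable def phiIso (A : COL.{u, v} I) : A ≅ A₀ (S₀ A) where
  hom := phiHom A
  inv := (phiHom A).symm (Equiv.ofBijective _ (phiHom_bijective A)) fun _ => rfl
  hom_inv_id := CylHom.ext_toFun fun a =>
    (Equiv.ofBijective _ (phiHom_bijective A)).symm_apply_apply a
  inv_hom_id := CylHom.ext_toFun fun a =>
    (Equiv.ofBijective _ (phiHom_bijective A)).apply_symm_apply a

/-- `φ` as a natural isomorphism. -/
noncomputable def phiNatIso (I : Type u) : 𝟭 (COL.{u, v} I) ≅ (S_F I).rightOp ⋙ A_F I :=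
  -- Naturality is `S₁fun_preimage_phi`, which holds by definition.
  NatIso.ofComponents phiIso fun _ => rfl

/-- An isomorphism of the structures of two cylindric UVO-spaces is a cylindric UVO-map. -/
theorem isCUVOMap_of_equiv {X Y : CUVO.{u, v} I} (e : X.carrier ≃ Y.carrier)
    (hB : ∀ U ∈ COB Y.perp, e ⁻¹' U ∈ CO X.carrier)
    (hp : ∀ x y, X.perp x y ↔ Y.perp (e x) (e y))
    (hR : ∀ i x y, X.R i x y ↔ Y.R i (e x) (e y)) (hΔ : ∀ i k, e ⁻¹' Y.Δ i k = X.Δ i k) :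
    IsCUVOMap X Y e where
  spectral U hU := by
    -- A compact open set is a finite union of members of the basis `COB`, so `hB` on the basis
    -- suffices.
    have hYB : TopologicalSpace.IsTopologicalBasis
        (Set.range (Subtype.val : COB Y.perp → Set Y.carrier)) := by
      rw [Subtype.range_coe]; exact Y.isCylindric.basis
    obtain ⟨s, hs, rfl⟩ := (isCompact_open_iff_eq_finite_iUnion_of_isTopologicalBasis
      (Subtype.val : COB Y.perp → Set Y.carrier) hYB (fun a => a.2.1.1) U).1 hU
    rw [Set.preimage_iUnion₂]
    exact ⟨hs.isCompact_biUnion fun a _ => (hB a.1 a.2).1,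
        isOpen_biUnion fun a _ => (hB a.1 a.2).2⟩
  nonperp x y h := by rwa [← hp]
  lift z y h := ⟨e.symm z, by rwa [hp, e.apply_symm_apply], by simp⟩
  image i U _ := by
    ext y
    constructor
    · rintro ⟨x, hx, hxy⟩
      exact ⟨e x, hx, (hR i x y).1 hxy⟩
    · rintro ⟨x, hx, hxy⟩
      refine ⟨e.symm x, by simpa using hx, ?_⟩
      rwa [hR, e.apply_symm_apply]
  diag := hΔ

variable (X : CUVO.{u, v} I)

/-- `ψ x`, the filter of those `U ∈ COB(X)` that contain `x`. -/
def psi (x : X.carrier) : (S₀ (A₀ X)).carrier :=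
  ⟨{U : {U // U ∈ COB X.perp} | x ∈ U.1},
    { nonempty := ⟨⟨Set.univ, X.univ_mem⟩, trivial⟩
      upward := fun _ _ hU h => h hU
      inf_mem := fun _ _ hU hW => ⟨hU, hW⟩
      proper := fun h => (h.ge (Set.mem_univ ⟨∅, X.empty_mem⟩) : x ∈ (∅ : Set X.carrier)) }⟩

/-- Points that lie in the same basic sets are inseparable, hence equal by T0. For surjectivity a
filter of the algebra is turned into a family of sets, to which the filter axiom applies. -/
theorem psi_bijective : Function.Bijective (psi X) := by
  constructor
  · intro x y h
    have := X.isCylindric.t0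
    refine X.isCylindric.basis.inseparable_iff.2 (fun U hU => ?_) |>.eq
    exact Set.ext_iff.1 (congrArg Subtype.val h) ⟨U, hU⟩
  · rintro ⟨y, hy⟩
    have hF : IsProperFilterIn (COB X.perp) (Subtype.val '' y) := by
      refine ⟨?_, hy.nonempty.image _, ?_, ?_, ?_⟩
      · rintro _ ⟨U, -, rfl⟩
        exact U.2
      · rintro _ W ⟨U, hU, rfl⟩ hW h
        exact ⟨⟨W, hW⟩, hy.upward U ⟨W, hW⟩ hU h, rfl⟩
      · rintro _ _ ⟨U, hU, rfl⟩ ⟨W, hW, rfl⟩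
        exact ⟨U ⊓ W, hy.inf_mem _ _ hU hW, rfl⟩
      · intro h
        refine hy.proper (Set.eq_univ_of_forall fun U => ?_)
        obtain ⟨W, hW, hWU⟩ := h.ge U.2
        rwa [← Subtype.ext hWU]
    obtain ⟨x, hx⟩ := X.isCylindric.filter _ hF
    refine ⟨x, Subtype.ext (Set.ext fun U => ?_)⟩
    constructor
    · intro hU
      obtain ⟨W, hW, hWU⟩ := hx.ge ⟨U.2, hU⟩
      rwa [← Subtype.ext hWU]
    · intro hU
      exact (hx.le ⟨U, hU, rfl⟩).2

/-- `ψ` as a bijection. -/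
noncomputable def psiEquiv : X.carrier ≃ (S₀ (A₀ X)).carrier :=
  Equiv.ofBijective _ (psi_bijective X)

/-- One direction is the axiom `perp_sep`; the other uses only the symmetry of `⊥`. -/
theorem psi_perp (x y : X.carrier) :
    X.perp x y ↔ (S₀ (A₀ X)).perp (psiEquiv X x) (psiEquiv X y) := by
  constructor
  · intro h
    obtain ⟨U, hU, hx, hy⟩ := X.isCylindric.perp_sep x y h
    exact ⟨⟨U, hU⟩, hx, hy⟩
  · rintro ⟨U, hx, hy⟩
    exact X.isCylindric.toIsOrthoframe.symm _ _ (hy x hx)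

theorem psi_R (i : I) (x y : X.carrier) :
    X.R i x y ↔ (S₀ (A₀ X)).R i (psiEquiv X x) (psiEquiv X y) := by
  constructor
  · rintro h _ ⟨U, hU, rfl⟩
    exact subset_orth_orth X.isCylindric.toIsOrthoframe _ ⟨x, hU, h⟩
  · intro h
    by_contra hn
    -- The separating set is `∃_i W` with `x ∈ W`: the filter of `x` contains `W`, while that of `y`
    -- omits `∃_i W`.
    obtain ⟨_, -, ⟨W, hW, hx, rfl⟩, hy⟩ := (X.isCylindric.monadicUVO i).rel_sep x y hn
    exact hy (h ⟨⟨W, hW⟩, hx, rfl⟩)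

theorem isCUVOMap_psi : IsCUVOMap X (S₀ (A₀ X)) (psiEquiv X) := by
  refine isCUVOMap_of_equiv _ (fun U hU => ?_) (psi_perp X) (psi_R X) fun _ _ => rfl
  obtain ⟨W, rfl⟩ := COB_spec.le hU
  exact W.2.1

/-- Every `U ∈ COB(X)` is the `psi`-preimage of `phi U`, so its preimage under the inverse is `phi
U`, which is compact open. -/
theorem isCUVOMap_psi_symm : IsCUVOMap (S₀ (A₀ X)) X (psiEquiv X).symm := by
  refine isCUVOMap_of_equiv _ (fun U hU => ?_) (fun x y => ?_) (fun i x y => ?_) fun i k => ?_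
  · let W : (A₀ X).carrier := ⟨U, hU⟩
    have h : (psiEquiv X).symm ⁻¹' (psiEquiv X ⁻¹' phi W) = phi W :=
      (psiEquiv X).symm_preimage_preimage _
    exact (congrArg (· ∈ CO (ProperFilter (A₀ X).carrier)) h).mpr (phi_mem_CO W)
  · rw [psi_perp X, Equiv.apply_symm_apply, Equiv.apply_symm_apply]
  · rw [psi_R X, Equiv.apply_symm_apply, Equiv.apply_symm_apply]
  · rw [← (isCUVOMap_psi X).diag, ← Set.preimage_comp, Equiv.self_comp_symm]; rfl

/-- `ψ` as an isomorphism of cylindric UVO-spaces. -/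
noncomputable def psiIso : X ≅ S₀ (A₀ X) where
  hom := ⟨psiEquiv X, isCUVOMap_psi X⟩
  inv := ⟨(psiEquiv X).symm, isCUVOMap_psi_symm X⟩
  hom_inv_id := Subtype.ext (Equiv.symm_comp_self _)
  inv_hom_id := Subtype.ext (Equiv.self_comp_symm _)

/-- `ψ` as a natural isomorphism. -/
noncomputable def psiNatIso (I : Type u) : 𝟭 (CUVO.{u, v} I) ≅ (A_F I).rightOp ⋙ S_F I :=
  NatIso.ofComponents psiIso fun _ => rfl

end Unit

/-! ## Definable types, predicates and functions over a model -/

section Definability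

variable {V : Type w} [setLang.Structure V]

/-- A type whose elements are coded by the tuples in a definable set. -/
class DefType (V : outParam (Type w)) [setLang.Structure V] (T : Type*) where
  ix : Type
  finite : Finite ix
  code : T → ix → V
  injective : Function.Injective code
  range : (Set.univ : Set V).Definable setLang (Set.range code)

attribute [instance] DefType.finite

open DefType (code)

instance DefType.self : DefType V V where
  ix := Unit
  finite := inferInstance
  code x _ := x
  injective _ _ h := congrFun h ()
  range := by
    convert Set.definable_univ
    exact Set.eq_univ_of_forall fun v => ⟨v (), rfl⟩

instance DefType.el (c : V) : DefType V (El c) where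
  ix := Unit
  finite := inferInstance
  code x _ := x.1
  injective _ _ h := Subtype.ext (congrFun h ())
  range := by
    convert (Dfn.mem_const (0 : Fin 1) c).preimage_comp (fun _ => ())
    ext v
    exact ⟨fun ⟨x, hx⟩ => hx ▸ x.2, fun h => ⟨⟨v (), h⟩, rfl⟩⟩

instance DefType.prod {T S : Type*} [DefType V T] [DefType V S] : DefType V (T × S) where
  ix := DefType.ix T ⊕ DefType.ix S
  finite := inferInstance
  code p := Sum.elim (code p.1) (code p.2)
  injective p q h := by
    have h1 := congrArg (fun v => v ∘ Sum.inl) h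
    have h2 := congrArg (fun v => v ∘ Sum.inr) h
    simp only [Sum.elim_comp_inl, Sum.elim_comp_inr] at h1 h2
    exact Prod.ext (DefType.injective h1) (DefType.injective h2)
  range := by
    convert ((DefType.range (T := T)).preimage_comp Sum.inl).inter
      ((DefType.range (T := S)).preimage_comp Sum.inr)
    ext v
    constructor
    · rintro ⟨p, rfl⟩
      exact ⟨⟨p.1, rfl⟩, ⟨p.2, rfl⟩⟩
    · rintro ⟨⟨t, ht⟩, ⟨s, hs⟩⟩
      refine ⟨(t, s), ?_⟩
      dsimp only
      rw [ht, hs]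
      exact Sum.elim_comp_inl_inr v

/-- A definable predicate on a definable type. -/
class DefPred {T : Type*} [DefType V T] (P : T → Prop) : Prop where
  out : (Set.univ : Set V).Definable setLang (code '' {t | P t})

/-- A definable function between definable types. -/
class DefFun {T S : Type*} [DefType V T] [DefType V S] (f : T → S) : Prop where
  graph : DefPred fun p : T × S => f p.1 = p.2

/-! ### Closure properties of definable predicates and functions -/

section Basic

variable {T S R : Type*} [DefType V T] [DefType V S] [DefType V R]

/-- Its use is to replace a predicate in set notation by an explicit first-order formula that
instance search can take apart. -/
theorem DefPred.congr {P Q : T → Prop} (h : DefPred P) (H : ∀ t, Q t ↔ P t) : DefPred Q := by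
  rwa [show Q = P from funext fun t => propext (H t)]

/-- The complement is taken within the set of codes, so this set itself must be definable; this is
the role of `DefType.range`. -/
instance DefPred.not {P : T → Prop} [h : DefPred P] : DefPred fun t => ¬ P t := by
  refine ⟨?_⟩
  have : code '' {t : T | ¬ P t} = Set.range code \ code '' {t | P t} :=
    (Set.range_sdiff_image DefType.injective _).symm
  rw [this]
  exact DefType.range.sdiff h.out

instance DefPred.and {P Q : T → Prop} [h : DefPred P] [h' : DefPred Q] :
    DefPred fun t => P t ∧ Q t := by
  refine ⟨?_⟩
  have : code '' {t : T | P t ∧ Q t} = code '' {t | P t} ∩ code '' {t | Q t} :=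
    Set.image_inter DefType.injective
  rw [this]
  exact h.out.inter h'.out

instance DefPred.or {P Q : T → Prop} [h : DefPred P] [h' : DefPred Q] :
    DefPred fun t => P t ∨ Q t := by
  refine ⟨?_⟩
  have : code '' {t : T | P t ∨ Q t} = code '' {t | P t} ∪ code '' {t | Q t} :=
    Set.image_union _ _ _
  rw [this]
  exact h.out.union h'.out

instance DefPred.imp {P Q : T → Prop} [DefPred P] [DefPred Q] : DefPred fun t => P t → Q t :=
  (inferInstance : DefPred fun t => ¬ P t ∨ Q t).congr fun _ => imp_iff_not_or

instance DefPred.iff {P Q : T → Prop} [DefPred P] [DefPred Q] : DefPred fun t => P t ↔ Q t :=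
  (inferInstance : DefPred fun t => (P t → Q t) ∧ (Q t → P t)).congr
    fun _ => iff_iff_implies_and_implies

theorem DefPred.true : DefPred fun _ : T => True := by
  refine ⟨?_⟩
  rw [show {t : T | True} = Set.univ from rfl, Set.image_univ]
  exact DefType.range

/-- An existential quantifier is a projection that drops the coordinates coding `s`. There are
finitely many of them, so definability survives. -/
instance DefPred.ex {P : T → S → Prop} [h : DefPred fun p : T × S => P p.1 p.2] :
    DefPred fun t => ∃ s, P t s := by
  refine ⟨?_⟩
  have : code '' {t : T | ∃ s, P t s} =
      (fun v => v ∘ Sum.inl) '' (code '' {p : T × S | P p.1 p.2}) := by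
    rw [← Set.image_comp]
    ext v
    constructor
    · rintro ⟨t, ⟨s, hs⟩, rfl⟩
      exact ⟨(t, s), hs, rfl⟩
    · rintro ⟨p, hp, rfl⟩
      exact ⟨p.1, ⟨p.2, hp⟩, rfl⟩
  rw [this]
  exact h.out.image_comp Sum.inl

instance DefPred.all {P : T → S → Prop} [h : DefPred fun p : T × S => P p.1 p.2] :
    DefPred fun t => ∀ s, P t s :=
  (inferInstance : DefPred fun t => ¬ ∃ s, ¬ P t s).congr fun _ => by push Not; rfl

/-- If `r` only selects coordinates of the code, substitution of `r` is a renaming of variables. -/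
theorem DefPred.reindex {P : T → Prop} (h : DefPred P) {r : S → T}
    (hr : ∃ ρ : DefType.ix T → DefType.ix S, ∀ s, code (r s) = code s ∘ ρ) :
    DefPred fun s => P (r s) := by
  obtain ⟨ρ, hρ⟩ := hr
  refine ⟨?_⟩
  have : code '' {s : S | P (r s)} =
      Set.range code ∩ (fun v => v ∘ ρ) ⁻¹' (code '' {t | P t}) := by
    ext v
    constructor
    · rintro ⟨s, hs, rfl⟩
      exact ⟨⟨s, rfl⟩, ⟨r s, hs, hρ s⟩⟩
    · rintro ⟨⟨s, rfl⟩, ⟨t, ht, hts⟩⟩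
      have : t = r s := DefType.injective (hts.trans (hρ s).symm)
      exact ⟨s, (this ▸ ht : P (r s)), rfl⟩
  rw [this]
  exact DefType.range.inter (h.out.preimage_comp ρ)

/-- As codes are injective, equality is a finite conjunction of equalities of coordinates. -/
theorem DefPred.diagonal : DefPred fun p : T × T => p.1 = p.2 := by
  refine ⟨?_⟩
  have : code '' {p : T × T | p.1 = p.2} = Set.range code ∩
      ⋂ i : DefType.ix T, {v | v (Sum.inl i) = v (Sum.inr i)} := by
    ext v
    constructor
    · rintro ⟨p, hp, rfl⟩
      refine ⟨⟨p, rfl⟩, Set.mem_iInter.2 fun i => ?_⟩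
      exact congrArg (fun t : T => code t i) hp
    · rintro ⟨⟨p, rfl⟩, h⟩
      exact ⟨p, DefType.injective (funext fun i => Set.mem_iInter.1 h i), rfl⟩
  rw [this]
  refine DefType.range.inter (Set.definable_iInter_of_finite fun i => ?_)
  exact (Dfn.eq (0 : Fin 2) 1).preimage_comp ![Sum.inl i, Sum.inr i]

/-- Parameters enter here: the coordinates of the code of `t` serve as constants. -/
theorem DefPred.singleton (t : T) : DefPred fun s : T => t = s := by
  refine ⟨?_⟩
  have : code '' {s : T | t = s} = ⋂ i : DefType.ix T, {v | v i = code t i} := by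
    ext v
    constructor
    · rintro ⟨s, rfl, rfl⟩
      exact Set.mem_iInter.2 fun i => rfl
    · intro h
      exact ⟨t, rfl, funext fun i => (Set.mem_iInter.1 h i).symm⟩
  rw [this]
  refine Set.definable_iInter_of_finite fun i => ?_
  exact (Dfn.eq_const (0 : Fin 1) (code t i)).preimage_comp fun _ => i

/-- The language has no function symbols, so `P (f t)` is expressed through the graph, as `∃ s, f t
= s ∧ P s`. -/
theorem DefPred.comp {P : S → Prop} (h : DefPred P) {f : T → S} (hf : DefFun f) :
    DefPred fun t => P (f t) := by
  have := hf.graph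
  have h' : DefPred fun p : T × S => P p.2 := h.reindex ⟨Sum.inr, fun _ => rfl⟩
  exact (inferInstance : DefPred fun t => ∃ s, f t = s ∧ P s).congr fun t => by simp

theorem DefFun.of_reindex {r : S → T}
    (hr : ∃ ρ : DefType.ix T → DefType.ix S, ∀ s, code (r s) = code s ∘ ρ) : DefFun r := by
  obtain ⟨ρ, hρ⟩ := hr
  refine ⟨DefPred.reindex (r := fun p : S × T => (r p.1, p.2)) DefPred.diagonal
    ⟨Sum.elim (Sum.inl ∘ ρ) Sum.inr, fun p => ?_⟩⟩
  funext i
  rcases i with i | i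
  · exact congrFun (hρ p.1) i
  · rfl

theorem DefFun.comp' {g : S → R} (hg : DefFun g) {f : T → S} (hf : DefFun f) :
    DefFun fun t => g (f t) := by
  have h1 : DefPred fun q : (T × R) × S => f q.1.1 = q.2 :=
    hf.graph.reindex (r := fun q : (T × R) × S => (q.1.1, q.2))
      ⟨Sum.elim (Sum.inl ∘ Sum.inl) Sum.inr, fun q => by funext i; rcases i with i | i <;> rfl⟩
  have h2 : DefPred fun q : (T × R) × S => g q.2 = q.1.2 :=
    hg.graph.reindex (r := fun q : (T × R) × S => (q.2, q.1.2))
      ⟨Sum.elim Sum.inr (Sum.inl ∘ Sum.inr), fun q => by funext i; rcases i with i | i <;> rfl⟩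
  exact ⟨(inferInstance : DefPred fun p : T × R => ∃ s, f p.1 = s ∧ g s = p.2).congr
    fun p => by simp⟩

instance DefFun.const (s : S) : DefFun fun _ : T => s :=
  ⟨(DefPred.singleton s).reindex (r := fun p : T × S => p.2) ⟨Sum.inr, fun _ => rfl⟩⟩

instance DefFun.id : DefFun fun t : T => t := DefFun.of_reindex ⟨_root_.id, fun _ => rfl⟩

instance DefFun.fst {f : T → S × R} [hf : DefFun f] : DefFun fun t => (f t).1 :=
  DefFun.comp' (g := Prod.fst) (DefFun.of_reindex ⟨Sum.inl, fun _ => rfl⟩) hf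

instance DefFun.snd {f : T → S × R} [hf : DefFun f] : DefFun fun t => (f t).2 :=
  DefFun.comp' (g := Prod.snd) (DefFun.of_reindex ⟨Sum.inr, fun _ => rfl⟩) hf

instance DefFun.val {c : V} {f : T → El c} [hf : DefFun f] : DefFun fun t => (f t).1 :=
  DefFun.comp' (g := fun x : El c => x.1) (DefFun.of_reindex ⟨_root_.id, fun _ => rfl⟩) hf

theorem DefFun.pair {f : T → S} {g : T → R} [hf : DefFun f] [hg : DefFun g] :
    DefFun fun t => (f t, g t) := by
  have h1 : DefPred fun q : T × S × R => f q.1 = q.2.1 :=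
    hf.graph.comp (f := fun q : T × S × R => (q.1, q.2.1)) (DefFun.of_reindex
      ⟨Sum.elim Sum.inl (Sum.inr ∘ Sum.inl), fun q => by funext i; rcases i with i | i <;> rfl⟩)
  have h2 : DefPred fun q : T × S × R => g q.1 = q.2.2 :=
    hg.graph.comp (f := fun q : T × S × R => (q.1, q.2.2)) (DefFun.of_reindex
      ⟨Sum.elim Sum.inl (Sum.inr ∘ Sum.inr), fun q => by funext i; rcases i with i | i <;> rfl⟩)
  exact ⟨(inferInstance : DefPred fun q : T × S × R => f q.1 = q.2.1 ∧ g q.1 = q.2.2).congr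
    fun q => Prod.ext_iff⟩

theorem DefPred.comp₂ {P : S → R → Prop} (h : DefPred fun p : S × R => P p.1 p.2) {f : T → S}
    {g : T → R} (hf : DefFun f) (hg : DefFun g) : DefPred fun t => P (f t) (g t) :=
  h.comp DefFun.pair

theorem DefPred.comp₃ {Q : Type*} [DefType V Q] {P : S → R → Q → Prop}
    (h : DefPred fun p : S × R × Q => P p.1 p.2.1 p.2.2) {f : T → S} {g : T → R} {k : T → Q}
    (hf : DefFun f) (hg : DefFun g) (hk : DefFun k) : DefPred fun t => P (f t) (g t) (k t) :=
  h.comp (f := fun t => (f t, g t, k t)) (@DefFun.pair _ _ _ _ _ _ _ _ _ _ hf DefFun.pair)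

instance DefPred.eq {f g : T → S} [hf : DefFun f] [hg : DefFun g] :
    DefPred fun t => f t = g t :=
  DefPred.diagonal.comp₂ hf hg

instance DefPred.vmem {f g : T → V} [hf : DefFun f] [hg : DefFun g] :
    DefPred fun t => f t ∊ g t := by
  have : DefPred fun p : V × V => p.1 ∊ p.2 := by
    refine ⟨?_⟩
    have h := (Dfn.mem (V := V) (0 : Fin 2) 1).preimage_comp
      ![(Sum.inl () : Unit ⊕ Unit), Sum.inr ()]
    refine (congrArg (Set.Definable Set.univ setLang) (Set.ext fun v => ?_)).mp h
    refine Iff.symm ?_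
    constructor
    · rintro ⟨p, hp, rfl⟩
      exact hp
    · intro h
      refine ⟨(v (Sum.inl ()), v (Sum.inr ())), h, ?_⟩
      funext i
      rcases i with i | i <;> rfl
  exact this.comp₂ hf hg

instance DefPred.isPair {p x y : T → V} [hp : DefFun p] [hx : DefFun x] [hy : DefFun y] :
    DefPred fun t => IsPair (p t) (x t) (y t) :=
  (inferInstance : DefPred fun t : V × V × V => ∀ z : V, z ∊ t.1 ↔
    (∀ s : V, s ∊ z ↔ s = t.2.1) ∨ (∀ s : V, s ∊ z ↔ s = t.2.1 ∨ s = t.2.2)).comp₃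
    (P := IsPair) hp hx hy

instance DefPred.mem_trace {c : V} {f : T → El c} {g : T → V} [DefFun f] [DefFun g] :
    DefPred fun t => f t ∈ trace c (g t) :=
  (inferInstance : DefPred fun t => (f t).1 ∊ g t)

/-- A relation that is a set `r` of the model is definable with `r` as parameter. Conversely,
`isSetRel₂_of_defPred` makes definable relations sets. -/
theorem DefPred.rel₂ {a b : V} {P : El a → El b → Prop} (hP : IsSetRel₂ P) {f : T → El a}
    {g : T → El b} [hf : DefFun f] [hg : DefFun g] : DefPred fun t => P (f t) (g t) := by
  obtain ⟨r, hr⟩ := hP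
  exact ((inferInstance : DefPred fun t : El a × El b =>
    ∃ p : V, IsPair p t.1.1 t.2.1 ∧ p ∊ r).congr fun t => hr _ _).comp₂ (P := P) hf hg

theorem DefPred.rel₃ {a b c : V} {P : El a → El b → El c → Prop} (hP : IsSetRel₃ P)
    {f : T → El a} {g : T → El b} {h : T → El c} [hf : DefFun f] [hg : DefFun g] [hh : DefFun h] :
    DefPred fun t => P (f t) (g t) (h t) := by
  obtain ⟨r, hr⟩ := hP
  exact ((inferInstance : DefPred fun t : El a × El b × El c => ∃ q p : V,
    IsPair q t.1.1 t.2.1.1 ∧ IsPair p q t.2.2.1 ∧ p ∊ r).congr fun t => hr _ _ _).comp₃ (P := P) hf hg hh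

theorem DefFun.app {a b : V} {F : El a → El b} (hF : IsSetFun F) {f : T → El a}
    [hf : DefFun f] : DefFun fun t => F (f t) :=
  DefFun.comp' (g := F) ⟨DefPred.rel₂ hF (f := fun p : El a × El b => p.1) (g := fun p => p.2)⟩ hf

theorem DefFun.app₂ {a b c : V} {F : El a → El b → El c} (hF : IsSetFun₂ F) {f : T → El a}
    {g : T → El b} [DefFun f] [DefFun g] : DefFun fun t => F (f t) (g t) :=
  DefFun.comp' (g := fun p : El a × El b => F p.1 p.2)
    ⟨DefPred.rel₃ hF (f := fun p : (El a × El b) × El c => p.1.1) (g := fun p => p.1.2)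
      (h := fun p => p.2)⟩ (f := fun t => (f t, g t)) DefFun.pair

set_option synthInstance.maxSize 1000 in
set_option synthInstance.maxHeartbeats 200000 in
-- Internal finiteness quantifies over elements `K` of the model only, and is therefore first-order.
instance DefPred.vfinite {f : T → V} [hf : DefFun f] : DefPred fun t => VFinite (f t) :=
  (inferInstance : DefPred fun s : V => ∀ K : V, (∃ e : V, e ∊ K ∧ ∀ t : V, ¬ t ∊ e) →
    (∀ u x : V, u ∊ K → x ∊ s → ∃ u' : V, u' ∊ K ∧ ∀ t : V, t ∊ u' ↔ t ∊ u ∨ t = x) →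
      s ∊ K).comp hf

theorem DefPred.dfn {P : V → Prop} (h : DefPred P) :
    (Set.univ : Set V).Definable₁ setLang {x | P x} := by
  refine (congrArg (Set.Definable Set.univ setLang) (Set.ext fun v => ?_)).mp
    (h.out.preimage_comp (fun _ : Unit => (0 : Fin 1)))
  constructor
  · rintro ⟨x, hx, hxv⟩
    have : x = v 0 := congrFun hxv ()
    exact (this ▸ hx : P (v 0))
  · intro hv
    exact ⟨v 0, hv, rfl⟩

end Basic

/-! ### From definable predicates to sets of the model -/

section Sets

variable [IsZFModel V]


/-- A trace forgets the elements outside `c`, so extensionality applies only to subsets of `c`. -/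
theorem trace_injOn {c u w : V} (hu : ∀ x : V, x ∊ u → x ∊ c) (hw : ∀ x : V, x ∊ w → x ∊ c)
    (h : trace c u = trace c w) : u = w :=
  IsZFModel.extensionality _ _ fun z =>
    ⟨fun hz => h.le (show (⟨z, hu z hz⟩ : El c) ∈ trace c u from hz),
      fun hz => h.ge (show (⟨z, hw z hz⟩ : El c) ∈ trace c w from hz)⟩

theorem exists_sep {P : V → Prop} (h : DefPred P) (c : V) :
    ∃ z : V, ∀ t : V, t ∊ z ↔ t ∊ c ∧ P t :=
  IsZFModel.separation _ h.dfn c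

theorem exists_trace_eq {c : V} {P : El c → Prop} (h : DefPred P) :
    ∃ u : V, (∀ x : V, x ∊ u → x ∊ c) ∧ trace c u = {x | P x} := by
  -- Separation needs a class of elements of `V`, so `P` is extended from `El c` to all of `V`.
  have : DefPred fun x : V => ∃ y : El c, y.1 = x ∧ P y := by
    have : DefPred fun p : V × El c => P p.2 := h.comp (f := fun p : V × El c => p.2) inferInstance
    infer_instance
  obtain ⟨u, hu⟩ := exists_sep this c
  refine ⟨u, fun x hx => ((hu x).1 hx).1, Set.ext fun x => ?_⟩
  refine (hu x.1).trans ⟨?_, fun hx => ⟨x.2, x, rfl, hx⟩⟩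
  rintro ⟨-, y, hy, hP⟩
  exact (Subtype.ext hy : y = x) ▸ hP

theorem IsPair.unique {p q x y : V} (hp : IsPair p x y) (hq : IsPair q x y) : p = q :=
  IsZFModel.extensionality _ _ fun z => (hp z).trans (hq z).symm

theorem isSetRel₂_of_defPred {a b : V} {P : El a → El b → Prop}
    (h : DefPred fun p : El a × El b => P p.1 p.2) : IsSetRel₂ P := by
  have hd : DefPred fun p : V × V => ∃ (x : El a) (y : El b), x.1 = p.1 ∧ y.1 = p.2 ∧ P x y := by
    have : DefPred fun q : ((V × V) × El a) × El b => P q.1.2 q.2 :=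
      h.comp₂ (P := P) inferInstance inferInstance
    infer_instance
  have hd' : Dfn fun v : Fin 2 → V =>
      ∃ (x : El a) (y : El b), x.1 = v 0 ∧ y.1 = v 1 ∧ P x y := by
    refine (congrArg (Set.Definable Set.univ setLang) (Set.ext fun v => ?_)).mp
      (hd.out.preimage_comp (Sum.elim (fun _ => (0 : Fin 2)) (fun _ => 1)))
    constructor
    · rintro ⟨p, ⟨x, y, hx, hy, hP⟩, hpv⟩
      exact ⟨x, y, hx.trans (congrFun hpv (Sum.inl ())), hy.trans (congrFun hpv (Sum.inr ())), hP⟩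
    · intro hv
      refine ⟨(v 0, v 1), hv, ?_⟩
      funext i
      rcases i with i | i <;> rfl
  obtain ⟨r, hr⟩ := isSetRel₂_of_dfn
    (P := fun s t => ∃ (x : El a) (y : El b), x.1 = s ∧ y.1 = t ∧ P x y) hd' a b
  refine ⟨r, fun x y => Iff.trans ⟨fun h => ⟨x, y, rfl, rfl, h⟩, ?_⟩ (hr x y)⟩
  rintro ⟨x', y', hx, hy, hP⟩
  obtain rfl : x' = x := Subtype.ext hx
  obtain rfl : y' = y := Subtype.ext hy
  exact hP

theorem isSetRel₃_of_defPred {a b c : V} {P : El a → El b → El c → Prop}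
    (h : DefPred fun p : El a × El b × El c => P p.1 p.2.1 p.2.2) : IsSetRel₃ P := by
  -- `D` contains all pairs from `a` and `b`, so the ternary relation becomes a binary one between
  -- `D` and `c`. Other elements of `D` do no harm, since the relation asks for a pair.
  obtain ⟨D, hD⟩ := isSetRel₂_of_defPred (a := a) (b := b) (P := fun _ _ => True) DefPred.true
  have hd : DefPred fun p : El D × El c =>
      ∃ (x : El a) (y : El b), IsPair p.1.1 x.1 y.1 ∧ P x y p.2 := by
    have : DefPred fun q : ((El D × El c) × El a) × El b => P q.1.2 q.2 q.1.1.2 :=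
      h.comp₃ (P := P) inferInstance inferInstance inferInstance
    infer_instance
  obtain ⟨r, hr⟩ := isSetRel₂_of_defPred
    (P := fun q z => ∃ (x : El a) (y : El b), IsPair q.1 x.1 y.1 ∧ P x y z) hd
  refine ⟨r, fun x y z => ?_⟩
  obtain ⟨q, hq, hqD⟩ := (hD x y).1 trivial
  constructor
  · intro hP
    obtain ⟨p, hp, hpr⟩ := (hr ⟨q, hqD⟩ z).1 ⟨x, y, hq, hP⟩
    exact ⟨q, p, hq, hp, hpr⟩
  · rintro ⟨q', p, hq', hp, hpr⟩
    obtain rfl := hq.unique hq'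
    obtain ⟨x', y', hxy, hP⟩ := (hr ⟨q, hqD⟩ z).2 ⟨p, hp, hpr⟩
    obtain ⟨h1, h2⟩ := hq.inj hxy
    obtain rfl : x = x' := Subtype.ext h1
    obtain rfl : y = y' := Subtype.ext h2
    exact hP

theorem isSetFun_of_defPred {a b : V} {f : El a → El b}
    (h : DefPred fun p : El a × El b => f p.1 = p.2) : IsSetFun f :=
  isSetRel₂_of_defPred h

theorem isSetFun_symm {a b : V} {e : El a ≃ El b} (h : IsSetFun e) : IsSetFun e.symm :=
  isSetFun_of_defPred <| (DefPred.rel₂ h (f := fun p : El b × El a => p.2)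
    (g := fun p => p.1)).congr fun p => by rw [Equiv.symm_apply_eq, eq_comm]

end Sets

/-! ## Finiteness and compactness in a model -/

section Finite

theorem mem_sUnion_traceFamily {c t : V} {x : El c} :
    x ∈ ⋃₀ traceFamily c t ↔ ∃ u : V, u ∊ t ∧ x.1 ∊ u := by
  constructor
  · rintro ⟨_, ⟨u, hu, rfl⟩, hx⟩
    exact ⟨u, hu, hx⟩
  · rintro ⟨u, hu, hx⟩
    exact ⟨_, ⟨u, hu, rfl⟩, hx⟩

set_option synthInstance.maxSize 1000 in
set_option synthInstance.maxHeartbeats 200000 in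
-- Internal covers and subcovers are elements of the model, so compactness of the members of a
-- definable family is a first-order condition on the index.
theorem DefPred.mem_VCO {c top : V} {T : Type w} [DefType V T] {U : T → Set (El c)}
    (hU : DefPred fun p : T × El c => p.2 ∈ U p.1) : DefPred fun t => U t ∈ VCO c top := by
  -- A local instance, by which instance search recognises membership in `U t` below further
  -- quantifiers.
  have key : ∀ {T' : Type w} [DefType V T'] {f : T' → T} {g : T' → El c} [DefFun f] [DefFun g],
      DefPred fun t => g t ∈ U (f t) := fun {T'} _ {f} {g} hf hg =>
    hU.comp₂ (P := fun t x => x ∈ U t) hf hg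
  have : DefPred fun t => (∀ r : V, (∀ u : V, u ∊ r → u ∊ top) →
      (∀ x : El c, x ∈ U t → ∃ u : V, u ∊ r ∧ x.1 ∊ u) → ∃ s : V, (∀ u : V, u ∊ s → u ∊ r) ∧
        VFinite s ∧ (∀ x : El c, x ∈ U t → ∃ u : V, u ∊ s ∧ x.1 ∊ u)) ∧
      ∃ u : V, u ∊ top ∧ ∀ x : El c, x.1 ∊ u ↔ x ∈ U t := inferInstance
  refine this.congr fun t => ?_
  simp only [← mem_sUnion_traceFamily (c := c)]
  refine and_congr Iff.rfl ?_
  exact ⟨fun ⟨u, hu, h⟩ => ⟨u, hu, fun x => by rw [← h]; rfl⟩,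
    fun ⟨u, hu, h⟩ => ⟨u, hu, Set.ext h⟩⟩

variable [IsZFModel V]

theorem exists_vempty (c : V) : ∃ e : V, ∀ t : V, ¬ t ∊ e := by
  obtain ⟨e, he⟩ := exists_sep (inferInstance : DefPred fun x : V => ¬ x = x) c
  exact ⟨e, fun t ht => ((he t).1 ht).2 rfl⟩

theorem exists_vunion (u w : V) : ∃ z : V, ∀ t : V, t ∊ z ↔ t ∊ u ∨ t ∊ w := by
  obtain ⟨p, hp⟩ := IsZFModel.pairing u w
  obtain ⟨z, hz⟩ := IsZFModel.union p
  refine ⟨z, fun t => (hz t).trans ⟨?_, ?_⟩⟩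
  · rintro ⟨y, hy, hyp⟩
    rcases (hp y).1 hyp with rfl | rfl
    · exact .inl hy
    · exact .inr hy
  · rintro (h | h)
    · exact ⟨u, h, (hp u).2 (.inl rfl)⟩
    · exact ⟨w, h, (hp w).2 (.inr rfl)⟩

theorem exists_vsingleton (x : V) : ∃ z : V, ∀ t : V, t ∊ z ↔ t = x := by
  obtain ⟨z, hz⟩ := IsZFModel.pairing x x
  exact ⟨z, fun t => by rw [hz, or_self]⟩

theorem exists_vinsert (u x : V) : ∃ z : V, ∀ t : V, t ∊ z ↔ t ∊ u ∨ t = x := by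
  obtain ⟨s, hs⟩ := exists_vsingleton x
  obtain ⟨z, hz⟩ := exists_vunion u s
  exact ⟨z, fun t => by rw [hz, hs]⟩

/-- The set `K` of those subsets of `s` that satisfy `Q` exists by separation, and `VFinite` applied
to `K` puts `s` into it. Hence `Q` has to be definable. -/
theorem VFinite.induction {s : V} (hs : VFinite s) {Q : V → Prop} (hQ : DefPred Q)
    (h0 : ∀ e : V, (∀ t : V, ¬ t ∊ e) → Q e)
    (h1 : ∀ u x u' : V, (∀ t : V, t ∊ u → t ∊ s) → Q u → x ∊ s →
      (∀ t : V, t ∊ u' ↔ t ∊ u ∨ t = x) → Q u') : Q s := by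
  obtain ⟨P, hP⟩ := IsZFModel.powerset s
  obtain ⟨K, hK⟩ := exists_sep hQ P
  refine ((hK s).1 (hs K ?_ fun u x hu hx => ?_)).2
  · obtain ⟨e, he⟩ := exists_vempty s
    exact ⟨e, (hK e).2 ⟨(hP e).2 fun t ht => (he t ht).elim, h0 e he⟩, he⟩
  · obtain ⟨u', hu'⟩ := exists_vinsert u x
    obtain ⟨h2, h3⟩ := (hK u).1 hu
    refine ⟨u', (hK u').2 ⟨(hP u').2 fun t ht => ?_, h1 u x u' ((hP u).1 h2) h3 hx hu'⟩, hu'⟩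
    rcases (hu' t).1 ht with h | rfl
    · exact (hP u).1 h2 t h
    · exact hx

theorem vfinite_of_empty {e : V} (he : ∀ t : V, ¬ t ∊ e) : VFinite e := by
  rintro K ⟨e', he', h⟩ -
  rwa [IsZFModel.extensionality e e' fun z => iff_of_false (he z) (h z)]

theorem vfinite_of_singleton {s x : V} (hs : ∀ t : V, t ∊ s ↔ t = x) : VFinite s := by
  rintro K ⟨e, he, h⟩ hK
  obtain ⟨u, hu, h'⟩ := hK e x he ((hs x).2 rfl)
  rwa [IsZFModel.extensionality s u fun z => by rw [hs, h', or_iff_right (h z)]]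

theorem VFinite.union {r s z : V} (hr : VFinite r) (hs : VFinite s)
    (hz : ∀ t : V, t ∊ z ↔ t ∊ r ∨ t ∊ s) : VFinite z := by
  intro K hK hK'
  have h1 : r ∊ K := hr K hK fun u x hu hx => hK' u x hu ((hz x).2 (.inl hx))
  -- Adjoin the elements of `s` to `r` one at a time. The union `r ∪ u` is described by its
  -- elements, which keeps the predicate first-order.
  refine hs.induction (Q := fun u => ∀ w : V, (∀ t : V, t ∊ w ↔ t ∊ r ∨ t ∊ u) → w ∊ K)
    inferInstance (fun e he w hw => ?_) (fun u x u' _ hu hx hu' w hw => ?_) z hz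
  · rwa [IsZFModel.extensionality w r fun t => by rw [hw, or_iff_left (he t)]]
  · obtain ⟨y, hy⟩ := exists_vunion r u
    obtain ⟨y', hy', h⟩ := hK' y x (hu y hy) ((hz x).2 (.inr hx))
    rwa [IsZFModel.extensionality w y' fun t => by rw [hw, h, hy, hu', or_assoc]]

variable {c top : V}

theorem VIsOpen.union (h : VIsTopology c top) {U W : Set (El c)} (hU : VIsOpen c top U)
    (hW : VIsOpen c top W) : VIsOpen c top (U ∪ W) := by
  obtain ⟨u, hu, rfl⟩ := hU
  obtain ⟨w, hw, rfl⟩ := hW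
  obtain ⟨t, ht⟩ := IsZFModel.pairing u w
  convert h.sUnion t fun y hy => ?_ using 1
  · ext x
    rw [mem_sUnion_traceFamily]
    simp only [ht, or_and_right, exists_or, exists_eq_left]
    rfl
  · rcases (ht y).1 hy with rfl | rfl
    · exact hu
    · exact hw

theorem vIsCompact_empty : VIsCompact c top ∅ := by
  intro t _ _
  obtain ⟨e, he⟩ := exists_vempty c
  exact ⟨e, fun u hu => (he u hu).elim, vfinite_of_empty he, Set.empty_subset _⟩

theorem VIsCompact.union {U W : Set (El c)} (hU : VIsCompact c top U)
    (hW : VIsCompact c top W) : VIsCompact c top (U ∪ W) := by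
  intro t ht h
  obtain ⟨r, hr, hr', hrU⟩ := hU t ht (Set.subset_union_left.trans h)
  obtain ⟨s, hs, hs', hsW⟩ := hW t ht (Set.subset_union_right.trans h)
  obtain ⟨z, hz⟩ := exists_vunion r s
  refine ⟨z, fun u hu => ((hz u).1 hu).elim (hr u) (hs u), hr'.union hs' hz, ?_⟩
  rintro x (hx | hx)
  · obtain ⟨u, hu, hxu⟩ := mem_sUnion_traceFamily.1 (hrU hx)
    exact mem_sUnion_traceFamily.2 ⟨u, (hz u).2 (.inl hu), hxu⟩
  · obtain ⟨u, hu, hxu⟩ := mem_sUnion_traceFamily.1 (hsW hx)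
    exact mem_sUnion_traceFamily.2 ⟨u, (hz u).2 (.inr hu), hxu⟩

theorem vIsOpen_empty (h : VIsTopology c top) : VIsOpen c top ∅ := by
  obtain ⟨e, he⟩ := exists_vempty c
  convert h.sUnion e fun u hu => (he u hu).elim
  ext x
  rw [mem_sUnion_traceFamily]
  simp [he]

theorem empty_mem_VCO (h : VIsTopology c top) : ∅ ∈ VCO c top :=
  ⟨vIsCompact_empty, vIsOpen_empty h⟩

theorem VCO.union_mem (h : VIsTopology c top) {U W : Set (El c)} (hU : U ∈ VCO c top)
    (hW : W ∈ VCO c top) : U ∪ W ∈ VCO c top :=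
  ⟨hU.1.union hW.1, hU.2.union h hW.2⟩

/-- The preimage of a finite union of basic sets whose preimages are compact open is again
compact open. -/
theorem preimage_mem_VCO {c' top' : V} (h : VIsTopology c top) {f : El c → El c'}
    (hf : IsSetFun f) {B : Set (Set (El c'))} (hB : ∀ W ∈ B, VIsOpen c' top' W)
    (hb : ∀ U, VIsOpen c' top' U → ∀ x ∈ U, ∃ W ∈ B, x ∈ W ∧ W ⊆ U)
    (hfB : ∀ W ∈ B, f ⁻¹' W ∈ VCO c top) {U : Set (El c')} (hU : U ∈ VCO c' top') :
    f ⁻¹' U ∈ VCO c top := by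
  obtain ⟨hc, u, hu, rfl⟩ := hU
  have hd : DefPred fun s : V => f ⁻¹' trace c' s ∈ VCO c top := by
    refine DefPred.mem_VCO ?_
    have : DefFun fun p : V × El c => f p.2 := DefFun.app hf
    exact (inferInstance : DefPred fun p : V × El c => f p.2 ∈ trace c' p.1)
  -- The family `B` need not be a set of the model. The cover therefore consists of all open subsets
  -- of `u` with compact open preimage, a definable condition satisfied by the members of `B` inside
  -- `u`.
  obtain ⟨t, ht⟩ := exists_sep (inferInstance : DefPred fun s : V =>
    f ⁻¹' trace c' s ∈ VCO c top ∧ ∀ x : El c', x ∈ trace c' s → x ∈ trace c' u) top'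
  obtain ⟨s, hst, hs, hus⟩ := hc t (fun w hw => ((ht w).1 hw).1) fun x hx => by
    obtain ⟨W, hW, hxW, hWU⟩ := hb _ ⟨u, hu, rfl⟩ x hx
    obtain ⟨w, hw, rfl⟩ := hB W hW
    exact ⟨_, ⟨w, (ht w).2 ⟨hw, hfB _ hW, hWU⟩, rfl⟩, hxW⟩
  have hQ : DefPred fun s : V => f ⁻¹' (⋃₀ traceFamily c' s) ∈ VCO c top := by
    refine DefPred.mem_VCO ?_
    have : DefFun fun q : (V × El c) × V => f q.1.2 := DefFun.app hf
    exact (inferInstance : DefPred fun p : V × El c => ∃ w : V, w ∊ p.1 ∧ (f p.2).1 ∊ w).congr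
      fun p => mem_sUnion_traceFamily
  -- Induction over the finite subcover: compact open sets contain `∅` and are closed under binary
  -- unions.
  have key : f ⁻¹' (⋃₀ traceFamily c' s) ∈ VCO c top := by
    refine hs.induction hQ (fun e he => ?_) fun r x r' _ hr hx hr' => ?_
    · convert empty_mem_VCO h
      ext y
      rw [Set.mem_preimage, mem_sUnion_traceFamily]
      simp [he]
    · convert VCO.union_mem h hr ((ht x).1 (hst x hx)).2.1
      ext y
      simp only [Set.mem_preimage, Set.mem_union, mem_sUnion_traceFamily, hr', or_and_right,
        exists_or, exists_eq_left]
      rfl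
  convert key using 2
  refine Set.Subset.antisymm hus fun x hx => ?_
  obtain ⟨w, hw, hxw⟩ := mem_sUnion_traceFamily.1 hx
  exact ((ht w).1 (hst w hw)).2.2 x hxw

end Finite
end Definability

/-! ## The spectrum in a model -/

section ModelSpectrum

variable {V : Type w} [setLang.Structure V]

/-! ### Definability of the operations of an algebra in the model -/

section Operations

variable {T : Type*} [DefType V T] {I : V} {A : VCOL I} {f g : T → El A.carrier}
  {i k : T → El I}

instance DefFun.inf [DefFun f] [DefFun g] : DefFun fun t => f t ⊓ g t :=
  DefFun.app₂ A.isSet_inf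

instance DefFun.compl [DefFun f] : DefFun fun t => (f t)ᶜ := DefFun.app A.isSet_compl

instance DefFun.cylEx [DefFun i] [DefFun f] : DefFun fun t => ex (i t) (f t) :=
  DefFun.app₂ A.isSet_ex

instance DefFun.cylDiag [DefFun i] [DefFun k] :
    DefFun fun t => (diag (i t) (k t) : El A.carrier) :=
  DefFun.app₂ A.isSet_diag

instance DefPred.le [DefFun f] [DefFun g] : DefPred fun t => f t ≤ g t :=
  (inferInstance : DefPred fun t => f t ⊓ g t = f t).congr fun _ => inf_eq_left.symm

end Operations

variable {I : V} (A : VCOL I)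

theorem VCOL.defPred_isProperFilter :
    DefPred fun x : V => IsProperFilter (trace A.carrier x) := by
  have : DefPred fun x : V => (∃ a : El A.carrier, a ∈ trace A.carrier x) ∧
    (∀ a b : El A.carrier, a ∈ trace A.carrier x → a ≤ b → b ∈ trace A.carrier x) ∧
    (∀ a b : El A.carrier, a ∈ trace A.carrier x → b ∈ trace A.carrier x →
      a ⊓ b ∈ trace A.carrier x) ∧ ∃ a : El A.carrier, ¬ a ∈ trace A.carrier x := inferInstance
  refine this.congr fun x => ⟨fun h => ⟨h.1, h.2, h.3, (Set.ne_univ_iff_exists_notMem _).1 h.4⟩,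
    fun h => ⟨h.1, h.2.1, h.2.2.1, (Set.ne_univ_iff_exists_notMem _).2 h.2.2.2⟩⟩

variable [IsZFModel V]

/-- Being a proper filter is first-order in `x`, so the points are separated from the power set. By
extensionality the resulting set is unique. -/
theorem VCOL.exists_specCarrier : ∃ c : V, ∀ x : V, x ∊ c ↔
    (∀ a : V, a ∊ x → a ∊ A.carrier) ∧ IsProperFilter (trace A.carrier x) := by
  obtain ⟨p, hp⟩ := IsZFModel.powerset A.carrier
  obtain ⟨c, hc⟩ := exists_sep A.defPred_isProperFilter p
  exact ⟨c, fun x => by rw [hc, hp]⟩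

/-- The set of the proper filters of `A` in the model. -/
noncomputable def VCOL.specCarrier : V := A.exists_specCarrier.choose

theorem VCOL.mem_specCarrier (x : V) : x ∊ A.specCarrier ↔
    (∀ a : V, a ∊ x → a ∊ A.carrier) ∧ IsProperFilter (trace A.carrier x) :=
  A.exists_specCarrier.choose_spec x

variable {A}

/-- The proper filter that is the point `x` of the spectrum. -/
def specFilter (x : El A.specCarrier) : Set (El A.carrier) := trace A.carrier x.1

theorem isProperFilter_specFilter (x : El A.specCarrier) : IsProperFilter (specFilter x) :=
  ((A.mem_specCarrier x.1).1 x.2).2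

theorem specFilter_injective : Function.Injective (specFilter (A := A)) := fun x y h =>
  Subtype.ext (trace_injOn ((A.mem_specCarrier x.1).1 x.2).1 ((A.mem_specCarrier y.1).1 y.2).1 h)

instance DefPred.mem_specFilter {T : Type*} [DefType V T] {f : T → El A.carrier}
    {g : T → El A.specCarrier} [DefFun f] [DefFun g] :
    DefPred fun t => f t ∈ specFilter (g t) :=
  (inferInstance : DefPred fun t => (f t).1 ∊ (g t).1)

/-- The only source of points in the model: a proper filter has to be definable in order to be a
point. -/
theorem exists_specFilter_eq {F : Set (El A.carrier)} (hF : IsProperFilter F)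
    (hd : DefPred fun a => a ∈ F) : ∃ x : El A.specCarrier, specFilter x = F := by
  obtain ⟨x, hx, hxF⟩ := exists_trace_eq hd
  exact ⟨⟨x, (A.mem_specCarrier x).2 ⟨hx, hxF.symm ▸ hF⟩⟩, hxF⟩

theorem exists_specFilter_eq_Ici {a : El A.carrier} (ha : a ≠ ⊥) :
    ∃ x : El A.specCarrier, specFilter x = Set.Ici a :=
  exists_specFilter_eq (isProperFilter_Ici ha)
    (DefPred.le (f := fun _ : El A.carrier => a) (g := fun b => b))

/-- The set of the points of the spectrum that contain `a`. -/
def vphi (a : El A.carrier) : Set (El A.specCarrier) := {x | a ∈ specFilter x}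

instance DefPred.mem_vphi {T : Type*} [DefType V T] {f : T → El A.carrier}
    {g : T → El A.specCarrier} [DefFun f] [DefFun g] : DefPred fun t => g t ∈ vphi (f t) :=
  (inferInstance : DefPred fun t => f t ∈ specFilter (g t))

theorem vphi_bot : vphi (⊥ : El A.carrier) = ∅ :=
  Set.eq_empty_of_forall_notMem fun x hx => (isProperFilter_specFilter x).bot_notMem hx

theorem vphi_top : vphi (⊤ : El A.carrier) = Set.univ :=
  Set.eq_univ_of_forall fun x => (isProperFilter_specFilter x).top_mem

theorem vphi_inf (a b : El A.carrier) : vphi (a ⊓ b) = vphi a ∩ vphi b :=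
  Set.ext fun x => ⟨fun h => ⟨(isProperFilter_specFilter x).upward _ _ h inf_le_left,
    (isProperFilter_specFilter x).upward _ _ h inf_le_right⟩,
    fun h => (isProperFilter_specFilter x).inf_mem _ _ h.1 h.2⟩

/-- For `a ≠ ⊥` the least point of `vphi a`, the principal filter, decides the inclusion. -/
theorem vphi_subset {a b : El A.carrier} : vphi a ⊆ vphi b ↔ a ≤ b := by
  refine ⟨fun h => ?_, fun h x hx => (isProperFilter_specFilter x).upward _ _ hx h⟩
  by_cases ha : a = ⊥
  · rw [ha]; exact bot_le
  · obtain ⟨x, hx⟩ := exists_specFilter_eq_Ici ha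
    have h1 : x ∈ vphi b := h (hx.ge (le_refl a))
    exact hx.le h1

theorem vphi_injective : Function.Injective (vphi (A := A)) := fun _ _ h =>
  le_antisymm (vphi_subset.1 h.le) (vphi_subset.1 h.ge)

/-- Orthogonality in the spectrum. -/
def vperp (x y : El A.specCarrier) : Prop := ∃ a ∈ specFilter x, aᶜ ∈ specFilter y

/-- The accessibility relations of the spectrum. -/
def vrel (i : El I) (x y : El A.specCarrier) : Prop :=
  ∀ a ∈ specFilter x, ex i a ∈ specFilter y

instance DefPred.vperp {T : Type*} [DefType V T] {f g : T → El A.specCarrier} [hf : DefFun f]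
    [hg : DefFun g] : DefPred fun t => vperp (f t) (g t) :=
  (inferInstance : DefPred fun p : El A.specCarrier × El A.specCarrier =>
    ∃ a : El A.carrier, a ∈ specFilter p.1 ∧ aᶜ ∈ specFilter p.2).comp₂ (P := _root_.vperp) hf hg

theorem isOrthoframe_vperp : IsOrthoframe (vperp (A := A)) where
  irrefl := by
    rintro x ⟨a, ha, ha'⟩
    have hx := isProperFilter_specFilter x
    exact hx.bot_notMem (Ortholattice.inf_compl a ▸ hx.inf_mem _ _ ha ha')
  symm := by
    rintro x y ⟨a, ha, ha'⟩
    exact ⟨aᶜ, ha', by rwa [Ortholattice.compl_compl]⟩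

theorem orth_vphi (a : El A.carrier) : orth vperp (vphi a) = vphi aᶜ := by
  ext x
  constructor
  · intro h
    by_cases ha : a = ⊥
    · rw [ha, Ortholattice.compl_bot, vphi_top]; trivial
    · obtain ⟨y, hy⟩ := exists_specFilter_eq_Ici ha
      obtain ⟨b, hb, hb'⟩ := h y (hy.ge (le_refl a))
      refine (isProperFilter_specFilter x).upward b _ hb ?_
      rw [hy] at hb'
      simpa [Ortholattice.compl_compl] using Ortholattice.compl_anti _ _ (Set.mem_Ici.1 hb')
  · intro h y hy
    exact ⟨aᶜ, h, by rw [Ortholattice.compl_compl]; exact hy⟩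

theorem isBiorth_vphi (a : El A.carrier) : IsBiorth vperp (vphi a) := by
  rw [IsBiorth, orth_vphi, orth_vphi, Ortholattice.compl_compl]

theorem orth_orth_union_vphi (a b : El A.carrier) :
    orth vperp (orth vperp (vphi a ∪ vphi b)) = vphi (a ⊔ b) := by
  rw [orth_union, orth_vphi, orth_vphi, ← vphi_inf, ← Ortholattice.compl_sup, orth_vphi,
    Ortholattice.compl_compl]

theorem relImage_vphi (i : El I) (a : El A.carrier) :
    relImage (vrel i) (vphi a) = vphi (ex i a) := by
  have hq : IsQuantifier (ex (A := El A.carrier) i) := CylindricOrtholattice.quantifier i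
  ext y
  constructor
  · rintro ⟨x, hx, hxy⟩
    exact hxy a hx
  · intro hy
    have ha : a ≠ ⊥ := by
      rintro rfl
      rw [hq.map_bot, vphi_bot] at hy
      exact hy
    -- The principal filter of `a` precedes `y`, since `∃_i` is monotone and `∃_i a ∈ y`.
    obtain ⟨x, hx⟩ := exists_specFilter_eq_Ici ha
    refine ⟨x, hx.ge (le_refl a), fun b hb => ?_⟩
    rw [hx] at hb
    exact (isProperFilter_specFilter y).upward _ _ hy (hq.mono hb)

/-- The filter generated by `∃_i[x]` is a point of the spectrum in the model. -/
theorem exists_vrel_generated (i : El I) (x : El A.specCarrier) :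
    ∃ y : El A.specCarrier, vrel i x y ∧
      ∀ b ∈ specFilter y, ∃ a ∈ specFilter x, ex i a ≤ b := by
  have hx := isProperFilter_specFilter x
  have hF := (exFilter i (⟨specFilter x, hx⟩ : ProperFilter (El A.carrier))).2
  obtain ⟨y, hy⟩ := exists_specFilter_eq hF (inferInstance : DefPred fun b : El A.carrier =>
    ∃ a : El A.carrier, a ∈ specFilter x ∧ ex i a ≤ b)
  exact ⟨y, fun a ha => hy.ge ⟨a, ha, le_rfl⟩, fun b hb => hy.le hb⟩

/-- The filter generated by `∃_k[x]` is the least `k`-successor of `x`, hence the best candidate for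
the intermediate point; it works because `∃_i` and `∃_k` commute. -/
theorem vrel_comm {i k : El I} {x z : El A.specCarrier} (h : ∃ y, vrel i x y ∧ vrel k y z) :
    ∃ y, vrel k x y ∧ vrel i y z := by
  obtain ⟨y, hxy, hyz⟩ := h
  obtain ⟨t, hxt, ht⟩ := exists_vrel_generated k x
  refine ⟨t, hxt, fun b hb => ?_⟩
  obtain ⟨a, ha, hab⟩ := ht b hb
  have h1 : ex k (ex i a) ∈ specFilter z := hyz _ (hxy a ha)
  rw [← CylindricOrtholattice.ex_comm] at h1
  exact (isProperFilter_specFilter z).upward _ _ h1 ((CylindricOrtholattice.quantifier i).mono hab)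

theorem isMonadicOrthoframe_vrel (i : El I) :
    IsMonadicOrthoframe (vperp (A := A)) (vrel i) where
  toIsOrthoframe := isOrthoframe_vperp
  refl x a ha :=
    (isProperFilter_specFilter x).upward _ _ ha ((CylindricOrtholattice.quantifier i).le a)
  trans x y z hxy hyz a ha := by
    have := hyz _ (hxy a ha)
    simpa only [(CylindricOrtholattice.quantifier i).idem] using this
  image_orth x := by
    have hq : IsQuantifier (ex (A := El A.carrier) i) := CylindricOrtholattice.quantifier i
    rintro y ⟨t, ht, hty⟩ z ⟨x', hx', hxz⟩
    obtain rfl : x' = x := hx'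
    -- Orthogonality of `t` to the least `i`-successor `g` of `x'` puts some `(∃_i a)ᶜ` with `a ∈
    -- x'` into `t`. The last quantifier axiom carries it on to `y`, while `∃_i a ∈ z`.
    obtain ⟨g, hxg, hg⟩ := exists_vrel_generated i x'
    obtain ⟨b, hb, hb'⟩ := ht g ⟨x', rfl, hxg⟩
    obtain ⟨a, ha, hab⟩ := hg _ hb'
    have h1 : b ≤ (ex i a)ᶜ := by
      simpa [Ortholattice.compl_compl] using Ortholattice.compl_anti _ _ hab
    have h2 := hty _ ((isProperFilter_specFilter t).upward _ _ hb h1)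
    rw [hq.compl] at h2
    exact ⟨_, h2, by rw [Ortholattice.compl_compl]; exact hxz a ha⟩

variable (A)

/-- The generated topology is described pointwise, by basic neighbourhoods; this is first-order, as
the sets `vphi a` are closed under intersection and form a basis. -/
theorem VCOL.exists_specTop : ∃ t : V, ∀ u : V, u ∊ t ↔ (∀ x : V, x ∊ u → x ∊ A.specCarrier) ∧
    ∀ x ∈ trace A.specCarrier u, ∃ a ∈ specFilter x, vphi a ⊆ trace A.specCarrier u := by
  obtain ⟨p, hp⟩ := IsZFModel.powerset A.specCarrier
  obtain ⟨t, ht⟩ := exists_sep (inferInstance : DefPred fun u : V => ∀ x : El A.specCarrier,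
    x ∈ trace A.specCarrier u → ∃ a : El A.carrier, a ∈ specFilter x ∧
      ∀ y : El A.specCarrier, y ∈ vphi a → y ∈ trace A.specCarrier u) p
  exact ⟨t, fun u => by rw [ht, hp]; rfl⟩

/-- The topology of the spectrum in the model. -/
noncomputable def VCOL.specTop : V := A.exists_specTop.choose

theorem VCOL.mem_specTop (u : V) : u ∊ A.specTop ↔ (∀ x : V, x ∊ u → x ∊ A.specCarrier) ∧
    ∀ x ∈ trace A.specCarrier u, ∃ a ∈ specFilter x, vphi a ⊆ trace A.specCarrier u :=
  A.exists_specTop.choose_spec u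

variable {A}

theorem vIsOpen_spec {U : Set (El A.specCarrier)} (hd : DefPred fun x => x ∈ U)
    (h : ∀ x ∈ U, ∃ a ∈ specFilter x, vphi a ⊆ U) : VIsOpen A.specCarrier A.specTop U := by
  obtain ⟨u, hu, hU⟩ := exists_trace_eq hd
  change trace _ u = U at hU
  exact ⟨u, (A.mem_specTop u).2 ⟨hu, hU ▸ h⟩, hU⟩

theorem exists_vphi_subset {U : Set (El A.specCarrier)} (hU : VIsOpen A.specCarrier A.specTop U)
    {x : El A.specCarrier} (hx : x ∈ U) : ∃ a ∈ specFilter x, vphi a ⊆ U := by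
  obtain ⟨u, hu, rfl⟩ := hU
  exact ((A.mem_specTop u).1 hu).2 x hx

theorem vIsOpen_vphi (a : El A.carrier) : VIsOpen A.specCarrier A.specTop (vphi a) :=
  vIsOpen_spec (inferInstance : DefPred fun x : El A.specCarrier => a ∈ specFilter x)
    fun _ hx => ⟨a, hx, subset_rfl⟩

theorem vIsTopology_spec : VIsTopology A.specCarrier A.specTop where
  subset u hu := ((A.mem_specTop u).1 hu).1
  univ := by
    rw [← vphi_top]
    exact vIsOpen_vphi _
  inter U W hU hW := by
    refine vIsOpen_spec ?_ fun x hx => ?_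
    · obtain ⟨u, -, rfl⟩ := hU
      obtain ⟨w, -, rfl⟩ := hW
      exact (inferInstance : DefPred fun x : El A.specCarrier => x.1 ∊ u ∧ x.1 ∊ w)
    · obtain ⟨a, ha, haU⟩ := exists_vphi_subset hU hx.1
      obtain ⟨b, hb, hbW⟩ := exists_vphi_subset hW hx.2
      refine ⟨a ⊓ b, (isProperFilter_specFilter x).inf_mem _ _ ha hb, ?_⟩
      rw [vphi_inf]
      exact Set.inter_subset_inter haU hbW
  sUnion t ht := by
    refine vIsOpen_spec ?_ fun x hx => ?_
    · exact (inferInstance : DefPred fun x : El A.specCarrier => ∃ u : V, u ∊ t ∧ x.1 ∊ u).congr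
        fun x => mem_sUnion_traceFamily
    · obtain ⟨u, hu, hx⟩ := mem_sUnion_traceFamily.1 hx
      obtain ⟨a, ha, h⟩ := exists_vphi_subset (U := trace _ u) ⟨u, ht u hu, rfl⟩ hx
      exact ⟨a, ha, h.trans fun y hy => mem_sUnion_traceFamily.2 ⟨u, hu, hy⟩⟩

theorem vphi_mem_VCO (a : El A.carrier) : vphi a ∈ VCO A.specCarrier A.specTop := by
  refine ⟨?_, vIsOpen_vphi a⟩
  by_cases ha : a = ⊥
  · rw [ha, vphi_bot]; exact vIsCompact_empty
  · intro t ht hc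
    obtain ⟨x, hx⟩ := exists_specFilter_eq_Ici ha
    obtain ⟨u, hu, hxu⟩ := mem_sUnion_traceFamily.1 (hc (show x ∈ vphi a from hx.ge (le_refl a)))
    obtain ⟨b, hb, hbu⟩ := exists_vphi_subset (U := trace _ u) ⟨u, ht u hu, rfl⟩ hxu
    rw [hx] at hb
    -- The member `u` of the cover that contains the least point of `vphi a` already covers `vphi
    -- a`.
    obtain ⟨s, hs⟩ := exists_vsingleton u
    refine ⟨s, fun w hw => (hs w).1 hw ▸ hu, vfinite_of_singleton hs, fun y hy => ?_⟩
    exact mem_sUnion_traceFamily.2 ⟨u, (hs u).2 rfl, hbu (vphi_subset.2 hb hy)⟩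

theorem vphi_mem_VCOB (a : El A.carrier) : vphi a ∈ VCOB A.specCarrier A.specTop vperp :=
  ⟨vphi_mem_VCO a, isBiorth_vphi a⟩

/-- Orthogonals turn unions into intersections, and the `vphi` are closed under meets and
complements. The element `a` stays under an existential quantifier in the induction, so no
representatives are selected. -/
theorem exists_orth_sUnion_vphi {s : V} (hs : VFinite s)
    (h : ∀ u : V, u ∊ s → ∃ a : El A.carrier, trace A.specCarrier u = vphi a) :
    ∃ a : El A.carrier, orth vperp (⋃₀ traceFamily A.specCarrier s) = vphi aᶜ := by
  refine hs.induction (Q := fun s => ∃ a : El A.carrier,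
    orth vperp (⋃₀ traceFamily A.specCarrier s) = vphi aᶜ) ?_ (fun e he => ⟨⊥, ?_⟩)
    fun r x r' _ hr hx hr' => ?_
  · refine (inferInstance : DefPred fun s : V => ∃ a : El A.carrier, ∀ x : El A.specCarrier,
      (∀ y : El A.specCarrier, (∃ u : V, u ∊ s ∧ y.1 ∊ u) → vperp x y) ↔ x ∈ vphi aᶜ).congr
      fun s => exists_congr fun a => ?_
    rw [Set.ext_iff]
    refine forall_congr' fun x => iff_congr (forall_congr' fun y => ?_) Iff.rfl
    rw [mem_sUnion_traceFamily]
  · rw [Ortholattice.compl_bot, vphi_top]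
    refine Set.eq_univ_of_forall fun x y hy => ?_
    obtain ⟨u, hu, -⟩ := mem_sUnion_traceFamily.1 hy
    exact (he u hu).elim
  · obtain ⟨a, ha⟩ := hr
    obtain ⟨b, hb⟩ := h x hx
    refine ⟨a ⊔ b, ?_⟩
    have : ⋃₀ traceFamily A.specCarrier r' = ⋃₀ traceFamily A.specCarrier r ∪ vphi b := by
      rw [← hb]
      ext y
      simp only [Set.mem_union, mem_sUnion_traceFamily, hr', or_and_right, exists_or,
        exists_eq_left]
      rfl
    rw [this, orth_union, ha, orth_vphi, Ortholattice.compl_sup, vphi_inf]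

/-- By compactness such a set is an internally finite union of sets `vphi a`; its orthogonal set is
a single `vphi aᶜ`, and biorthogonal closedness then makes it equal to `vphi a`. -/
theorem VCOB_spec : VCOB A.specCarrier A.specTop vperp = Set.range vphi := by
  refine Set.Subset.antisymm ?_ (Set.range_subset_iff.2 vphi_mem_VCOB)
  rintro _ ⟨⟨hc, u, hu, rfl⟩, hb⟩
  obtain ⟨t, ht⟩ := exists_sep (inferInstance : DefPred fun s : V =>
    (∃ a : El A.carrier, ∀ x : El A.specCarrier, x ∈ trace A.specCarrier s ↔ x ∈ vphi a) ∧
      ∀ x : El A.specCarrier, x ∈ trace A.specCarrier s → x ∈ trace A.specCarrier u) A.specTop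
  obtain ⟨s, hst, hs, hus⟩ := hc t (fun w hw => ((ht w).1 hw).1) fun x hx => by
    obtain ⟨a, ha, hau⟩ := exists_vphi_subset (U := trace _ u) ⟨u, hu, rfl⟩ hx
    obtain ⟨w, hw, hwa⟩ := vIsOpen_vphi a
    exact ⟨_, ⟨w, (ht w).2 ⟨hw, ⟨a, fun x => by rw [hwa]⟩, hwa.le.trans hau⟩, rfl⟩, hwa.ge ha⟩
  obtain ⟨a, ha⟩ := exists_orth_sUnion_vphi hs fun w hw =>
    ((ht w).1 (hst w hw)).2.1.imp fun a h => Set.ext h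
  have : trace A.specCarrier u = ⋃₀ traceFamily A.specCarrier s := by
    refine Set.Subset.antisymm hus fun x hx => ?_
    obtain ⟨w, hw, hxw⟩ := mem_sUnion_traceFamily.1 hx
    exact ((ht w).1 (hst w hw)).2.2 x hxw
  refine ⟨a, ?_⟩
  rw [IsBiorth, this, ha, orth_vphi, Ortholattice.compl_compl] at hb
  rw [hb, this]

theorem vIsUVOSpace_spec : VIsUVOSpace A.specCarrier A.specTop vperp where
  toIsOrthoframe := isOrthoframe_vperp
  isTopology := vIsTopology_spec
  t0 x y hxy := by
    by_contra! h
    exact hxy (specFilter_injective (Set.ext fun a => h (vphi a) (vIsOpen_vphi a)))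
  basis U hU x hx := by
    obtain ⟨a, ha, haU⟩ := exists_vphi_subset hU hx
    exact ⟨vphi a, vphi_mem_VCOB a, ha, haU⟩
  inter_mem := by
    rw [VCOB_spec]
    rintro _ _ ⟨a, rfl⟩ ⟨b, rfl⟩
    exact ⟨a ⊓ b, vphi_inf a b⟩
  orth_mem := by
    rw [VCOB_spec]
    rintro _ ⟨a, rfl⟩
    exact ⟨aᶜ, (orth_vphi a).symm⟩
  filter := by
    rw [VCOB_spec]
    intro F hF
    -- The `vphi`-preimage of the given filter of sets. It is definable with `F` as parameter and so
    -- is a point.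
    have hF' : IsProperFilter {a : El A.carrier | vphi a ∈ traceFamily A.specCarrier F} := by
      refine ⟨?_, ?_, ?_, ?_⟩
      · obtain ⟨U, hU⟩ := hF.nonempty
        obtain ⟨a, rfl⟩ := hF.subset hU
        exact ⟨a, hU⟩
      · exact fun a b ha hab => hF.upward _ _ ha ⟨b, rfl⟩ (vphi_subset.2 hab)
      · intro a b ha hb
        have := hF.inter_mem _ _ ha hb
        rwa [← vphi_inf] at this
      · intro h
        refine hF.proper (Set.Subset.antisymm hF.subset ?_)
        rintro _ ⟨a, rfl⟩
        exact h.ge (Set.mem_univ a)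
    obtain ⟨x, hx⟩ := exists_specFilter_eq hF' <|
      (inferInstance : DefPred fun a : El A.carrier => ∃ u : V, u ∊ F ∧ ∀ x : El A.specCarrier,
        x ∈ trace A.specCarrier u ↔ x ∈ vphi a).congr fun a =>
          exists_congr fun u => and_congr_right fun _ => Set.ext_iff
    refine ⟨x, Set.ext fun U => ⟨fun hU => ?_, ?_⟩⟩
    · obtain ⟨a, rfl⟩ := hF.subset hU
      exact ⟨⟨a, rfl⟩, hx.ge hU⟩
    · rintro ⟨⟨a, rfl⟩, hU⟩
      exact hx.le hU
  perp_sep := by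
    rintro x y ⟨a, ha, ha'⟩
    exact ⟨vphi a, vphi_mem_VCOB a, ha, by rw [orth_vphi]; exact ha'⟩

theorem vIsCylindricUVOSpace_spec : VIsCylindricUVOSpace A.specCarrier A.specTop vperp vrel
    fun i k : El I => vphi (diag i k) where
  toVIsUVOSpace := vIsUVOSpace_spec
  monadic := isMonadicOrthoframe_vrel
  comm i k x z := ⟨vrel_comm, vrel_comm⟩
  diag_symm i k := congrArg vphi (CylindricOrtholattice.diag_symm i k)
  diag_biorth i k := isBiorth_vphi _
  diag_self i := by rw [CylindricOrtholattice.diag_self, vphi_top]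
  image_diag i k l h h' := by
    rw [← vphi_inf, relImage_vphi, CylindricOrtholattice.ex_diag i k l h h']
  monadicUVO i :=
    { toVIsUVOSpace := vIsUVOSpace_spec
      refl := (isMonadicOrthoframe_vrel i).refl
      trans := (isMonadicOrthoframe_vrel i).trans
      image_orth := (isMonadicOrthoframe_vrel i).image_orth
      image_mem := by
        rw [VCOB_spec]
        rintro _ ⟨a, rfl⟩
        exact ⟨ex i a, (relImage_vphi i a).symm⟩
      rel_sep := by
        intro x y h
        unfold vrel at h
        push Not at h
        obtain ⟨a, ha, hy⟩ := h
        refine ⟨vphi (ex i a), vphi_mem_VCOB _, ⟨vphi a, vphi_mem_VCOB _, ha, ?_⟩, hy⟩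
        rw [relImage_vphi, isBiorth_vphi] }
  diag_mem i k := vphi_mem_VCO _

/-- The spectrum of `A` in the model. -/
noncomputable abbrev VCOL.spec (A : VCOL I) : VCUVO I where
  carrier := A.specCarrier
  top := A.specTop
  perp := vperp
  R := vrel
  Δ i k := vphi (diag i k)
  isSet_perp := isSetRel₂_of_defPred inferInstance
  isSet_R := isSetRel₃_of_defPred (inferInstance : DefPred fun p : El I × El A.specCarrier ×
    El A.specCarrier => ∀ a : El A.carrier, a ∈ specFilter p.2.1 → ex p.1 a ∈ specFilter p.2.2)
  isSet_Δ := isSetRel₃_of_defPred (inferInstance : DefPred fun p : El I × El I ×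
    El A.specCarrier => diag p.1 p.2.1 ∈ specFilter p.2.2)
  isCylindric := vIsCylindricUVOSpace_spec

theorem VCOL.vIsSpectrum_spec (A : VCOL I) : VIsSpectrum A A.spec where
  carrier := A.mem_specCarrier
  perp _ _ := Iff.rfl
  R _ _ _ := Iff.rfl
  Δ _ _ := rfl
  top := A.mem_specTop

end ModelSpectrum

/-! ## The algebra of compact open biorthogonally closed sets in a model -/

section ModelAlgebra

variable {V : Type w} [setLang.Structure V] {I : V}

/-! ### Definability of the relations of a space in the model -/

section Relations

variable {T : Type*} [DefType V T] {X : VCUVO I} {f g : T → El X.carrier} {i k : T → El I}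

instance DefPred.perp [DefFun f] [DefFun g] : DefPred fun t => X.perp (f t) (g t) :=
  DefPred.rel₂ X.isSet_perp

instance DefPred.cylRel [DefFun i] [DefFun f] [DefFun g] :
    DefPred fun t => X.R (i t) (f t) (g t) :=
  DefPred.rel₃ X.isSet_R

instance DefPred.mem_cylDiag [DefFun i] [DefFun k] [DefFun f] :
    DefPred fun t => f t ∈ X.Δ (i t) (k t) :=
  DefPred.rel₃ X.isSet_Δ

end Relations

variable (X : VCUVO I)

/-- `COB(X)` in the sense of the model. -/
abbrev VCUVO.cob : Set (Set (El X.carrier)) := VCOB X.carrier X.top X.perp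

theorem VCUVO.defPred_trace_mem_cob : DefPred fun u : V => trace X.carrier u ∈ X.cob := by
  have h1 : DefPred fun u : V => trace X.carrier u ∈ VCO X.carrier X.top :=
    DefPred.mem_VCO inferInstance
  exact (inferInstance : DefPred fun u : V => trace X.carrier u ∈ VCO X.carrier X.top ∧
    ∀ x : El X.carrier, (∀ y : El X.carrier,
      (∀ z : El X.carrier, z ∈ trace X.carrier u → X.perp y z) → X.perp x y) ↔
        x ∈ trace X.carrier u).congr fun u => and_congr_right fun _ => Set.ext_iff

variable {X}

theorem VCUVO.sup_mem {U W : Set (El X.carrier)} (hU : U ∈ X.cob) (hW : W ∈ X.cob) :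
    orth X.perp (orth X.perp (U ∪ W)) ∈ X.cob := by
  rw [orth_union]
  exact X.isCylindric.orth_mem _ (X.isCylindric.inter_mem _ _ (X.isCylindric.orth_mem _ hU)
    (X.isCylindric.orth_mem _ hW))

theorem VCUVO.image_mem (i : El I) {U : Set (El X.carrier)} (hU : U ∈ X.cob) :
    orth X.perp (orth X.perp (relImage (X.R i) U)) ∈ X.cob :=
  X.isCylindric.orth_mem _ (X.isCylindric.orth_mem _
    ((X.isCylindric.monadicUVO i).image_mem U hU))

theorem VCUVO.biorth_image (i : El I) {U : Set (El X.carrier)} (hU : U ∈ X.cob) :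
    orth X.perp (orth X.perp (relImage (X.R i) U)) = relImage (X.R i) U :=
  ((X.isCylindric.monadicUVO i).image_mem U hU).2

theorem VCUVO.diag_mem (i k : El I) : X.Δ i k ∈ X.cob :=
  ⟨X.isCylindric.diag_mem i k, X.isCylindric.diag_biorth i k⟩

variable (X) [IsZFModel V]

theorem VCUVO.exists_cobCarrier : ∃ c : V, ∀ u : V, u ∊ c ↔
    (∀ x : V, x ∊ u → x ∊ X.carrier) ∧ trace X.carrier u ∈ X.cob := by
  obtain ⟨p, hp⟩ := IsZFModel.powerset X.carrier
  obtain ⟨c, hc⟩ := exists_sep X.defPred_trace_mem_cob p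
  exact ⟨c, fun u => by rw [hc, hp]⟩

/-- `COB(X)` as a set of the model. -/
noncomputable def VCUVO.cobCarrier : V := X.exists_cobCarrier.choose

theorem VCUVO.mem_cobCarrier (u : V) : u ∊ X.cobCarrier ↔
    (∀ x : V, x ∊ u → x ∊ X.carrier) ∧ trace X.carrier u ∈ X.cob :=
  X.exists_cobCarrier.choose_spec u

variable {X}

/-- The set of points of an element of `COB(X)`. -/
def cobSet (a : El X.cobCarrier) : Set (El X.carrier) := trace X.carrier a.1

theorem cobSet_mem (a : El X.cobCarrier) : cobSet a ∈ X.cob := ((X.mem_cobCarrier a.1).1 a.2).2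

theorem cobSet_injective : Function.Injective (cobSet (X := X)) := fun a b h =>
  Subtype.ext (trace_injOn ((X.mem_cobCarrier a.1).1 a.2).1 ((X.mem_cobCarrier b.1).1 b.2).1 h)

/-- Being open in the model already means being the trace of an element of the topology, and that
element is a subset of the carrier. -/
theorem exists_cobSet_eq {U : Set (El X.carrier)} (hU : U ∈ X.cob) :
    ∃ a : El X.cobCarrier, cobSet a = U := by
  have hU' := hU
  obtain ⟨⟨-, u, hu, rfl⟩, -⟩ := hU'
  exact ⟨⟨u, (X.mem_cobCarrier u).2 ⟨X.isCylindric.isTopology.subset u hu, hU⟩⟩, rfl⟩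

/-- The element of `COB(X)` with a given set of points. -/
noncomputable def cobMk (U : Set (El X.carrier)) (hU : U ∈ X.cob) : El X.cobCarrier :=
  (exists_cobSet_eq hU).choose

@[simp] theorem cobSet_cobMk (U : Set (El X.carrier)) (hU : U ∈ X.cob) : cobSet (cobMk U hU) = U :=
  (exists_cobSet_eq hU).choose_spec

instance DefPred.mem_cobSet {T : Type*} [DefType V T] {f : T → El X.carrier}
    {g : T → El X.cobCarrier} [DefFun f] [DefFun g] : DefPred fun t => f t ∈ cobSet (g t) :=
  (inferInstance : DefPred fun t => (f t).1 ∊ (g t).1)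

variable (X)

theorem VCUVO.empty_mem : ∅ ∈ X.cob := by
  have hp := X.isCylindric.toIsOrthoframe
  rcases isEmpty_or_nonempty (El X.carrier) with h | ⟨⟨x⟩⟩
  · exact ⟨empty_mem_VCO X.isCylindric.isTopology, Subsingleton.elim _ _⟩
  · obtain ⟨U, hU, -⟩ :=
      X.isCylindric.basis _ X.isCylindric.isTopology.univ x (Set.mem_univ x)
    rw [← inter_orth hp U]
    exact X.isCylindric.inter_mem _ _ hU (X.isCylindric.orth_mem _ hU)

theorem VCUVO.univ_mem : Set.univ ∈ X.cob := by
  rw [← orth_empty X.perp]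
  exact X.isCylindric.orth_mem _ X.empty_mem

/-- `cobMk` is known only through `cobSet_cobMk`, so every equation is checked on point sets by
`cobSet_injective`. -/
noncomputable instance VCUVO.instOrtholattice : Ortholattice (El X.cobCarrier) where
  le a b := cobSet a ⊆ cobSet b
  le_refl _ := subset_rfl
  le_trans _ _ _ h h' := h.trans h'
  le_antisymm _ _ h h' := cobSet_injective (h.antisymm h')
  inf a b := cobMk (cobSet a ∩ cobSet b)
    (X.isCylindric.inter_mem _ _ (cobSet_mem a) (cobSet_mem b))
  inf_le_left _ _ := (cobSet_cobMk _ _).le.trans Set.inter_subset_left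
  inf_le_right _ _ := (cobSet_cobMk _ _).le.trans Set.inter_subset_right
  le_inf _ _ _ h h' := (Set.subset_inter h h').trans (cobSet_cobMk _ _).ge
  sup a b := cobMk (orth X.perp (orth X.perp (cobSet a ∪ cobSet b)))
    (VCUVO.sup_mem (cobSet_mem a) (cobSet_mem b))
  le_sup_left _ _ := (Set.subset_union_left.trans
    (subset_orth_orth X.isCylindric.toIsOrthoframe _)).trans (cobSet_cobMk _ _).ge
  le_sup_right _ _ := (Set.subset_union_right.trans
    (subset_orth_orth X.isCylindric.toIsOrthoframe _)).trans (cobSet_cobMk _ _).ge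
  sup_le _ _ c h h' := (cobSet_cobMk _ _).le.trans
    ((orth_anti (orth_anti (Set.union_subset h h'))).trans (cobSet_mem c).2.le)
  top := cobMk Set.univ X.univ_mem
  le_top _ := (Set.subset_univ _).trans (cobSet_cobMk _ _).ge
  bot := cobMk ∅ X.empty_mem
  bot_le _ := (cobSet_cobMk _ _).le.trans (Set.empty_subset _)
  compl a := cobMk (orth X.perp (cobSet a)) (X.isCylindric.orth_mem _ (cobSet_mem a))
  inf_compl a := cobSet_injective <| by
    refine (cobSet_cobMk _ _).trans (Eq.trans ?_ (cobSet_cobMk _ _).symm)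
    rw [cobSet_cobMk, inter_orth X.isCylindric.toIsOrthoframe]
  sup_compl a := cobSet_injective <| by
    refine (cobSet_cobMk _ _).trans (Eq.trans ?_ (cobSet_cobMk _ _).symm)
    rw [cobSet_cobMk, orth_union, inter_orth X.isCylindric.toIsOrthoframe, orth_empty]
  compl_anti _ _ h :=
    ((cobSet_cobMk _ _).le.trans (orth_anti h)).trans (cobSet_cobMk _ _).ge
  compl_compl a := cobSet_injective <| by
    refine (cobSet_cobMk _ _).trans ?_
    rw [cobSet_cobMk, (cobSet_mem a).2]

variable {X}

theorem cobSet_inf (a b : El X.cobCarrier) : cobSet (a ⊓ b) = cobSet a ∩ cobSet b :=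
  cobSet_cobMk _ _

theorem cobSet_sup (a b : El X.cobCarrier) :
    cobSet (a ⊔ b) = orth X.perp (orth X.perp (cobSet a ∪ cobSet b)) :=
  cobSet_cobMk _ _

theorem cobSet_compl (a : El X.cobCarrier) : cobSet aᶜ = orth X.perp (cobSet a) :=
  cobSet_cobMk _ _

theorem cobSet_top : cobSet (⊤ : El X.cobCarrier) = Set.univ := cobSet_cobMk _ _

theorem cobSet_bot : cobSet (⊥ : El X.cobCarrier) = ∅ := cobSet_cobMk _ _

/-- `∃_i U = R_i[U]^⊥⊥` on `COB(X)`. -/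
noncomputable def cobEx (i : El I) (a : El X.cobCarrier) : El X.cobCarrier :=
  cobMk (orth X.perp (orth X.perp (relImage (X.R i) (cobSet a))))
    (VCUVO.image_mem i (cobSet_mem a))

theorem cobSet_cobEx (i : El I) (a : El X.cobCarrier) :
    cobSet (cobEx i a) = relImage (X.R i) (cobSet a) :=
  (cobSet_cobMk _ _).trans (VCUVO.biorth_image i (cobSet_mem a))

theorem isQuantifier_cobEx (i : El I) : IsQuantifier (cobEx (X := X) i) := by
  have hf := X.isCylindric.monadic i
  refine ⟨fun a b => le_antisymm ?_ ?_, cobSet_injective ?_, fun a => cobSet_injective ?_,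
    fun a => ?_, fun a => cobSet_injective ?_⟩
  · show cobSet _ ⊆ cobSet _
    rw [cobSet_cobEx, cobSet_sup, cobSet_sup, cobSet_cobEx, cobSet_cobEx]
    -- Additivity: the union of the two images is `R_i`-closed by transitivity, and `⊥` preserves
    -- `R_i`-closed sets. So its biorthogonal closure is `R_i`-closed, and it contains the join of
    -- `a` and `b`.
    have h1 : relImage (X.R i) (relImage (X.R i) (cobSet a) ∪ relImage (X.R i) (cobSet b)) =
        relImage (X.R i) (cobSet a) ∪ relImage (X.R i) (cobSet b) := by
      refine Set.Subset.antisymm ?_ (hf.subset_image _)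
      rintro y ⟨x, hx | hx, hxy⟩
      · exact .inl ((hf.image_image _).le ⟨x, hx, hxy⟩)
      · exact .inr ((hf.image_image _).le ⟨x, hx, hxy⟩)
    rw [← hf.image_orth_of (hf.image_orth_of h1)]
    exact relImage_mono (orth_anti (orth_anti
      (Set.union_subset_union (hf.subset_image _) (hf.subset_image _))))
  · have mono : ∀ c d : El X.cobCarrier, c ≤ d → cobEx i c ≤ cobEx i d := fun c d h => by
      show cobSet _ ⊆ cobSet _
      rw [cobSet_cobEx, cobSet_cobEx]
      exact relImage_mono h
    exact sup_le (mono _ _ le_sup_left) (mono _ _ le_sup_right)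
  · rw [cobSet_cobEx, cobSet_bot]
    exact Set.eq_empty_of_forall_notMem fun y ⟨x, hx, _⟩ => hx
  · rw [cobSet_cobEx, cobSet_cobEx, hf.image_image]
  · show cobSet _ ⊆ cobSet _
    rw [cobSet_cobEx]
    exact hf.subset_image _
  · rw [cobSet_cobEx, cobSet_compl, cobSet_cobEx, hf.image_orth_image]

variable (X)

noncomputable instance VCUVO.instCylindric : CylindricOrtholattice (El I) (El X.cobCarrier) where
  ex := cobEx
  diag i k := cobMk (X.Δ i k) (VCUVO.diag_mem i k)
  quantifier := isQuantifier_cobEx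
  ex_comm i k a := cobSet_injective <| by
    rw [cobSet_cobEx, cobSet_cobEx, cobSet_cobEx, cobSet_cobEx]
    ext z
    constructor
    · rintro ⟨y, ⟨x, hx, hxy⟩, hyz⟩
      obtain ⟨y', h1, h2⟩ := (X.isCylindric.comm i k x z).2 ⟨y, hxy, hyz⟩
      exact ⟨y', ⟨x, hx, h1⟩, h2⟩
    · rintro ⟨y, ⟨x, hx, hxy⟩, hyz⟩
      obtain ⟨y', h1, h2⟩ := (X.isCylindric.comm i k x z).1 ⟨y, hxy, hyz⟩
      exact ⟨y', ⟨x, hx, h1⟩, h2⟩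
  diag_symm i k := cobSet_injective <| by
    rw [cobSet_cobMk, cobSet_cobMk, X.isCylindric.diag_symm i k]
  diag_self i := cobSet_injective <| by
    rw [cobSet_cobMk, cobSet_top, X.isCylindric.diag_self i]
  ex_diag i k l h h' := cobSet_injective <| by
    rw [cobSet_cobEx, cobSet_inf, cobSet_cobMk, cobSet_cobMk, cobSet_cobMk,
      X.isCylindric.image_diag i k l h h']

variable {X}

theorem cobSet_ex (i : El I) (a : El X.cobCarrier) :
    cobSet (ex i a) = relImage (X.R i) (cobSet a) :=
  cobSet_cobEx i a

theorem cobSet_diag (i k : El I) : cobSet (diag i k : El X.cobCarrier) = X.Δ i k :=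
  cobSet_cobMk _ _

/-- Brings the graph of an operation on `COB(X)` into first-order form. -/
theorem cobSet_eq_iff {a b : El X.cobCarrier} :
    a = b ↔ ∀ x : El X.carrier, x ∈ cobSet a ↔ x ∈ cobSet b :=
  cobSet_injective.eq_iff.symm.trans Set.ext_iff

/-- The algebra of `X` in the model. -/
noncomputable abbrev VCUVO.alg (X : VCUVO I) : VCOL I where
  carrier := X.cobCarrier
  isSet_inf := isSetRel₃_of_defPred <|
    (inferInstance : DefPred fun p : El X.cobCarrier × El X.cobCarrier × El X.cobCarrier =>
      ∀ x : El X.carrier, (x ∈ cobSet p.1 ∧ x ∈ cobSet p.2.1) ↔ x ∈ cobSet p.2.2).congr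
    fun p => by rw [cobSet_eq_iff, cobSet_inf]; rfl
  isSet_sup := isSetRel₃_of_defPred <|
    (inferInstance : DefPred fun p : El X.cobCarrier × El X.cobCarrier × El X.cobCarrier =>
      ∀ x : El X.carrier, (∀ y : El X.carrier, (∀ z : El X.carrier,
        z ∈ cobSet p.1 ∨ z ∈ cobSet p.2.1 → X.perp y z) → X.perp x y) ↔ x ∈ cobSet p.2.2).congr
    fun p => by rw [cobSet_eq_iff, cobSet_sup]; rfl
  isSet_compl := isSetRel₂_of_defPred <|
    (inferInstance : DefPred fun p : El X.cobCarrier × El X.cobCarrier => ∀ x : El X.carrier,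
      (∀ y : El X.carrier, y ∈ cobSet p.1 → X.perp x y) ↔ x ∈ cobSet p.2).congr
    fun p => by rw [cobSet_eq_iff, cobSet_compl]; rfl
  isSet_ex := isSetRel₃_of_defPred <|
    (inferInstance : DefPred fun p : El I × El X.cobCarrier × El X.cobCarrier =>
      ∀ y : El X.carrier, (∃ x : El X.carrier, x ∈ cobSet p.2.1 ∧ X.R p.1 x y) ↔
        y ∈ cobSet p.2.2).congr
    fun p => by rw [cobSet_eq_iff, cobSet_ex]; rfl
  isSet_diag := isSetRel₃_of_defPred <|
    (inferInstance : DefPred fun p : El I × El I × El X.cobCarrier =>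
      ∀ x : El X.carrier, x ∈ X.Δ p.1 p.2.1 ↔ x ∈ cobSet p.2.2).congr
    fun p => by rw [cobSet_eq_iff, cobSet_diag]

theorem VCUVO.vIsCOBAlgebra_alg (X : VCUVO I) : VIsCOBAlgebra X X.alg where
  carrier := X.mem_cobCarrier
  inf := cobSet_inf (X := X)
  sup := cobSet_sup (X := X)
  compl := cobSet_compl (X := X)
  bot := cobSet_bot (X := X)
  top := cobSet_top (X := X)
  ex i a := (cobSet_ex (X := X) i a).trans (VCUVO.biorth_image i (cobSet_mem a)).symm
  diag := cobSet_diag (X := X)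

end ModelAlgebra

/-! ## The dual equivalence in a model -/

section ModelDuality

variable {V : Type w} [setLang.Structure V] {I : V}

/-- The filter axioms do not refer to the model, so the ordinary functor `S₁` can be applied to the
types of elements. -/
theorem CylHom.isProperFilter_preimage {A B : VCOL I}
    (h : CylHom (El I) (El A.carrier) (El B.carrier)) {F : Set (El B.carrier)}
    (hF : IsProperFilter F) : IsProperFilter {a | h.toFun a ∈ F} :=
  (S₁fun (A := ⟨El A.carrier⟩) (B := ⟨El B.carrier⟩) h ⟨F, hF⟩).2

/-- Cylindric UVO-maps commute with `^⊥` on open sets. -/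
theorem VIsCUVOMap.preimage_orth {X Y : VCUVO I} {f : El X.carrier → El Y.carrier}
    (hf : VIsCUVOMap X Y f) {U : Set (El Y.carrier)} (hU : VIsOpen Y.carrier Y.top U) :
    f ⁻¹' orth Y.perp U = orth X.perp (f ⁻¹' U) :=
  _root_.preimage_orth (le := fun z w => ∀ W, VIsOpen Y.carrier Y.top W → z ∈ W → w ∈ W)
    X.isCylindric.toIsOrthoframe Y.isCylindric.toIsOrthoframe hf.nonperp hf.lift
    (fun _ _ h => h U hU)

variable [IsZFModel V]

/-! ### The spectrum on homomorphisms of the model -/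

section SpecMap

variable {A B : VCOL I}

theorem exists_specFilter_eq_preimage (h : A ⟶ B) (x : El B.specCarrier) :
    ∃ y : El A.specCarrier, specFilter y = {a | h.1.toFun a ∈ specFilter x} := by
  have : DefFun fun a : El A.carrier => h.1.toFun a := DefFun.app h.2
  exact exists_specFilter_eq (h.1.isProperFilter_preimage (isProperFilter_specFilter x))
    (inferInstance : DefPred fun a : El A.carrier => h.1.toFun a ∈ specFilter x)

/-- The preimage map between the spectra in the model. -/
noncomputable def specMap (h : A ⟶ B) (x : El B.specCarrier) : El A.specCarrier :=
  (exists_specFilter_eq_preimage h x).choose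

theorem specFilter_specMap (h : A ⟶ B) (x : El B.specCarrier) :
    specFilter (specMap h x) = {a | h.1.toFun a ∈ specFilter x} :=
  (exists_specFilter_eq_preimage h x).choose_spec

theorem specMap_preimage_vphi (h : A ⟶ B) (a : El A.carrier) :
    specMap h ⁻¹' vphi a = vphi (h.1.toFun a) :=
  Set.ext fun x => Set.ext_iff.1 (specFilter_specMap h x) a

/-- That `y` is the preimage of `x` can be said elementwise, using the set that codes `h` as
parameter. -/
theorem isSetFun_specMap (h : A ⟶ B) : IsSetFun (specMap h) := by
  have : DefFun fun q : (El B.specCarrier × El A.specCarrier) × El A.carrier =>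
    h.1.toFun q.2 := DefFun.app h.2
  refine isSetFun_of_defPred <| (inferInstance : DefPred fun p : El B.specCarrier ×
    El A.specCarrier => ∀ a : El A.carrier,
      h.1.toFun a ∈ specFilter p.1 ↔ a ∈ specFilter p.2).congr fun p => ?_
  rw [← specFilter_injective.eq_iff, specFilter_specMap, Set.ext_iff]
  rfl

theorem vIsCUVOMap_specMap (h : A ⟶ B) : VIsCUVOMap B.spec A.spec (specMap h) where
  isSet := isSetFun_specMap h
  spectral U hU := by
    refine preimage_mem_VCO vIsTopology_spec (isSetFun_specMap h) (B := Set.range vphi)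
      ?_ (fun U hU x hx => ?_) ?_ hU
    · rintro _ ⟨a, rfl⟩
      exact vIsOpen_vphi a
    · obtain ⟨a, ha, haU⟩ := exists_vphi_subset hU hx
      exact ⟨_, ⟨a, rfl⟩, ha, haU⟩
    · rintro _ ⟨a, rfl⟩
      rw [specMap_preimage_vphi]
      exact vphi_mem_VCO _
  nonperp := by
    rintro x y hxy ⟨a, ha, ha'⟩
    rw [specFilter_specMap] at ha ha'
    refine hxy ⟨h.1.toFun a, ha, ?_⟩
    rw [← h.1.map_compl']
    exact ha'
  lift := by
    intro z y hzy
    have hz := isProperFilter_specFilter z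
    have hy := isProperFilter_specFilter y
    have hperp : ∀ a ∈ specFilter z, ¬ (h.1.toFun a)ᶜ ∈ specFilter y := fun a ha ha' =>
      hzy ⟨a, ha, by
        rw [specFilter_specMap]
        show h.1.toFun aᶜ ∈ specFilter y
        rwa [h.1.map_compl']⟩
    -- The lift is the filter generated by `h[z]`. If it were improper, some `a ∈ z` would have `h a
    -- = ⊥`, so `(h a)ᶜ = ⊤` would lie in `y`, against `hperp`.
    have hF : IsProperFilter {b : El B.carrier | ∃ a ∈ specFilter z, h.1.toFun a ≤ b} := by
      refine ⟨⟨⊤, ⊤, hz.top_mem, le_top⟩, ?_, ?_, fun hu => ?_⟩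
      · rintro b c ⟨a, ha, hab⟩ hbc
        exact ⟨a, ha, hab.trans hbc⟩
      · rintro b c ⟨a, ha, hab⟩ ⟨a', ha', hac⟩
        refine ⟨a ⊓ a', hz.inf_mem _ _ ha ha', ?_⟩
        rw [h.1.map_inf']
        exact inf_le_inf hab hac
      · obtain ⟨a, ha, hab⟩ := hu.ge (Set.mem_univ (⊥ : El B.carrier))
        refine hperp a ha ?_
        rw [le_bot_iff.1 hab, Ortholattice.compl_bot]
        exact hy.top_mem
    have : DefFun fun q : El B.carrier × El A.carrier => h.1.toFun q.2 := DefFun.app h.2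
    obtain ⟨x, hx⟩ := exists_specFilter_eq hF (inferInstance : DefPred fun b : El B.carrier =>
      ∃ a : El A.carrier, a ∈ specFilter z ∧ h.1.toFun a ≤ b)
    refine ⟨x, ?_, fun U hU hzU => ?_⟩
    · rintro ⟨b, hb, hb'⟩
      rw [hx] at hb
      obtain ⟨a, ha, hab⟩ := hb
      exact hperp a ha (hy.upward _ _ hb' (Ortholattice.compl_anti _ _ hab))
    · obtain ⟨a, ha, haU⟩ := exists_vphi_subset hU hzU
      refine haU ?_
      rw [← Set.mem_preimage, specMap_preimage_vphi]
      exact hx.ge ⟨a, ha, le_rfl⟩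
  image i U hU := by
    obtain ⟨a, rfl⟩ := VCOB_spec.le hU
    rw [specMap_preimage_vphi]
    refine (relImage_vphi i _).trans ?_
    rw [← h.1.map_ex', ← specMap_preimage_vphi]
    exact congrArg _ (relImage_vphi i a).symm
  diag i k := by
    refine (specMap_preimage_vphi h _).trans ?_
    rw [h.1.map_diag']

end SpecMap

/-- The contravariant functor `S_F` in the model. -/
noncomputable def vSpec (I : V) : (VCOL I)ᵒᵖ ⥤ VCUVO I where
  obj A := A.unop.spec
  map h := ⟨specMap h.unop, vIsCUVOMap_specMap h.unop⟩
  -- `specMap` comes from `choose`, so the functor laws are verified on the filters that determine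
  -- the points.
  map_id A := Subtype.ext <| funext fun x =>
    specFilter_injective (specFilter_specMap (𝟙 A.unop) x)
  map_comp {A B C} h g := Subtype.ext <| funext fun x => specFilter_injective <| by
    refine (specFilter_specMap (g.unop ≫ h.unop) x).trans ?_
    refine Eq.trans ?_ (specFilter_specMap g.unop (specMap h.unop x)).symm
    rw [specFilter_specMap]
    rfl

/-! ### The algebra on maps of the model -/

section AlgMap

variable {X Y : VCUVO I}

/-- The preimage map between the algebras in the model. -/
noncomputable def algMapFun (f : X ⟶ Y) (a : El Y.cobCarrier) : El X.cobCarrier :=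
  cobMk (f.1 ⁻¹' cobSet a) (f.2.preimage_mem (cobSet_mem a))

theorem cobSet_algMapFun (f : X ⟶ Y) (a : El Y.cobCarrier) :
    cobSet (algMapFun f a) = f.1 ⁻¹' cobSet a :=
  cobSet_cobMk _ _

/-- The preimage map as a homomorphism. -/
noncomputable def algMap (f : X ⟶ Y) : CylHom (El I) (El Y.cobCarrier) (El X.cobCarrier) where
  toFun := algMapFun f
  map_inf' a b := cobSet_injective <| by
    rw [cobSet_algMapFun, cobSet_inf, cobSet_inf, cobSet_algMapFun, cobSet_algMapFun]
    rfl
  map_top' := cobSet_injective <| by rw [cobSet_algMapFun, cobSet_top, cobSet_top]; rfl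
  map_bot' := cobSet_injective <| by rw [cobSet_algMapFun, cobSet_bot, cobSet_bot]; rfl
  map_sup' a b := cobSet_injective <| by
    show cobSet (algMapFun f (a ⊔ b)) = cobSet (algMapFun f a ⊔ algMapFun f b)
    rw [cobSet_algMapFun, cobSet_sup, cobSet_sup, cobSet_algMapFun, cobSet_algMapFun]
    have ht := Y.isCylindric.isTopology
    -- `preimage_orth` is applied twice, and its second use is for this set, which is open as an
    -- intersection of two members of `COB(Y)`.
    have h1 : VIsOpen Y.carrier Y.top (orth Y.perp (cobSet a ∪ cobSet b)) := by
      rw [orth_union]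
      exact ht.inter _ _ (Y.isCylindric.orth_mem _ (cobSet_mem a)).1.2
        (Y.isCylindric.orth_mem _ (cobSet_mem b)).1.2
    rw [f.2.preimage_orth h1,
      f.2.preimage_orth (VIsOpen.union ht (cobSet_mem a).1.2 (cobSet_mem b).1.2)]
    rfl
  map_compl' a := cobSet_injective <| by
    show cobSet (algMapFun f aᶜ) = cobSet (algMapFun f a)ᶜ
    rw [cobSet_algMapFun, cobSet_compl, cobSet_compl, cobSet_algMapFun,
      f.2.preimage_orth (cobSet_mem a).1.2]
  map_ex' i a := cobSet_injective <| by
    show cobSet (algMapFun f (ex i a)) = cobSet (ex i (algMapFun f a))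
    rw [cobSet_algMapFun, cobSet_ex, cobSet_ex, cobSet_algMapFun, f.2.image i _ (cobSet_mem a)]
  map_diag' i k := cobSet_injective <| by
    show cobSet (algMapFun f (diag i k)) = cobSet (diag i k)
    rw [cobSet_algMapFun, cobSet_diag, cobSet_diag, f.2.diag]

theorem isSetFun_algMap (f : X ⟶ Y) : IsSetFun fun a => algMap f a := by
  have : DefFun fun q : (El Y.cobCarrier × El X.cobCarrier) × El X.carrier =>
    f.1 q.2 := DefFun.app f.2.isSet
  refine isSetFun_of_defPred <| (inferInstance : DefPred fun p : El Y.cobCarrier ×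
    El X.cobCarrier => ∀ x : El X.carrier, f.1 x ∈ cobSet p.1 ↔ x ∈ cobSet p.2).congr fun p => ?_
  show algMapFun f p.1 = p.2 ↔ _
  rw [cobSet_eq_iff, cobSet_algMapFun]
  rfl

end AlgMap

/-- The contravariant functor `A_F` in the model. -/
noncomputable def vAlg (I : V) : (VCUVO I)ᵒᵖ ⥤ VCOL I where
  obj X := X.unop.alg
  map f := ⟨algMap f.unop, isSetFun_algMap f.unop⟩
  map_id X := Subtype.ext <| CylHom.ext_toFun fun a =>
    cobSet_injective (cobSet_algMapFun (𝟙 X.unop) a)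
  map_comp {X Y Z} f g := Subtype.ext <| CylHom.ext_toFun fun a => cobSet_injective <| by
    refine (cobSet_algMapFun (g.unop ≫ f.unop) a).trans ?_
    refine Eq.trans ?_ (cobSet_algMapFun g.unop (algMapFun f.unop a)).symm
    rw [cobSet_algMapFun]
    rfl

/-! ### The isomorphism `φ` in the model -/

section Phi

variable (A : VCOL I)

/-- The homomorphism `φ` in the model. -/
noncomputable def vphiHom : CylHom (El I) (El A.carrier) (El A.spec.cobCarrier) where
  toFun a := cobMk (X := A.spec) (vphi a) (vphi_mem_VCOB a)
  map_sup' a b := cobSet_injective <| by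
    rw [cobSet_sup, cobSet_cobMk, cobSet_cobMk, cobSet_cobMk]
    exact (orth_orth_union_vphi a b).symm
  map_inf' a b := cobSet_injective <| by
    rw [cobSet_inf, cobSet_cobMk, cobSet_cobMk, cobSet_cobMk]
    exact vphi_inf a b
  map_top' := cobSet_injective <| by
    rw [cobSet_top, cobSet_cobMk]
    exact vphi_top
  map_bot' := cobSet_injective <| by
    rw [cobSet_bot, cobSet_cobMk]
    exact vphi_bot
  map_compl' a := cobSet_injective <| by
    rw [cobSet_compl, cobSet_cobMk, cobSet_cobMk]
    exact (orth_vphi a).symm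
  map_ex' i a := cobSet_injective <| by
    rw [cobSet_ex, cobSet_cobMk, cobSet_cobMk]
    exact (relImage_vphi i a).symm
  map_diag' i k := cobSet_injective <| by
    rw [cobSet_diag, cobSet_cobMk]

theorem cobSet_vphiHom (a : El A.carrier) :
    cobSet ((vphiHom A).toFun a) = vphi a :=
  cobSet_cobMk _ (vphi_mem_VCOB a)

/-- Order reflection gives injectivity, and `VCOB_spec` gives surjectivity. -/
theorem vphiHom_bijective : Function.Bijective (vphiHom A).toFun := by
  constructor
  · intro a b h
    have h' := congrArg cobSet h
    rw [cobSet_vphiHom, cobSet_vphiHom] at h'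
    exact vphi_injective h'
  · intro b
    obtain ⟨a, ha⟩ := VCOB_spec.le (cobSet_mem b)
    exact ⟨a, cobSet_injective ((cobSet_vphiHom A a).trans ha)⟩

/-- `φ` as a bijection. -/
noncomputable def vphiEquiv : El A.carrier ≃ El A.spec.cobCarrier :=
  Equiv.ofBijective _ (vphiHom_bijective A)

theorem isSetFun_vphiEquiv : IsSetFun (vphiEquiv A) := by
  refine isSetFun_of_defPred <| (inferInstance : DefPred fun p : El A.carrier ×
    El A.spec.cobCarrier => ∀ x : El A.spec.carrier, x ∈ vphi p.1 ↔ x ∈ cobSet p.2).congr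
      fun p => ?_
  show (vphiHom A).toFun p.1 = p.2 ↔ _
  rw [cobSet_eq_iff, cobSet_vphiHom]

/-- `φ` as an isomorphism in the model. -/
noncomputable def vphiIso : A ≅ A.spec.alg where
  hom := ⟨vphiHom A, isSetFun_vphiEquiv A⟩
  inv := ⟨(vphiHom A).symm (vphiEquiv A) fun _ => rfl, isSetFun_symm (isSetFun_vphiEquiv A)⟩
  hom_inv_id := Subtype.ext <| CylHom.ext_toFun fun a => (vphiEquiv A).symm_apply_apply a
  inv_hom_id := Subtype.ext <| CylHom.ext_toFun fun a => (vphiEquiv A).apply_symm_apply a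

end Phi

/-- `φ` as a natural isomorphism in the model. -/
noncomputable def vphiNatIso (I : V) : 𝟭 (VCOL I) ≅ (vSpec I).rightOp ⋙ vAlg I :=
  NatIso.ofComponents vphiIso fun {A B} h => Subtype.ext <| CylHom.ext_toFun fun a =>
    cobSet_injective <| by
      refine (cobSet_vphiHom B (h.1.toFun a)).trans ?_
      refine Eq.trans ?_ (cobSet_algMapFun (X := B.spec) (Y := A.spec)
        ⟨specMap h, vIsCUVOMap_specMap h⟩ ((vphiHom A).toFun a)).symm
      rw [cobSet_vphiHom]
      exact (specMap_preimage_vphi h a).symm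

/-- An isomorphism of the structures of two cylindric UVO-spaces of the model is a cylindric
UVO-map. -/
theorem vIsCUVOMap_of_equiv {X Y : VCUVO I} (e : El X.carrier ≃ El Y.carrier) (he : IsSetFun e)
    (hB : ∀ U ∈ Y.cob, e ⁻¹' U ∈ VCO X.carrier X.top)
    (hp : ∀ x y, X.perp x y ↔ Y.perp (e x) (e y))
    (hR : ∀ i x y, X.R i x y ↔ Y.R i (e x) (e y)) (hΔ : ∀ i k, e ⁻¹' Y.Δ i k = X.Δ i k) :
    VIsCUVOMap X Y e where
  isSet := he
  spectral _ hU := preimage_mem_VCO X.isCylindric.isTopology he (fun _ hW => hW.1.2)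
    Y.isCylindric.basis hB hU
  nonperp x y h := by rwa [← hp]
  lift z y h := ⟨e.symm z, by rwa [hp, e.apply_symm_apply], by simp⟩
  image i U _ := by
    ext y
    constructor
    · rintro ⟨x, hx, hxy⟩
      exact ⟨e x, hx, (hR i x y).1 hxy⟩
    · rintro ⟨x, hx, hxy⟩
      refine ⟨e.symm x, by simpa using hx, ?_⟩
      rwa [hR, e.apply_symm_apply]
  diag := hΔ

/-! ### The isomorphism `ψ` in the model -/

section Psi

variable (X : VCUVO I)

theorem exists_specFilter_eq_nhds (x : El X.carrier) :
    ∃ y : El X.alg.specCarrier, specFilter y = {a : El X.cobCarrier | x ∈ cobSet a} := by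
  refine exists_specFilter_eq (A := X.alg) ⟨⟨(⊤ : El X.cobCarrier), ?_⟩, fun _ _ ha h => h ha,
    fun a b ha hb => ?_, fun h => ?_⟩
    (inferInstance : DefPred fun a : El X.cobCarrier => x ∈ cobSet a)
  · exact (cobSet_top (X := X)).ge trivial
  · show x ∈ cobSet (X := X) (a ⊓ b)
    rw [cobSet_inf]
    exact ⟨ha, hb⟩
  · have : x ∈ cobSet (⊥ : El X.cobCarrier) := h.ge (Set.mem_univ _)
    rw [cobSet_bot] at this
    exact this

/-- `ψ x`, the point of the spectrum of the algebra of `X` given by `x`. -/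
noncomputable def vpsi (x : El X.carrier) : El X.alg.specCarrier :=
  (exists_specFilter_eq_nhds X x).choose

theorem specFilter_vpsi (x : El X.carrier) :
    specFilter (vpsi X x) = {a : El X.cobCarrier | x ∈ cobSet a} :=
  (exists_specFilter_eq_nhds X x).choose_spec

theorem mem_specFilter_vpsi {x : El X.carrier} {a : El X.cobCarrier} :
    a ∈ specFilter (A := X.alg) (vpsi X x) ↔ x ∈ cobSet a :=
  Set.ext_iff.1 (specFilter_vpsi X x) a

theorem vpsi_bijective : Function.Bijective (vpsi X) := by
  constructor
  · intro x y h
    by_contra hxy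
    have key : ∀ W ∈ X.cob, x ∈ W ↔ y ∈ W := fun W hW => by
      obtain ⟨a, rfl⟩ := exists_cobSet_eq hW
      rw [← mem_specFilter_vpsi, h, mem_specFilter_vpsi]
    obtain ⟨U, hU, hn⟩ := X.isCylindric.t0 x y hxy
    refine hn ⟨fun hx => ?_, fun hy => ?_⟩
    · obtain ⟨W, hW, hxW, hWU⟩ := X.isCylindric.basis U hU x hx
      exact hWU ((key W hW).1 hxW)
    · obtain ⟨W, hW, hyW, hWU⟩ := X.isCylindric.basis U hU y hy
      exact hWU ((key W hW).2 hyW)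
  · intro y
    have hy := isProperFilter_specFilter y
    have hsub : ∀ u : V, u ∊ y.1 → u ∊ X.cobCarrier := ((X.alg.mem_specCarrier y.1).1 y.2).1
    -- A point `y` of the spectrum is itself a set of sets in the model, so `y.1` can serve directly
    -- as the family in the filter axiom.
    have hmem : ∀ a : El X.cobCarrier, cobSet a ∈ traceFamily X.carrier y.1 ↔
        a ∈ specFilter (A := X.alg) y := by
      refine fun a => ⟨?_, fun ha => ⟨a.1, ha, rfl⟩⟩
      rintro ⟨u, hu, hua⟩
      obtain rfl : (⟨u, hsub u hu⟩ : El X.cobCarrier) = a := cobSet_injective hua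
      exact hu
    have hex : ∀ U ∈ traceFamily X.carrier y.1, ∃ a : El X.cobCarrier, cobSet a = U := by
      rintro _ ⟨u, hu, rfl⟩
      exact ⟨⟨u, hsub u hu⟩, rfl⟩
    have hF : IsProperFilterIn X.cob (traceFamily X.carrier y.1) := by
      refine ⟨fun U hU => ?_, ?_, fun U W hU hW h => ?_, fun U W hU hW => ?_, fun h => ?_⟩
      · obtain ⟨a, rfl⟩ := hex U hU
        exact cobSet_mem a
      · obtain ⟨a, ha⟩ := hy.nonempty
        exact ⟨_, (hmem a).2 ha⟩
      · obtain ⟨a, rfl⟩ := hex U hU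
        obtain ⟨b, rfl⟩ := exists_cobSet_eq hW
        exact (hmem b).2 (hy.upward a b ((hmem a).1 hU) h)
      · obtain ⟨a, rfl⟩ := hex U hU
        obtain ⟨b, rfl⟩ := hex W hW
        rw [← cobSet_inf]
        exact (hmem _).2 (hy.inf_mem a b ((hmem a).1 hU) ((hmem b).1 hW))
      · refine hy.proper (Set.eq_univ_of_forall fun a => ?_)
        exact (hmem a).1 (h.ge (cobSet_mem a))
    obtain ⟨x, hx⟩ := X.isCylindric.filter _ hF
    refine ⟨x, specFilter_injective (Set.ext fun a => ?_)⟩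
    refine (mem_specFilter_vpsi X).trans (Iff.trans ?_ (hmem a))
    rw [hx]
    exact ⟨fun h => ⟨cobSet_mem a, h⟩, fun h => h.2⟩

/-- `ψ` as a bijection in the model. -/
noncomputable def vpsiEquiv : El X.carrier ≃ El X.alg.spec.carrier :=
  Equiv.ofBijective _ (vpsi_bijective X)

theorem mem_specFilter_vpsiEquiv {x : El X.carrier} {a : El X.cobCarrier} :
    a ∈ specFilter (A := X.alg) (vpsiEquiv X x) ↔ x ∈ cobSet a :=
  mem_specFilter_vpsi X

theorem isSetFun_vpsiEquiv : IsSetFun (vpsiEquiv X) := by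
  refine isSetFun_of_defPred <| (inferInstance : DefPred fun p : El X.carrier ×
    El X.alg.specCarrier => ∀ a : El X.cobCarrier, p.1 ∈ cobSet a ↔
      a ∈ specFilter (A := X.alg) p.2).congr fun p => ?_
  show vpsi X p.1 = p.2 ↔ _
  rw [← specFilter_injective.eq_iff, specFilter_vpsi, Set.ext_iff]
  rfl

theorem vpsiEquiv_preimage_vphi (a : El X.cobCarrier) :
    vpsiEquiv X ⁻¹' vphi (A := X.alg) a = cobSet a :=
  Set.ext fun _ => mem_specFilter_vpsi X

theorem vpsi_perp (x y : El X.carrier) :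
    X.perp x y ↔ X.alg.spec.perp (vpsiEquiv X x) (vpsiEquiv X y) := by
  constructor
  · intro h
    obtain ⟨U, hU, hx, hy⟩ := X.isCylindric.perp_sep x y h
    obtain ⟨a, rfl⟩ := exists_cobSet_eq hU
    refine ⟨a, (mem_specFilter_vpsiEquiv X).2 hx, (mem_specFilter_vpsiEquiv X).2 ?_⟩
    exact (cobSet_compl a).ge hy
  · rintro ⟨a, hx, hy⟩
    have hy' := (cobSet_compl (X := X) a).le ((mem_specFilter_vpsiEquiv X).1 hy)
    exact X.isCylindric.toIsOrthoframe.symm _ _ (hy' x ((mem_specFilter_vpsiEquiv X).1 hx))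

theorem vpsi_R (i : El I) (x y : El X.carrier) :
    X.R i x y ↔ X.alg.spec.R i (vpsiEquiv X x) (vpsiEquiv X y) := by
  constructor
  · intro h a ha
    refine (mem_specFilter_vpsiEquiv X).2 ((cobSet_ex (X := X) i a).ge ?_)
    exact ⟨x, (mem_specFilter_vpsiEquiv X).1 ha, h⟩
  · intro h
    by_contra hn
    obtain ⟨_, -, ⟨W, hW, hx, rfl⟩, hy⟩ := (X.isCylindric.monadicUVO i).rel_sep x y hn
    obtain ⟨a, rfl⟩ := exists_cobSet_eq hW
    -- The separating set `R_i[W]^⊥⊥` is `R_i[W]`, the point set of `∃_i a` for the element `a` with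
    -- point set `W`.
    rw [VCUVO.biorth_image i hW, ← cobSet_ex] at hy
    exact hy ((mem_specFilter_vpsiEquiv X).1 (h a ((mem_specFilter_vpsiEquiv X).2 hx)))

theorem vpsi_diag (i k : El I) : vpsiEquiv X ⁻¹' X.alg.spec.Δ i k = X.Δ i k :=
  (vpsiEquiv_preimage_vphi X _).trans (cobSet_diag i k)

theorem vIsCUVOMap_vpsi : VIsCUVOMap X X.alg.spec (vpsiEquiv X) := by
  refine vIsCUVOMap_of_equiv _ (isSetFun_vpsiEquiv X) (fun U hU => ?_) (vpsi_perp X) (vpsi_R X)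
    (vpsi_diag X)
  obtain ⟨a, rfl⟩ := VCOB_spec.le hU
  rw [vpsiEquiv_preimage_vphi]
  exact (cobSet_mem a).1

/-- Each member of `COB(X)` is the `vpsiEquiv`-preimage of some `vphi a`, hence pulls back along the
inverse to that compact open set. -/
theorem vIsCUVOMap_vpsi_symm : VIsCUVOMap X.alg.spec X (vpsiEquiv X).symm := by
  refine vIsCUVOMap_of_equiv _ (isSetFun_symm (isSetFun_vpsiEquiv X)) (fun U hU => ?_)
    (fun x y => ?_) (fun i x y => ?_) fun i k => ?_
  · obtain ⟨a, rfl⟩ := exists_cobSet_eq hU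
    rw [← vpsiEquiv_preimage_vphi, Equiv.symm_preimage_preimage]
    exact vphi_mem_VCO _
  · rw [vpsi_perp X, Equiv.apply_symm_apply, Equiv.apply_symm_apply]
  · rw [vpsi_R X, Equiv.apply_symm_apply, Equiv.apply_symm_apply]
  · rw [← vpsi_diag, Equiv.symm_preimage_preimage]

/-- `ψ` as an isomorphism in the model. -/
noncomputable def vpsiIso : X ≅ X.alg.spec where
  hom := ⟨vpsiEquiv X, vIsCUVOMap_vpsi X⟩
  inv := ⟨(vpsiEquiv X).symm, vIsCUVOMap_vpsi_symm X⟩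
  hom_inv_id := Subtype.ext (Equiv.symm_comp_self _)
  inv_hom_id := Subtype.ext (Equiv.self_comp_symm _)

end Psi

/-- `ψ` as a natural isomorphism in the model. -/
noncomputable def vpsiNatIso (I : V) : 𝟭 (VCUVO I) ≅ (vAlg I).rightOp ⋙ vSpec I :=
  NatIso.ofComponents vpsiIso fun {X Y} f => Subtype.ext <| funext fun x =>
    specFilter_injective <| by
      refine (specFilter_vpsi Y (f.1 x)).trans ?_
      refine Eq.trans ?_ (specFilter_specMap (A := Y.alg) (B := X.alg)
        ⟨algMap f, isSetFun_algMap f⟩ (vpsi X x)).symm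
      ext a
      refine Iff.trans ?_ (mem_specFilter_vpsi X (a := algMapFun f a)).symm
      rw [cobSet_algMapFun]
      rfl

end ModelDuality

/-! ### The duality, for types and inside every model of ZF -/

theorem mainTheorem1 :
    -- The functors `S_F` and `A_F` form a dual equivalence, by the natural isomorphisms `φ`, `ψ`.
    (∀ I : Type u,
      IsDualEquivalence (S_F.{u, v} I) (A_F.{u, v} I) ∧
      (∃ η : 𝟭 (COL.{u, v} I) ≅ (S_F I).rightOp ⋙ A_F I,
        ∀ (A : COL.{u, v} I) (a : A.carrier),
          ((η.hom.app A).toFun a).1 = phi a) ∧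
      ∃ θ : 𝟭 (CUVO.{u, v} I) ≅ (A_F I).rightOp ⋙ S_F I,
        ∀ (X : CUVO.{u, v} I) (x : X.carrier),
          ((θ.hom.app X).1 x).1 = {U : {U // U ∈ COB X.perp} | x ∈ U.1}) ∧
    -- The duality is choice-free: the same holds inside every model of ZF.
    (∀ (V : Type w) [setLang.Structure V] [IsZFModel V] (I : V),
      ∃ (S : (VCOL I)ᵒᵖ ⥤ VCUVO I) (A : (VCUVO I)ᵒᵖ ⥤ VCOL I),
        (∀ B : VCOL I, VIsSpectrum B (S.obj (.op B))) ∧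
        (∀ (B C : VCOL I) (h : B ⟶ C) (x : El (S.obj (.op C)).carrier),
          trace B.carrier ((S.map h.op).1 x).1 = {b | h.1 b ∈ trace C.carrier x.1}) ∧
        (∀ X : VCUVO I, VIsCOBAlgebra X (A.obj (.op X))) ∧
        (∀ (X Y : VCUVO I) (f : X ⟶ Y) (U : El (A.obj (.op Y)).carrier),
          trace X.carrier ((A.map f.op).1 U).1 = f.1 ⁻¹' trace Y.carrier U.1) ∧
        IsDualEquivalence S A ∧
        (∃ η : 𝟭 (VCOL I) ≅ S.rightOp ⋙ A, ∀ (B : VCOL I) (b : El B.carrier),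
          trace (S.obj (.op B)).carrier ((η.hom.app B).1 b).1 =
            {x | b ∈ trace B.carrier x.1}) ∧
        ∃ θ : 𝟭 (VCUVO I) ≅ A.rightOp ⋙ S, ∀ (X : VCUVO I) (x : El X.carrier),
          trace (A.obj (.op X)).carrier ((θ.hom.app X).1 x).1 =
            {U | x ∈ trace X.carrier U.1}) := by
  refine ⟨fun I => ⟨isDualEquivalence_of_natIso (phiNatIso I) (psiNatIso I),
    ⟨phiNatIso I, fun _ _ => rfl⟩, ⟨psiNatIso I, fun _ _ => rfl⟩⟩, fun V _ _ I => ?_⟩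
  exact ⟨vSpec I, vAlg I, VCOL.vIsSpectrum_spec, fun _ _ h x => specFilter_specMap h x,
    VCUVO.vIsCOBAlgebra_alg, fun _ _ f U => cobSet_algMapFun f U,
    isDualEquivalence_of_natIso (vphiNatIso I) (vpsiNatIso I),
    ⟨vphiNatIso I, cobSet_vphiHom⟩, ⟨vpsiNatIso I, specFilter_vpsi⟩⟩
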